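/- Let $U$ be a finite set of users and $R$ a finite set of resources. An authorization relation is a set $A\subseteq U\times R$; write $A(r)=\{u\in U:(u,r)\in A\}$ for $r\in R$. An instance of $\mathrm{APEP}\langle\mathsf{SoD_E}\rangle$ consists of $U$, $R$, a base relation $A_{\mathsf{Bse}}\subseteq U\times R$ with $A_{\mathsf{Bse}}(r)\neq\emptyset$ for every $r\in R$, and a finite set $C$ of existential separation-of-duty constraints $(r,r',\updownarrow,\exists)$ with $r,r'\in R$. A relation $A$ satisfies $(r,r',\updownarrow,\exists)$ if some $u\in A(r)\cup A(r')$ belongs to exactly one of $A(r)$ and $A(r')$, that is, if $A(r)\neq A(r')$. A relation $A$ is valid if $A\subseteq A_{\mathsf{Bse}}$, $A(r)\neq\emptyset$ for every $r\in R$, and $A$ satisfies every constraint in $C$. The problem $\mathrm{D\text{-}APEP}\langle\mathsf{SoD_E}\rangle$ asks to decide whether a valid authorization relation exists, and to find one if so. The problem $\mathrm{maxAPEP}\langle\mathsf{SoD_E}\rangle$ asks to find a valid authorization relation of maximum cardinality, or to report that no valid relation exists. **Theorem.** Both $\mathrm{D\text{-}APEP}\langle\mathsf{SoD_E}\rangle$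 and $\mathrm{maxAPEP}\langle\mathsf{SoD_E}\rangle$ can be solved in time $O^*(2^k)$, where $k=|R|$. That is, for each of the two problems there are an algorithm (a program for a random access machine with logarithmic cost) and a polynomial $q$ such that the algorithm solves every instance in time at most $2^k\,q(N)$, where $N$ is the total size of the input. -/

import Mathlib

namespace APEP

/-! ## Authorization relations and constraints -/

/-- The four binary logical operators used in constraints. -/
inductive LogicOp
  | iff
  | imp
  | revImp
  | xor

/-- Truth table of a logical operator (`xor` is the exclusive or, written `↕`). -/
def LogicOp.Holds : LogicOp → Prop → Prop → Prop
  | .iff, p, q => p ↔ q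
  | .imp, p, q => p → q
  | .revImp, p, q => q → p
  | .xor, p, q => (p ∧ ¬ q) ∨ (¬ p ∧ q)

/-- The two first-order quantifiers used in constraints. -/
inductive Quantifier
  | ex
  | all

/-- A constraint `(r, r', ∘, Q)` over the set of resources `R`. -/
structure Constraint (R : Type) where
  fst : R
  snd : R
  op : LogicOp
  quant : Quantifier

/-- `A(r)`, the set of users authorized for the resource `r`. -/
def usersOf {U R : Type} (A : Finset (U × R)) (r : R) : Set U :=
  {u | (u, r) ∈ A}

/-- The authorization relation `A` satisfies the constraint `c = (r, r', ∘, Q)`: the formula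
`(u ∈ A(r)) ∘ (u ∈ A(r'))` is true for some (resp. every) `u ∈ A(r) ∪ A(r')`. -/
def Satisfies {U R : Type} (A : Finset (U × R)) (c : Constraint R) : Prop :=
  match c.quant with
  | .ex => ∃ u ∈ usersOf A c.fst ∪ usersOf A c.snd,
      c.op.Holds (u ∈ usersOf A c.fst) (u ∈ usersOf A c.snd)
  | .all => ∀ u ∈ usersOf A c.fst ∪ usersOf A c.snd,
      c.op.Holds (u ∈ usersOf A c.fst) (u ∈ usersOf A c.snd)

/-- A family of constraints, over every (finite, numbered) set of resources. -/
abbrev ConstraintFamily : Type := ∀ k : ℕ, Set (Constraint (Fin k))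

/-- The existential separation-of-duty constraints `(r, r', ↕, ∃)`. -/
def SoDE : ConstraintFamily := fun _ => {c | c.op = .xor ∧ c.quant = .ex}

/-- An instance `(U, R, A_Bse, C)` with `U = {0, …, n - 1}` and `R = {0, …, k - 1}`. The finite
set `C` is given by a list, in any order and possibly with repetitions. -/
structure Instance where
  numUsers : ℕ
  numResources : ℕ
  base : Finset (Fin numUsers × Fin numResources)
  base_nonempty : ∀ r, (usersOf base r).Nonempty
  constraints : List (Constraint (Fin numResources))

/-- The authorization relations `A ⊆ U × R` of an instance. -/
abbrev Instance.AuthRel (I : Instance) : Type := Finset (Fin I.numUsers × Fin I.numResources)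

def Instance.Authorized (I : Instance) (A : I.AuthRel) : Prop := A ⊆ I.base

def Instance.Complete (I : Instance) (A : I.AuthRel) : Prop := ∀ r, (usersOf A r).Nonempty

def Instance.Eligible (I : Instance) (A : I.AuthRel) : Prop := ∀ c ∈ I.constraints, Satisfies A c

def Instance.Valid (I : Instance) (A : I.AuthRel) : Prop :=
  I.Authorized A ∧ I.Complete A ∧ I.Eligible A

/-! ## The two problems -/

/-- A problem on instances: which answers are correct. The answer is either `none`
("there is no valid authorization relation") or an authorization relation. -/
abbrev Problem : Type := ∀ I : Instance, Option I.AuthRel → Prop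

/-- D-APEP: decide whether a valid authorization relation exists, and find one if so. -/
def DAPEP : Problem := fun I ans =>
  match ans with
  | none => ∀ A : I.AuthRel, ¬ I.Valid A
  | some A => I.Valid A

/-- maxAPEP: find a valid authorization relation of maximum cardinality, if one exists. -/
def maxAPEP : Problem := fun I ans =>
  match ans with
  | none => ∀ A : I.AuthRel, ¬ I.Valid A
  | some A => I.Valid A ∧ ∀ A' : I.AuthRel, I.Valid A' → A'.card ≤ A.card

/-! ## Random access machines with logarithmic cost

The memory consists of banks of cells that hold natural numbers, addressed by natural numbers.
The bank used by an access is a constant of the program, so a program uses finitely many banks;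
the address within the bank is computed. Every operation is charged the number of bits of all the
numbers it handles (operands, addresses and contents). -/

/-- Memory: bank, address, content. -/
abbrev Memory : Type := ℕ → ℕ → ℕ

inductive ArithOp
  | add
  | sub
  | mul
  | div

/-- Arithmetic on natural numbers, with truncated subtraction, rounded division, `x / 0 = 0`. -/
def ArithOp.eval : ArithOp → ℕ → ℕ → ℕ
  | .add, x, y => x + y
  | .sub, x, y => x - y
  | .mul, x, y => x * y
  | .div, x, y => x / y

inductive Expr
  | const (v : ℕ)
  | read (bank : ℕ) (addr : Expr)
  | arith (o : ArithOp) (e₁ e₂ : Expr)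

def Expr.eval (s : Memory) : Expr → ℕ
  | .const v => v
  | .read b a => s b (a.eval s)
  | .arith o e₁ e₂ => o.eval (e₁.eval s) (e₂.eval s)

/-- Time to evaluate an expression (`Nat.size x` is the number of binary digits of `x`). -/
def Expr.time (s : Memory) : Expr → ℕ
  | .const v => v.size + 1
  | .read b a => a.time s + (a.eval s).size + (s b (a.eval s)).size + 1
  | .arith _ e₁ e₂ => e₁.time s + e₂.time s + (e₁.eval s).size + (e₂.eval s).size + 1

/-- Programs. In guards, a nonzero value means true. -/
inductive Program
  | skip
  | write (bank : ℕ) (addr val : Expr)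
  | seq (p q : Program)
  | ite (guard : Expr) (p q : Program)
  | loop (guard : Expr) (body : Program)

/-- Content of the memory after `v` is stored in bank `b` at address `a`. -/
def Memory.store (s : Memory) (b a v : ℕ) : Memory :=
  fun b' a' => if b' = b ∧ a' = a then v else s b' a'

/-- `Runs p s s' t`: started on the memory `s`, the program `p` halts with memory `s'` after
time `t`. -/
inductive Runs : Program → Memory → Memory → ℕ → Prop
  | skip (s : Memory) : Runs .skip s s 1
  | write (s : Memory) (b : ℕ) (a e : Expr) :
      Runs (.write b a e) s (s.store b (a.eval s) (e.eval s))
        (a.time s + e.time s + (a.eval s).size + (e.eval s).size + 1)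
  | seq {p q : Program} {s s' s'' : Memory} {t t' : ℕ} :
      Runs p s s' t → Runs q s' s'' t' → Runs (.seq p q) s s'' (t + t')
  | iteTrue {g : Expr} {p q : Program} {s s' : Memory} {t : ℕ} :
      g.eval s ≠ 0 → Runs p s s' t →
      Runs (.ite g p q) s s' (g.time s + (g.eval s).size + 1 + t)
  | iteFalse {g : Expr} {p q : Program} {s s' : Memory} {t : ℕ} :
      g.eval s = 0 → Runs q s s' t →
      Runs (.ite g p q) s s' (g.time s + (g.eval s).size + 1 + t)
  | loopTrue {g : Expr} {p : Program} {s s' s'' : Memory} {t t' : ℕ} :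
      g.eval s ≠ 0 → Runs p s s' t → Runs (.loop g p) s' s'' t' →
      Runs (.loop g p) s s'' (g.time s + (g.eval s).size + 1 + t + t')
  | loopFalse {g : Expr} {p : Program} {s : Memory} :
      g.eval s = 0 → Runs (.loop g p) s s (g.time s + (g.eval s).size + 1)

/-! ## Input, output, and running time -/

def LogicOp.code : LogicOp → ℕ
  | .iff => 0
  | .imp => 1
  | .revImp => 2
  | .xor => 3

def Quantifier.code : Quantifier → ℕ
  | .ex => 0
  | .all => 1

def Constraint.encode {k : ℕ} (c : Constraint (Fin k)) : List ℕ :=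
  [c.fst, c.snd, c.op.code, c.quant.code]

/-- The input word of an instance: `n, k, m`, then the `m` constraints, then the `n × k` matrix of
the base relation, row by row (one row for each user). -/
def Instance.encode (I : Instance) : List ℕ :=
  [I.numUsers, I.numResources, I.constraints.length]
    ++ I.constraints.flatMap Constraint.encode
    ++ (List.finRange I.numUsers).flatMap fun u =>
        (List.finRange I.numResources).map fun r => if (u, r) ∈ I.base then 1 else 0

/-- The total size of the input: the number of bits of the input word, plus one for each entry. -/
def Instance.size (I : Instance) : ℕ :=
  (I.encode.map fun x => x.size + 1).sum

/-- At the start, the input word is in bank `0`, and all other cells contain `0`. -/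
def Instance.initialMemory (I : Instance) : Memory :=
  fun b a => if b = 0 then I.encode.getD a 0 else 0

/-- The answer is read from bank `1`: cell `0` contains `0` if there is no solution; otherwise the
`n × k` matrix of the solution starts at cell `1`, row by row. -/
def Instance.answer (I : Instance) (s : Memory) : Option I.AuthRel :=
  if s 1 0 = 0 then none
  else some (Finset.univ.filter fun x => s 1 (1 + x.1 * I.numResources + x.2) = 1)

/-- `P⟨F⟩`, the problem `P` restricted to the instances all of whose constraints are in the family
`F`, can be solved in time `O*(f(k))`: a single program gives a correct answer for each such
instance in time at most `f(k)` times a polynomial in the size of the input, where `k` is the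
number of resources. -/
def SolvableInOStar (P : Problem) (F : ConstraintFamily) (f : ℕ → ℕ) : Prop :=
  ∃ (prog : Program) (q : Polynomial ℕ), ∀ I : Instance,
    (∀ c ∈ I.constraints, c ∈ F I.numResources) →
    ∃ (s : Memory) (t : ℕ), Runs prog I.initialMemory s t ∧ P I (I.answer s) ∧
      t ≤ f I.numResources * q.eval I.size

end APEP

/-! A relation is determined by the sets A(r). A valid one is therefore a coloring of the resources:
the color of r is a nonempty subset of A_Bse(r), and resources joined by a constraint get different
colors. maxAPEP asks for a coloring of largest total size, and a correct answer to it also answers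
D-APEP.

There may be 2^n colors, but k² of them suffice. Sets are collected until, for each r, every missing
admissible set is matched in size by k collected admissible ones (`Rich`). A resource with an
uncollected color can then be recolored without loss, because the other resources occupy at most k -
1 of these k sets (`MaskColoring.exists_rich`). A largest missing set is A_Bse(r) itself or a
collected set minus one user (`exists_candidate`), so each search inspects only polynomially many
candidates.

An optimal coloring with g ≤ k² colors is found by weighted inclusion-exclusion. The pair (c, v) has
weight Z^cost, where the cost counts the users of A_Bse(v) missing in c, or weight 0 if it is not
allowed. For a set X of resources, form the product over all colors of the weighted sums over
independent subsets of X. The alternating sum of these products over all X is, up to sign, the total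
weight of the families of g independent sets covering R (`coverTotal_eq`). A recursion on the
largest element (`indepSum_insert`) tabulates the sums for all 2^k sets X.

As Z exceeds the number of families, no carries occur: Z^W fails to divide the total exactly when
some coloring has cost below W (`pow_dvd_sum_iff`, `not_pow_dvd_coverTotal_iff`). The least such W
gives the optimum. Deleting weights as long as this test still succeeds isolates one optimal
coloring (`wp_reduce`).

All numbers have polynomially many bits, so logarithmic cost contributes only a polynomial factor.
`WP` accounts for steps and bit lengths together, and the step count is affine in 2^k
(`solveSteps_le_mul`). -/

namespace APEP

/-! ## A program logic that counts steps and bounds the contents of the memory -/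

instance : Add Expr := ⟨.arith .add⟩
instance : Sub Expr := ⟨.arith .sub⟩
instance : Mul Expr := ⟨.arith .mul⟩
instance : Div Expr := ⟨.arith .div⟩
instance (n : ℕ) : OfNat Expr n := ⟨.const n⟩

/-- The register of bank `b`, its cell `0`. -/
def Expr.reg (b : ℕ) : Expr := .read b 0

namespace Expr

variable (s : Memory) (e f : Expr)

@[simp] theorem eval_add : (e + f).eval s = e.eval s + f.eval s := rfl
@[simp] theorem eval_sub : (e - f).eval s = e.eval s - f.eval s := rfl
@[simp] theorem eval_mul : (e * f).eval s = e.eval s * f.eval s := rfl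
@[simp] theorem eval_div : (e / f).eval s = e.eval s / f.eval s := rfl
@[simp] theorem eval_zero : (0 : Expr).eval s = 0 := rfl
@[simp] theorem eval_one : (1 : Expr).eval s = 1 := rfl
@[simp] theorem eval_two : (2 : Expr).eval s = 2 := rfl
@[simp] theorem eval_three : (3 : Expr).eval s = 3 := rfl
@[simp] theorem eval_four : (4 : Expr).eval s = 4 := rfl
@[simp] theorem eval_reg (b : ℕ) : (reg b).eval s = s b 0 := rfl
@[simp] theorem eval_read (b : ℕ) : (read b e).eval s = s b (e.eval s) := rfl

/-- The number of nodes of an expression. -/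
def nodes : Expr → ℕ
  | .const _ => 1
  | .read _ a => a.nodes + 1
  | .arith _ a b => a.nodes + b.nodes + 1

/-- All constants have at most three bits. -/
def smallConsts : Expr → Bool
  | .const v => v < 8
  | .read _ a => a.smallConsts
  | .arith _ a b => a.smallConsts && b.smallConsts

/-- Expressions whose evaluation counts as one step. -/
def ok (e : Expr) : Bool := e.smallConsts && decide (e.nodes ≤ 100)

end Expr

/-- All memory cells have at most `B` bits, where `B ≥ 3`. -/
def Memory.Bounded (B : ℕ) (s : Memory) : Prop := 3 ≤ B ∧ ∀ b a, s b a < 2 ^ B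

/-- A cell has at most `B` bits, and an operation yields at most the bits of its operands plus one.
Intermediate values may exceed `B` bits and are charged too, so they need a bound of their own. -/
theorem Expr.size_eval_le {B : ℕ} {s : Memory} (hs : s.Bounded B) (e : Expr)
    (he : e.smallConsts = true) : (e.eval s).size ≤ e.nodes * B := by
  induction e with
  | const v =>
    have hv : v < 8 := by simpa [smallConsts] using he
    have : v < 2 ^ B := lt_of_lt_of_le hv (by
      calc 8 = 2 ^ 3 := rfl
        _ ≤ 2 ^ B := Nat.pow_le_pow_right (by norm_num) hs.1)
    simpa [Expr.eval, nodes] using Nat.size_le.2 this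
  | read b a ih =>
    refine (Nat.size_le.2 (hs.2 b _)).trans ?_
    simp only [nodes]; nlinarith
  | arith o e f ihe ihf =>
    simp only [smallConsts, Bool.and_eq_true] at he
    have h1 := Nat.size_le.1 (ihe he.1)
    have h2 := Nat.size_le.1 (ihf he.2)
    have hB := hs.1
    simp only [Expr.eval, nodes]
    rw [Nat.size_le]
    have hpow : (2 : ℕ) ^ ((e.nodes + f.nodes + 1) * B)
        = 2 ^ (e.nodes * B) * 2 ^ (f.nodes * B) * 2 ^ B := by
      rw [← pow_add, ← pow_add]; ring_nf
    have hB2 : 2 ≤ 2 ^ B := by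
      calc 2 = 2 ^ 1 := rfl
        _ ≤ 2 ^ B := Nat.pow_le_pow_right (by norm_num) (by omega)
    rw [hpow]
    set x := e.eval s
    set y := f.eval s
    set X := 2 ^ (e.nodes * B)
    set Y := 2 ^ (f.nodes * B)
    have hXY : X * Y * 2 ≤ X * Y * 2 ^ B := Nat.mul_le_mul_left _ hB2
    have hX : X ≤ X * Y := Nat.le_mul_of_pos_right _ (by omega)
    have hY : Y ≤ X * Y := Nat.le_mul_of_pos_left _ (by omega)
    cases o <;> simp only [ArithOp.eval]
    · omega
    · omega
    · have : x * y < X * Y := Nat.mul_lt_mul'' h1 h2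
      omega
    · have := Nat.div_le_self x y
      omega

/-- Each node is charged the sizes of its operands, which are linear in nodes times `B`; summing
over the nodes makes the bound quadratic. -/
theorem Expr.time_le {B : ℕ} {s : Memory} (hs : s.Bounded B) (e : Expr)
    (he : e.smallConsts = true) : e.time s ≤ 3 * e.nodes ^ 2 * (B + 1) := by
  induction e with
  | const v =>
    have := Expr.size_eval_le hs (.const v) he
    simp only [Expr.eval, nodes] at this
    simp only [Expr.time, nodes]; omega
  | read b a ih =>
    have h1 := Expr.size_eval_le hs a he
    have h2 := Nat.size_le.2 (hs.2 b (a.eval s))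
    have h3 := ih he
    simp only [Expr.time, nodes]
    nlinarith
  | arith o e f ihe ihf =>
    simp only [smallConsts, Bool.and_eq_true] at he
    have h1 := Expr.size_eval_le hs e he.1
    have h2 := Expr.size_eval_le hs f he.2
    have h3 := ihe he.1
    have h4 := ihf he.2
    simp only [Expr.time, nodes]
    nlinarith [Nat.zero_le (e.nodes * f.nodes), Nat.zero_le (e.nodes * f.nodes * B),
      Nat.zero_le (e.nodes * B), Nat.zero_le (f.nodes * B)]

/-- The time allowed for one step. -/
def stepTime (B : ℕ) : ℕ := 70000 * (B + 1)

theorem Expr.ok_bounds {B : ℕ} {s : Memory} (hs : s.Bounded B) {e : Expr} (he : e.ok = true) :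
    e.time s ≤ 30000 * (B + 1) ∧ (e.eval s).size ≤ 100 * B := by
  simp only [Expr.ok, Bool.and_eq_true, decide_eq_true_eq] at he
  refine ⟨(e.time_le hs he.1).trans ?_,
    (e.size_eval_le hs he.1).trans (Nat.mul_le_mul_right _ he.2)⟩
  have : e.nodes ^ 2 ≤ 100 ^ 2 := Nat.pow_le_pow_left he.2 2
  calc 3 * e.nodes ^ 2 * (B + 1) ≤ 3 * 100 ^ 2 * (B + 1) := by gcongr
    _ = _ := by norm_num

/-- The program contains a `write` into bank `b`. -/
def Program.writes (b : ℕ) : Program → Bool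
  | .skip => false
  | .write b' _ _ => b' == b
  | .seq p q => p.writes b || q.writes b
  | .ite _ p q => p.writes b || q.writes b
  | .loop _ p => p.writes b

/-- The expression reads no bank that the program writes. -/
def Expr.indep (p : Program) : Expr → Bool
  | .const _ => true
  | .read b a => !p.writes b && a.indep p
  | .arith _ e f => e.indep p && f.indep p

/-- The memories agree outside the banks that the program writes. -/
def Frame (p : Program) (s s' : Memory) : Prop := ∀ b, p.writes b = false → s' b = s b

theorem Frame.eval {p : Program} {s s' : Memory} (h : Frame p s s') {e : Expr}
    (he : e.indep p = true) : e.eval s' = e.eval s := by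
  induction e with
  | const v => rfl
  | read b a ih =>
    simp only [Expr.indep, Bool.and_eq_true, Bool.not_eq_true'] at he
    simp only [Expr.eval, ih he.2, h b he.1]
  | arith o e f ihe ihf =>
    simp only [Expr.indep, Bool.and_eq_true] at he
    simp only [Expr.eval, ihe he.1, ihf he.2]

theorem Memory.store_of_ne (s : Memory) {b b' : ℕ} (h : b' ≠ b) (a v : ℕ) :
    s.store b a v b' = s b' := by
  funext a'; simp [Memory.store, h]

theorem Runs.frame {p : Program} {s s' : Memory} {t : ℕ} (h : Runs p s s' t) : Frame p s s' := by
  induction h with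
  | skip s => intro b _; rfl
  | write s b a e =>
    intro b' hb
    exact Memory.store_of_ne _ (by rintro rfl; simp [Program.writes] at hb) _ _
  | seq _ _ ih1 ih2 =>
    intro b hb
    simp only [Program.writes, Bool.or_eq_false_iff] at hb
    rw [ih2 b hb.2, ih1 b hb.1]
  | iteTrue _ _ ih =>
    intro b hb
    simp only [Program.writes, Bool.or_eq_false_iff] at hb
    exact ih b hb.1
  | iteFalse _ _ ih =>
    intro b hb
    simp only [Program.writes, Bool.or_eq_false_iff] at hb
    exact ih b hb.2
  | loopTrue _ _ _ ih1 ih2 =>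
    intro b hb
    rw [ih2 b hb, ih1 b hb]
  | loopFalse _ => intro b _; rfl

/-- Started on `s`, whose cells are assumed to have at most `B` bits, the program halts within `N`
steps on a memory that satisfies `Q` and whose cells have at most `B` bits. -/
def WP (B : ℕ) (p : Program) (s : Memory) (N : ℕ) (Q : Memory → Prop) : Prop :=
  s.Bounded B → ∃ s' t, Runs p s s' t ∧ s'.Bounded B ∧ t ≤ N * stepTime B ∧ Q s'

namespace WP

variable {B N N' : ℕ} {p q : Program} {s : Memory} {Q Q' : Memory → Prop}

/-- The frame condition comes for free from the run. As `writes` is computable, later proofs obtain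
each unchanged bank by `rfl`. -/
theorem conseq (h : WP B p s N Q) (hN : N ≤ N') (hQ : ∀ s', Frame p s s' → Q s' → Q' s') :
    WP B p s N' Q' := by
  intro hs
  obtain ⟨s', t, hr, hb, ht, hq⟩ := h hs
  exact ⟨s', t, hr, hb, ht.trans (Nat.mul_le_mul_right _ hN), hQ s' hr.frame hq⟩

theorem mono (h : WP B p s N Q) (hN : N ≤ N') : WP B p s N' Q :=
  h.conseq hN fun _ _ => id

theorem skip (h : Q s) : WP B .skip s 1 Q := fun hs =>
  ⟨s, 1, .skip s, hs, by simp only [stepTime]; omega, h⟩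

theorem write {b a' v : ℕ} {a e : Expr} (haddr : a.eval s = a') (hval : e.eval s = v)
    (hv : v < 2 ^ B) (h : Q (s.store b a' v)) (ha : a.ok = true := by rfl)
    (he : e.ok = true := by rfl) : WP B (.write b a e) s 1 Q := by
  subst haddr hval
  intro hs
  refine ⟨_, _, .write s b a e, ⟨hs.1, fun b' a' => ?_⟩, ?_, h⟩
  · simp only [Memory.store]
    split_ifs
    · exact hv
    · exact hs.2 _ _
  -- Two evaluations at 30000 * (B + 1) each and two sizes of at most 100 * B: this is what the
  -- constant 70000 in `stepTime` covers.
  · have h1 := Expr.ok_bounds hs ha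
    have h2 := Expr.ok_bounds hs he
    simp only [stepTime]; omega

theorem seq {N₁ N₂ : ℕ} (h : WP B p s N₁ fun s' => WP B q s' N₂ Q) :
    WP B (.seq p q) s (N₁ + N₂) Q := by
  intro hs
  obtain ⟨s', t, hr, hb, ht, hq⟩ := h hs
  obtain ⟨s'', t', hr', hb', ht', hq'⟩ := hq hb
  exact ⟨s'', t + t', .seq hr hr', hb', by rw [add_mul]; omega, hq'⟩

theorem call {N₁ N₂ : ℕ} {P : Memory → Prop} (h : WP B p s N₁ P)
    (h' : ∀ s', Frame p s s' → P s' → WP B q s' N₂ Q) : WP B (.seq p q) s (N₁ + N₂) Q :=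
  seq (h.conseq le_rfl h')

theorem set {N₂ b a' v : ℕ} {a e : Expr} (haddr : a.eval s = a') (hval : e.eval s = v)
    (hv : v < 2 ^ B) (h : WP B q (s.store b a' v) N₂ Q) (ha : a.ok = true := by rfl)
    (he : e.ok = true := by rfl) : WP B (.seq (.write b a e) q) s (N₂ + 1) Q :=
  mono (seq (write haddr hval hv h ha he)) (by omega)

theorem ite {g : Expr} {N₁ N₂ : ℕ} (h₁ : g.eval s ≠ 0 → WP B p s N₁ Q)
    (h₂ : g.eval s = 0 → WP B q s N₂ Q) (hg : g.ok = true := by rfl) :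
    WP B (.ite g p q) s (N₁ + N₂ + 1) Q := by
  intro hs
  have h := Expr.ok_bounds hs hg
  by_cases h0 : g.eval s = 0
  · obtain ⟨s', t, hr, hb, ht, hq⟩ := h₂ h0 hs
    refine ⟨s', _, .iteFalse h0 hr, hb, ?_, hq⟩
    have : stepTime B = 70000 * (B + 1) := rfl
    rw [add_mul, add_mul]; omega
  · obtain ⟨s', t, hr, hb, ht, hq⟩ := h₁ h0 hs
    refine ⟨s', _, .iteTrue h0 hr, hb, ?_, hq⟩
    have : stepTime B = 70000 * (B + 1) := rfl
    rw [add_mul, add_mul]; omega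

end WP

/-- `for x < e do p`: the loop variable is the register of bank `x`. -/
def Program.forLoop (x : ℕ) (e : Expr) (p : Program) : Program :=
  .seq (.write x 0 0) (.loop (e - .reg x) (.seq p (.write x 0 (.reg x + 1))))

/-- A round costs `M` for the body and one step each for guard and increment; the final 2 counts the
initialization and the last guard. The loop register changes between rounds, so the invariant must
be insensitive to it (`hI`). For concrete programs the side conditions hold by computation. -/
theorem WP.forLoop {B M n x : ℕ} {e : Expr} {p : Program} {s : Memory} {Q : Memory → Prop}
    (Inv : ℕ → Memory → Prop) (hval : e.eval s = n) (hn : n < 2 ^ B)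
    (h0 : Inv 0 s)
    (hstep : ∀ i < n, ∀ s', Frame (.forLoop x e p) s s' → s' x 0 = i → Inv i s' →
      WP B p s' M (Inv (i + 1)))
    (hpost : ∀ s', Frame (.forLoop x e p) s s' → Inv n s' → Q s')
    (hI : ∀ i s' v, Inv i s' → Inv i (s'.store x 0 v) := by exact fun _ _ _ h => h)
    (hx : p.writes x = false := by rfl)
    (he : e.indep (.forLoop x e p) = true := by rfl)
    (hok : (e - .reg x).ok = true := by rfl) :
    WP B (.forLoop x e p) s (n * (M + 2) + 2) Q := by
  have key : ∀ d i, i + d = n → ∀ s', Frame (.forLoop x e p) s s' → s' x 0 = i → Inv i s' →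
      WP B (.loop (e - .reg x) (.seq p (.write x 0 (.reg x + 1)))) s' (d * (M + 2) + 1)
        fun s'' => Frame (.forLoop x e p) s s'' ∧ Inv n s'' := by
    intro d
    induction d with
    | zero =>
      intro i hi s' hf hxi hinv hs
      have h := Expr.ok_bounds hs hok
      obtain rfl : i = n := by omega
      refine ⟨s', _, .loopFalse ?_, hs, ?_, hf, hinv⟩
      · simp [hf.eval he, hval, hxi]
      · simp only [stepTime]; omega
    | succ d ih =>
      intro i hi s' hf hxi hinv hs
      have h := Expr.ok_bounds hs hok
      have hg : (e - .reg x).eval s' ≠ 0 := by simp [hf.eval he, hval, hxi]; omega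
      obtain ⟨s₁, t₁, hr₁, hb₁, ht₁, hq₁⟩ := hstep i (by omega) s' hf hxi hinv hs
      have hfr := hr₁.frame
      have hx1 : s₁ x 0 = i := by rw [hfr x hx, hxi]
      have hw : WP B (.write x 0 (.reg x + 1)) s₁ 1 fun s₂ =>
          Frame (.forLoop x e p) s s₂ ∧ s₂ x 0 = i + 1 ∧ Inv (i + 1) s₂ := by
        refine WP.write (v := i + 1) rfl (by simp [hx1]) (by omega) ⟨?_, ?_, ?_⟩
        · intro b hb
          have hb' := hb
          simp only [Program.forLoop, Program.writes, Bool.or_eq_false_iff, beq_eq_false_iff_ne]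
            at hb'
          rw [Memory.store_of_ne _ (Ne.symm hb'.1), hfr b hb'.2.1, hf b hb]
        · simp [Memory.store]
        · exact hI _ _ _ hq₁
      obtain ⟨s₂, t₂, hr₂, hb₂, ht₂, hf₂, hx₂, hinv₂⟩ := hw hb₁
      obtain ⟨s₃, t₃, hr₃, hb₃, ht₃, hq₃⟩ := ih (i + 1) (by omega) s₂ hf₂ hx₂ hinv₂ hb₂
      refine ⟨s₃, _, .loopTrue hg (.seq hr₁ hr₂) hr₃, hb₃, ?_, hq₃⟩
      have hu : stepTime B = 70000 * (B + 1) := rfl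
      have : ((d + 1) * (M + 2) + 1) * stepTime B
          = M * stepTime B + 2 * stepTime B + (d * (M + 2) + 1) * stepTime B := by ring
      rw [this]; omega
  have := WP.seq (B := B) (p := .write x 0 0)
    (q := .loop (e - .reg x) (.seq p (.write x 0 (.reg x + 1)))) (s := s) (N₁ := 1)
    (N₂ := n * (M + 2) + 1) (Q := fun s'' => Frame (.forLoop x e p) s s'' ∧ Inv n s'')
    (WP.write rfl rfl (by simp) (key n 0 (by omega) _ (by
      intro b hb
      simp only [Program.forLoop, Program.writes, Bool.or_eq_false_iff, beq_eq_false_iff_ne]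
            at hb
      exact Memory.store_of_ne _ (Ne.symm hb.1) _ _) (by simp [Memory.store]) (hI _ _ _ h0)))
  exact this.conseq (by omega) fun s' _ h => hpost s' h.1 h.2

end APEP

namespace APEP

open Finset

/-! ## The program

Banks `0` and `1` hold the input and the output. The arrays are: `3` the adjacency matrix of the
constraints, `4` the parities of the sets of resources, `5` the flags of the masks that are not
available as new colors, `6` the colors (sets of users, as masks), `23` the weights, `25` the
products over the colors, `26` the sums over independent sets. All other banks are registers. -/

namespace Prog

open Program APEP.Expr

/-- The numbers of users, resources, and constraints. -/
abbrev numU : Expr := .read 0 0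
abbrev numR : Expr := .read 0 1
abbrev numC : Expr := .read 0 2

/-- The entry of the base relation for user `u` and resource `r`. -/
abbrev baseEntry (u r : Expr) : Expr := .read 0 (3 + 4 * numC + u * numR + r)

abbrev modTwo (e : Expr) : Expr := e - e / 2 * 2

infixr:30 " ;; " => Program.seq

/-- Register `12` receives the weight of mask `10` for resource `11`, with parameters in registers
`8` and `9`. -/
def weight : Program :=
  .write 12 0 1 ;; .write 13 0 (reg 10) ;;
  forLoop 14 numU
    (.write 15 0 (modTwo (reg 13)) ;;
     .write 12 0 (reg 12 * (baseEntry (reg 14) (reg 11) * (reg 15 * reg 8 + (1 - reg 15) * reg 9)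
        + (1 - baseEntry (reg 14) (reg 11)) * (1 - reg 15))) ;;
     .write 13 0 (reg 13 / 2))

/-- Register `16` receives the mask of the users that may access resource `11`. -/
def baseMask : Program :=
  .write 16 0 0 ;; .write 17 0 1 ;;
  forLoop 14 numU
    (.write 16 0 (reg 16 + baseEntry (reg 14) (reg 11) * reg 17) ;;
     .write 17 0 (reg 17 * 2))

/-- Replace the mask in register `19`, of weight in register `20`, by the mask in register `10` if
that is available and has larger weight. -/
def tryMask : Program :=
  weight ;;
  .ite (reg 12 * (1 - .read 5 (reg 10)) - reg 20)
    (.write 19 0 (reg 10) ;; .write 20 0 (reg 12)) .skip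

/-- Search for an available mask of largest weight for resource `11`. -/
def search : Program :=
  .write 19 0 0 ;; .write 20 0 0 ;; .write 10 0 (reg 16) ;; tryMask ;;
  forLoop 21 (reg 7)
    (.write 17 0 1 ;;
     forLoop 22 numU
      (.write 10 0 (.read 6 (reg 21) - reg 17) ;; tryMask ;; .write 17 0 (reg 17 * 2)))

/-- Collect the colors. -/
def colors : Program :=
  .write 8 0 2 ;; .write 9 0 1 ;; .write 5 0 1 ;; .write 7 0 0 ;;
  forLoop 11 numR
    (baseMask ;;
     forLoop 18 numR
      (search ;;
       .ite (reg 20)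
        (.write 6 (reg 7) (reg 19) ;; .write 5 (reg 19) 1 ;; .write 7 0 (reg 7 + 1)) .skip))

/-- Compute `2 ^ k` and the parities of the sets of resources. -/
def parities : Program :=
  .write 2 0 1 ;;
  forLoop 44 numR
    (forLoop 45 (reg 2) (.write 4 (reg 2 + reg 45) (1 - .read 4 (reg 45))) ;;
     .write 2 0 (reg 2 * 2))

/-- Compute the adjacency matrix of the constraints. -/
def adjacency : Program :=
  forLoop 46 numC
    (.write 3 (.read 0 (3 + 4 * reg 46) * numR + .read 0 (4 + 4 * reg 46)) 1)

/-- Register `32` receives the mask of the elements of mask `31` not adjacent to `30`. -/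
def removeNeighbors : Program :=
  .write 32 0 0 ;; .write 33 0 1 ;; .write 34 0 (reg 31) ;;
  forLoop 35 numR
    (.write 32 0 (reg 32 + modTwo (reg 34) *
        (1 - (.read 3 (reg 30 * numR + reg 35) + .read 3 (reg 35 * numR + reg 30))) * reg 33) ;;
     .write 33 0 (reg 33 * 2) ;; .write 34 0 (reg 34 / 2))

/-- Fill bank `26` with the sums over independent sets for color `28`. -/
def indepSums : Program :=
  .write 26 0 1 ;; .write 29 0 1 ;;
  forLoop 30 numR
    (forLoop 31 (reg 29)
      (removeNeighbors ;;
       .write 26 (reg 29 + reg 31) (.read 26 (reg 31) +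
          .read 23 (reg 28 * numR + reg 30) * .read 26 (reg 32))) ;;
     .write 29 0 (reg 29 * 2))

/-- Fill bank `25` with the products over all colors. -/
def products : Program :=
  forLoop 27 (reg 2) (.write 25 (reg 27) 1) ;;
  forLoop 28 (reg 7)
    (indepSums ;;
     forLoop 27 (reg 2) (.write 25 (reg 27) (.read 25 (reg 27) * .read 26 (reg 27))))

/-- Register `38` receives the total weight of the covers. -/
def total : Program :=
  products ;;
  .write 36 0 0 ;; .write 37 0 0 ;;
  forLoop 27 (reg 2)
    (.ite (.read 4 (reg 27)) (.write 37 0 (reg 37 + .read 25 (reg 27)))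
      (.write 36 0 (reg 36 + .read 25 (reg 27)))) ;;
  .write 38 0 ((reg 36 - reg 37) + (reg 37 - reg 36))

/-- Fill bank `23` with the weights. -/
def weights : Program :=
  .write 8 0 1 ;; .write 9 0 2 ;;
  forLoop 24 (reg 7) (.write 9 0 (reg 9 * reg 2)) ;;
  forLoop 24 (reg 7)
    (forLoop 11 numR
      (.write 10 0 (.read 6 (reg 24)) ;; weight ;;
       -- A diagonal entry of the matrix marks an unsatisfiable constraint of a resource with
       -- itself; weight 0 for all colors then rules out every cover.
       .write 23 (reg 24 * numR + reg 11) (reg 12 * (1 - .read 3 (reg 11 * numR + reg 11)))))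

abbrev totalModD : Expr := reg 38 - reg 38 / reg 39 * reg 39

/-- Register `39` receives the least power of register `9` that does not divide the total. -/
def modulus : Program :=
  .write 39 0 1 ;;
  forLoop 40 (numR * numU + 1) (.ite totalModD .skip (.write 39 0 (reg 39 * reg 9)))

/-- Delete weights as long as an optimal cover remains. -/
def reduce : Program :=
  forLoop 24 (reg 7)
    (forLoop 11 numR
      (.write 41 0 (.read 23 (reg 24 * numR + reg 11)) ;;
       .write 23 (reg 24 * numR + reg 11) 0 ;; total ;;
       .ite totalModD .skip (.write 23 (reg 24 * numR + reg 11) (reg 41))))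

/-- Write the answer. -/
def output : Program :=
  .write 1 0 1 ;;
  forLoop 24 (reg 7)
    (forLoop 11 numR
      (.ite (.read 23 (reg 24 * numR + reg 11))
        (.write 42 0 (.read 6 (reg 24)) ;;
         forLoop 43 numU
          (.write 1 (1 + reg 43 * numR + reg 11) (modTwo (reg 42)) ;; .write 42 0 (reg 42 / 2)))
        .skip))

def solve : Program :=
  parities ;; adjacency ;; colors ;; weights ;; total ;;
  .ite (reg 38) (modulus ;; reduce ;; output) .skip

end Prog

/-- The input word `inp` describes `n` users, `k` resources, `m` constraints between the resources
`fst j` and `snd j`, and the base relation `base`. -/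
structure IsInput (inp : ℕ → ℕ) (n k m : ℕ) (fst snd : ℕ → ℕ) (base : ℕ → ℕ → Bool) : Prop where
  numU : inp 0 = n
  numR : inp 1 = k
  numC : inp 2 = m
  -- A constraint occupies four entries; operator and quantifier are not recorded, being the same
  -- for all constraints in `SoDE`.
  fst : ∀ j < m, inp (3 + 4 * j) = fst j
  snd : ∀ j < m, inp (4 + 4 * j) = snd j
  base : ∀ u < n, ∀ r < k, inp (3 + 4 * m + u * k + r) = if base u r then 1 else 0

/-- The factor of user `u` in the weight of a mask. -/
def userFactor (base bit : Bool) (α β : ℕ) : ℕ :=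
  if base then (if bit then α else β) else (if bit then 0 else 1)

/-- The weight of the mask `c` for resource `r`. -/
def maskWeight (n : ℕ) (base : ℕ → ℕ → Bool) (α β r c : ℕ) : ℕ :=
  ∏ u ∈ range n, userFactor (base u r) (c.testBit u) α β

theorem userFactor_le {α β Z : ℕ} (hα : α ≤ Z) (hβ : β ≤ Z) (hZ : 1 ≤ Z) (b c : Bool) :
    userFactor b c α β ≤ Z := by
  unfold userFactor; split_ifs <;> omega

theorem maskWeight_le {α β Z : ℕ} (hα : α ≤ Z) (hβ : β ≤ Z) (hZ : 1 ≤ Z) (n : ℕ)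
    (base : ℕ → ℕ → Bool) (r c : ℕ) : maskWeight n base α β r c ≤ Z ^ n := by
  calc maskWeight n base α β r c ≤ ∏ _u ∈ range n, Z :=
        prod_le_prod' fun u _ => userFactor_le hα hβ hZ _ _
    _ = Z ^ n := by simp

/-- The left side is what `modTwo` computes from a mask after `i` halvings. -/
theorem div_two_pow_mod_two (c i : ℕ) : c / 2 ^ i - c / 2 ^ i / 2 * 2 = (c.testBit i).toNat := by
  rw [Nat.testBit_eq_decide_div_mod_eq]
  rcases Nat.mod_two_eq_zero_or_one (c / 2 ^ i) with h | h <;> simp [h] <;> omega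

theorem eight_le_two_pow {B : ℕ} (h : 3 ≤ B) : 8 ≤ 2 ^ B :=
  Nat.pow_le_pow_right (n := 2) (by norm_num) h

/-! ### Specification of the search for a largest available color -/

section Spec

variable {B n k m : ℕ} {fst snd : ℕ → ℕ} {base : ℕ → ℕ → Bool} {s : Memory}

/-- Used with two choices of (α, β): (2, 1) ranks admissible masks by size, and (1, Z) encodes the
cost of a color. In both cases an unauthorized user makes the product 0. -/
theorem wp_weight (hB3 : 3 ≤ B) (hin : IsInput (s 0) n k m fst snd base) {α β Z r c : ℕ}
    (hα : α ≤ Z) (hβ : β ≤ Z) (hZ : 1 ≤ Z) (hB : Z ^ n < 2 ^ B) (hn : n < 2 ^ B)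
    (hc : c < 2 ^ B) (hr : r < k)
    (h8 : s 8 0 = α) (h9 : s 9 0 = β) (h10 : s 10 0 = c) (h11 : s 11 0 = r) :
    WP B Prog.weight s (n * 5 + 4) fun s' => s' 12 0 = maskWeight n base α β r c := by
  have hB8 := eight_le_two_pow hB3
  refine WP.mono (WP.set (v := 1) rfl rfl (by omega) <| WP.set (v := c) rfl h10 hc <|
    WP.forLoop (M := 3) (n := n)
      (fun i s' => s' 12 0 = maskWeight i base α β r c ∧ s' 13 0 = c / 2 ^ i)
      hin.numU hn ?_ ?_ ?_) (by omega)
  · simp [Memory.store, maskWeight]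
  · intro i hi s' hf h14 ⟨h12, h13⟩
    have e0 : s' 0 = s 0 := hf 0 rfl
    have e8 : s' 8 0 = α := (congrFun (hf 8 rfl) 0).trans h8
    have e9 : s' 9 0 = β := (congrFun (hf 9 rfl) 0).trans h9
    have e11 : s' 11 0 = r := (congrFun (hf 11 rfl) 0).trans h11
    have hb := hin.base i hi r hr
    have hsucc : maskWeight (i + 1) base α β r c
        = maskWeight i base α β r c * userFactor (base i r) (c.testBit i) α β := by
      simp [maskWeight, prod_range_succ]
    -- The program replaces case distinctions by arithmetic on 0 and 1, with subtraction from 1 as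
    -- negation.
    have hfac : (if base i r = true then 1 else 0) * ((c.testBit i).toNat * α
        + (1 - (c.testBit i).toNat) * β)
        + (1 - if base i r = true then 1 else 0) * (1 - (c.testBit i).toNat)
        = userFactor (base i r) (c.testBit i) α β := by
      cases base i r <;> cases c.testBit i <;> simp [userFactor]
    have hbit := div_two_pow_mod_two c i
    have hle := maskWeight_le hα hβ hZ (i + 1) base r c
    have hle' : Z ^ (i + 1) ≤ Z ^ n := Nat.pow_le_pow_right hZ hi
    refine WP.set (v := (c.testBit i).toNat) rfl (by simp [h13, hbit])
      ((Bool.toNat_lt _).trans_le (by omega)) <|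
      WP.set (v := maskWeight (i + 1) base α β r c) rfl ?_ (by omega) <|
      WP.write (v := c / 2 ^ (i + 1)) rfl ?_ ((Nat.div_le_self _ _).trans_lt hc) ⟨?_, ?_⟩
    · rw [hsucc, ← hfac, ← hb]
      simp [Memory.store, e0, h12, h14, e8, e9, e11, hin.numC, hin.numR]
    · simp [Memory.store, h13, Nat.div_div_eq_div_mul, pow_succ]
    · simp [Memory.store]
    · simp [Memory.store]
  · intro s' _ h
    exact h.1

/-- The mask of the users that may access resource `r`. -/
def baseMaskOf (n : ℕ) (base : ℕ → ℕ → Bool) (r : ℕ) : ℕ :=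
  ∑ u ∈ range n with base u r, 2 ^ u

theorem baseMaskOf_lt (n : ℕ) (base : ℕ → ℕ → Bool) (r : ℕ) : baseMaskOf n base r < 2 ^ n :=
  (sum_le_sum_of_subset (filter_subset _ _)).trans_lt (by
    rw [Nat.geomSum_eq (le_refl 2)]
    simp)

theorem wp_baseMask (hB3 : 3 ≤ B) (hin : IsInput (s 0) n k m fst snd base) {r : ℕ}
    (hn : n < 2 ^ B) (hB : 2 ^ n < 2 ^ B) (hr : r < k) (h11 : s 11 0 = r) :
    WP B Prog.baseMask s (n * 4 + 4) fun s' => s' 16 0 = baseMaskOf n base r := by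
  have hB8 := eight_le_two_pow hB3
  refine WP.mono (WP.set (v := 0) rfl rfl (by omega) <| WP.set (v := 1) rfl rfl (by omega) <|
    WP.forLoop (M := 2) (n := n)
      (fun i s' => s' 16 0 = baseMaskOf i base r ∧ s' 17 0 = 2 ^ i)
      hin.numU hn ?_ ?_ ?_) (by omega)
  · simp [Memory.store, baseMaskOf]
  · intro i hi s' hf h14 ⟨h16, h17⟩
    have e0 : s' 0 = s 0 := hf 0 rfl
    have e11 : s' 11 0 = r := (congrFun (hf 11 rfl) 0).trans h11
    have hb := hin.base i hi r hr
    have hsucc : baseMaskOf (i + 1) base r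
        = baseMaskOf i base r + (if base i r = true then 1 else 0) * 2 ^ i := by
      simp [baseMaskOf, sum_filter, sum_range_succ]
    have hle := baseMaskOf_lt (i + 1) base r
    have hle' : 2 ^ (i + 1) ≤ 2 ^ n := Nat.pow_le_pow_right (by norm_num) hi
    refine WP.set (v := baseMaskOf (i + 1) base r) rfl ?_ (by omega) <|
      WP.write (v := 2 ^ (i + 1)) rfl ?_ (by omega) ⟨?_, ?_⟩
    · rw [hsucc, ← hb]
      simp [e0, h16, h17, h14, e11, hin.numC, hin.numR]
    · simp [Memory.store, h17, pow_succ]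
    · simp [Memory.store]
    · simp [Memory.store]
  · intro s' _ h
    exact h.1

theorem wp_tryMask (hB3 : 3 ≤ B) (hin : IsInput (s 0) n k m fst snd base) {r c : ℕ}
    {score : ℕ → ℕ} (hscore : ∀ c, score c = maskWeight n base 2 1 r c * (1 - s 5 c))
    (hn : n < 2 ^ B) (hB : 2 ^ n < 2 ^ B) (hc : c < 2 ^ n) (hr : r < k)
    (h8 : s 8 0 = 2) (h9 : s 9 0 = 1) (h10 : s 10 0 = c) (h11 : s 11 0 = r)
    (h19 : s 19 0 < 2 ^ n) (h20 : s 20 0 = score (s 19 0)) :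
    WP B Prog.tryMask s (n * 5 + 8) fun s' => s' 19 0 < 2 ^ n ∧ s' 20 0 = score (s' 19 0) ∧
      score (s 19 0) ≤ score (s' 19 0) ∧ score c ≤ score (s' 19 0) := by
  have hB8 := eight_le_two_pow hB3
  refine WP.mono (WP.call (wp_weight hB3 hin le_rfl one_le_two one_le_two hB hn (hc.trans hB) hr
    h8 h9 h10 h11) fun s' hf h12 => WP.ite (N₁ := 2) (N₂ := 1) ?_ ?_) (by omega)
  all_goals
    have e5 : s' 5 = s 5 := hf 5 rfl
    have e10 : s' 10 0 = c := (congrFun (hf 10 rfl) 0).trans h10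
    have e19 : s' 19 0 = s 19 0 := congrFun (hf 19 rfl) 0
    have e20 : s' 20 0 = score (s 19 0) := (congrFun (hf 20 rfl) 0).trans h20
    have hc' := hscore c
    intro hg
    simp only [Expr.eval_sub, Expr.eval_mul, Expr.eval_reg, Expr.eval_one, Expr.eval_read, h12,
      e5, e10, e20, ← hc'] at hg
  · have hsc : score c = maskWeight n base 2 1 r c := by
      rcases Nat.eq_zero_or_pos (s 5 c) with h | h
      · simp [hc', h]
      · have : 1 - s 5 c = 0 := by omega
        rw [this, mul_zero] at hc'; omega
    refine WP.set (v := c) rfl e10 (hc.trans hB) <| WP.write (v := score c) rfl ?_ ?_ ?_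
    · simp [Memory.store, h12, hsc]
    · rw [hsc]
      exact (maskWeight_le le_rfl one_le_two one_le_two _ _ _ _).trans_lt hB
    · simp [Memory.store, hc]; omega
  · refine WP.skip ?_
    rw [e19, e20]
    exact ⟨h19, rfl, le_rfl, by omega⟩

/-- The candidates are those of `exists_candidate`. Subtracting `2 ^ u` without testing that `u`
lies in the color is harmless: otherwise some other mask below `2 ^ n` results, and it is scored
correctly as well. -/
theorem wp_search (hB3 : 3 ≤ B) (hin : IsInput (s 0) n k m fst snd base) {r g : ℕ}
    {score : ℕ → ℕ} (hscore : ∀ c, score c = maskWeight n base 2 1 r c * (1 - s 5 c))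
    (hn : n < 2 ^ B) (hB : 2 ^ n < 2 ^ B) (hg : g < 2 ^ B) (hr : r < k)
    (h5 : s 5 0 = 1) (h7 : s 7 0 = g) (h6 : ∀ i < g, s 6 i < 2 ^ n)
    (h8 : s 8 0 = 2) (h9 : s 9 0 = 1) (h11 : s 11 0 = r) (h16 : s 16 0 = baseMaskOf n base r) :
    WP B Prog.search s (g * (n * (n * 5 + 12) + 5) + (n * 5 + 13)) fun s' =>
      s' 19 0 < 2 ^ n ∧ s' 20 0 = score (s' 19 0) ∧
      score (baseMaskOf n base r) ≤ score (s' 19 0) ∧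
      ∀ i < g, ∀ u < n, score (s 6 i - 2 ^ u) ≤ score (s' 19 0) := by
  have hB8 := eight_le_two_pow hB3
  have hbm := baseMaskOf_lt n base r
  -- The empty set is flagged as unavailable, so it can serve as the initial best mask.
  have hs0 : score 0 = 0 := by simp [hscore, h5]
  refine WP.mono (WP.set (v := 0) rfl rfl (by omega) <| WP.set (v := 0) rfl rfl (by omega) <|
    WP.set (v := baseMaskOf n base r) rfl (by simpa [Memory.store] using h16) (by omega) <|
    WP.call (wp_tryMask hB3 (by exact hin) (c := baseMaskOf n base r) (score := score)
      (by exact hscore) hn hB hbm hr (by exact h8) (by exact h9) ?_ (by exact h11) ?_ ?_) fun s₁ hf₁ hQ =>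
    WP.forLoop (M := n * (n * 5 + 12) + 3) (n := g)
      (fun i s' => s' 19 0 < 2 ^ n ∧ s' 20 0 = score (s' 19 0) ∧
        score (baseMaskOf n base r) ≤ score (s' 19 0) ∧
        ∀ i' < i, ∀ u < n, score (s 6 i' - 2 ^ u) ≤ score (s' 19 0))
      ((congrFun (hf₁ 7 rfl) 0).trans h7) hg ?_ ?_ ?_) (N := (n * 5 + 8) + (g * (n * (n * 5 + 12) + 3 + 2) + 2) + 3) (le_of_eq (by ring))
  · simp [Memory.store]
  · simp [Memory.store]
  · simp [Memory.store, hs0]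
  · exact ⟨hQ.1, hQ.2.1, hQ.2.2.2, by simp⟩
  · intro i hi s₂ hf₂ h21 ⟨i19, i20, iB, iA⟩
    refine WP.mono (WP.set (v := 1) rfl rfl (by omega) <|
      WP.forLoop (M := n * 5 + 10) (n := n)
        (fun u' s' => s' 17 0 = 2 ^ u' ∧ s' 19 0 < 2 ^ n ∧ s' 20 0 = score (s' 19 0) ∧
          score (baseMaskOf n base r) ≤ score (s' 19 0) ∧
          (∀ i' < i, ∀ u < n, score (s 6 i' - 2 ^ u) ≤ score (s' 19 0)) ∧
          ∀ u < u', score (s 6 i - 2 ^ u) ≤ score (s' 19 0)) ?_ hn ?_ ?_ ?_)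
        (N := n * (n * 5 + 10 + 2) + 2 + 1) (le_of_eq (by ring))
    · exact (congrFun (hf₂ 0 rfl) 0).trans ((congrFun (hf₁ 0 rfl) 0).trans hin.numU)
    · exact ⟨rfl, i19, i20, iB, iA, by simp⟩
    · intro u hu s₃ hf₃ h22 ⟨j17, j19, j20, jB, jA, jU⟩
      have e0 : s₃ 0 = s 0 := (hf₃ 0 rfl).trans ((hf₂ 0 rfl).trans (hf₁ 0 rfl))
      have e5 : s₃ 5 = s 5 := (hf₃ 5 rfl).trans ((hf₂ 5 rfl).trans (hf₁ 5 rfl))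
      have e6 : s₃ 6 = s 6 := (hf₃ 6 rfl).trans ((hf₂ 6 rfl).trans (hf₁ 6 rfl))
      have e8 : s₃ 8 = s 8 := (hf₃ 8 rfl).trans ((hf₂ 8 rfl).trans (hf₁ 8 rfl))
      have e9 : s₃ 9 = s 9 := (hf₃ 9 rfl).trans ((hf₂ 9 rfl).trans (hf₁ 9 rfl))
      have e11 : s₃ 11 = s 11 := (hf₃ 11 rfl).trans ((hf₂ 11 rfl).trans (hf₁ 11 rfl))
      have e21 : s₃ 21 0 = i := (congrFun (hf₃ 21 rfl) 0).trans h21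
      have hlt : s 6 i - 2 ^ u < 2 ^ n := (Nat.sub_le _ _).trans_lt (h6 i hi)
      have hle' : 2 ^ (u + 1) ≤ 2 ^ n := Nat.pow_le_pow_right (by norm_num) hu
      refine WP.mono (WP.set (v := s 6 i - 2 ^ u) rfl (by simp [e21, e6, j17]) (hlt.trans hB) <|
        WP.call (wp_tryMask hB3 (s := s₃.store 10 0 _) (c := s 6 i - 2 ^ u) (score := score)
          (n := n) (k := k) (m := m) (fst := fst) (snd := snd) (base := base) (r := r)
          ?_ ?_ hn hB hlt hr ?_ ?_ ?_ ?_ j19 j20)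
          fun s₄ hf₄ ⟨l19, l20, lA, lB⟩ => WP.write (v := 2 ^ (u + 1)) rfl ?_ (by omega) ?_)
          (by omega)
      · change IsInput (s₃ 0) n k m fst snd base
        rw [e0]; exact hin
      · intro c
        rw [hscore, ← e5]; rfl
      · exact (congrFun e8 0).trans h8
      · exact (congrFun e9 0).trans h9
      · simp [Memory.store]
      · exact (congrFun e11 0).trans h11
      · have : s₄ 17 0 = 2 ^ u := (congrFun (hf₄ 17 rfl) 0).trans j17
        simp [this, pow_succ]
      · have lA' : score (s₃ 19 0) ≤ score (s₄ 19 0) := lA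
        refine ⟨rfl, l19, l20, jB.trans lA', fun i' hi' u hu => (jA i' hi' u hu).trans lA', ?_⟩
        intro u' hu'
        rcases Nat.lt_succ_iff_lt_or_eq.1 hu' with h | rfl
        · exact (jU u' h).trans lA'
        · exact lB
    · intro s' _ ⟨_, j19, j20, jB, jA, jU⟩
      refine ⟨j19, j20, jB, fun i' hi' => ?_⟩
      rcases Nat.lt_succ_iff_lt_or_eq.1 hi' with h | rfl
      · exact jA i' h
      · exact jU
  · intro s' _ h
    exact h

end Spec

end APEP

namespace APEP

open Finset

/-! ## Sets of numbers as masks -/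

/-- The positions of the ones in the binary expansion. -/
def bits (c : ℕ) : Finset ℕ := c.bitIndices.toFinset

/-- The number with ones exactly at the positions in `S`. -/
def mask (S : Finset ℕ) : ℕ := ∑ i ∈ S, 2 ^ i

@[simp] theorem mem_bits {c i : ℕ} : i ∈ bits c ↔ c.testBit i = true := by simp [bits]

@[simp] theorem bits_mask (S : Finset ℕ) : bits (mask S) = S :=
  equivBitIndices.right_inv S

@[simp] theorem mask_bits (c : ℕ) : mask (bits c) = c :=
  equivBitIndices.left_inv c

theorem mask_lt {S : Finset ℕ} {n : ℕ} (h : S ⊆ range n) : mask S < 2 ^ n :=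
  (sum_le_sum_of_subset h).trans_lt (by
    rw [Nat.geomSum_eq (le_refl 2)]
    simp)

theorem bits_subset_range {c n : ℕ} (h : c < 2 ^ n) : bits c ⊆ range n := fun i hi => by
  by_contra hin
  have := Nat.testBit_lt_two_pow (h.trans_le (Nat.pow_le_pow_right (n := 2) (by norm_num)
    (not_lt.1 fun h => hin (mem_range.2 h))))
  simp [mem_bits.1 hi] at this

theorem mask_insert {S : Finset ℕ} {v : ℕ} (h : v ∉ S) : mask (insert v S) = mask S + 2 ^ v := by
  simp [mask, sum_insert h, add_comm]

theorem bits_zero : bits 0 = ∅ := by simp [bits]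

theorem bits_injective : Function.Injective bits := equivBitIndices.injective

/-- The basis of all tables filled by doubling: the masks from `2 ^ v` up to `2 ^ (v + 1)` are the
sets with largest element `v`. -/
theorem bits_two_pow_add {v a : ℕ} (h : a < 2 ^ v) : bits (2 ^ v + a) = insert v (bits a) := by
  have hv : v ∉ bits a := fun hm => by simpa using bits_subset_range h hm
  rw [← bits_mask (insert v (bits a)), mask_insert hv, mask_bits, add_comm]

/-- The users that may access resource `r`. -/
def baseSet (n : ℕ) (base : ℕ → ℕ → Bool) (r : ℕ) : Finset ℕ := {u ∈ range n | base u r}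

theorem baseMaskOf_eq (n : ℕ) (base : ℕ → ℕ → Bool) (r : ℕ) :
    baseMaskOf n base r = mask (baseSet n base r) := rfl

theorem maskWeight_eq_zero {n : ℕ} {base : ℕ → ℕ → Bool} {α β r c : ℕ} (hc : c < 2 ^ n)
    (h : ¬ bits c ⊆ baseSet n base r) : maskWeight n base α β r c = 0 := by
  obtain ⟨u, hu, hu'⟩ := not_subset.1 h
  refine prod_eq_zero (bits_subset_range hc hu) ?_
  have : base u r = false := by
    by_contra hb
    exact hu' (mem_filter.2 ⟨bits_subset_range hc hu, by simpa using hb⟩)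
  simp [userFactor, this, mem_bits.1 hu]

theorem maskWeight_eq {n : ℕ} {base : ℕ → ℕ → Bool} {α β r c : ℕ}
    (h : bits c ⊆ baseSet n base r) :
    maskWeight n base α β r c = α ^ #(bits c) * β ^ #(baseSet n base r \ bits c) := by
  have h1 : maskWeight n base α β r c
      = ∏ u ∈ baseSet n base r, if u ∈ bits c then α else β := by
    rw [maskWeight, baseSet, prod_filter]
    refine prod_congr rfl fun u hu => ?_
    by_cases hb : base u r = true
    · simp [userFactor, hb]
    · have : u ∉ bits c := fun hm => hb (mem_filter.1 (h hm)).2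
      simp [userFactor, hb, mem_bits] at this ⊢
      simp [this]
  rw [h1, prod_ite, prod_const, prod_const, filter_mem_eq_inter, inter_eq_right.2 h,
    ← sdiff_eq_filter]

/-! ## Collections of colors that are rich enough -/

/-- Every nonempty set of authorized users of `r` that is missing in the collection `G` of masks
is dominated in size by `j` members of `G`. -/
def Rich (n : ℕ) (base : ℕ → ℕ → Bool) (r j : ℕ) (G : Finset ℕ) : Prop :=
  ∀ c, c ≠ 0 → bits c ⊆ baseSet n base r → c ∉ G →
    ∃ F ⊆ G, j ≤ #F ∧ ∀ f ∈ F, bits f ⊆ baseSet n base r ∧ #(bits c) ≤ #(bits f)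

section Rich

variable {n r j : ℕ} {base : ℕ → ℕ → Bool} {G G' : Finset ℕ}

theorem Rich.mono (h : Rich n base r j G) (hG : G ⊆ G') : Rich n base r j G' := by
  intro c h0 hc hcG
  obtain ⟨F, hF, h⟩ := h c h0 hc fun hm => hcG (hG hm)
  exact ⟨F, hF.trans hG, h⟩

theorem rich_zero : Rich n base r 0 G := fun _ _ _ _ => ⟨∅, by simp⟩

theorem lt_of_bits_subset {c : ℕ} (h : bits c ⊆ baseSet n base r) : c < 2 ^ n := by
  rw [← mask_bits c]
  exact mask_lt (h.trans (filter_subset _ _))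

/-- A missing set is dominated by a missing set that is a candidate. -/
theorem exists_candidate {c : ℕ} (h0 : c ≠ 0) (hc : bits c ⊆ baseSet n base r) (hcG : c ∉ G) :
    ∃ d, d ≠ 0 ∧ bits d ⊆ baseSet n base r ∧ d ∉ G ∧ #(bits c) ≤ #(bits d) ∧
      (d = baseMaskOf n base r ∨ ∃ f ∈ G, ∃ u < n, d = f - 2 ^ u) := by
  classical
  set M := {d ∈ range (2 ^ n) | d ≠ 0 ∧ bits d ⊆ baseSet n base r ∧ d ∉ G} with hM
  have hcM : c ∈ M := mem_filter.2 ⟨mem_range.2 (lt_of_bits_subset hc), h0, hc, hcG⟩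
  -- Take a largest missing set. Unless it is the whole base set, adding one more authorized user
  -- gives a larger admissible set, which by maximality lies in `G`.
  obtain ⟨d, hd, hmax⟩ := exists_max_image M (fun d => #(bits d)) ⟨c, hcM⟩
  obtain ⟨_, hd0, hdB, hdG⟩ := mem_filter.1 hd
  refine ⟨d, hd0, hdB, hdG, hmax c hcM, ?_⟩
  by_cases hdb : baseSet n base r ⊆ bits d
  · left
    rw [baseMaskOf_eq, ← hdB.antisymm hdb, mask_bits]
  · right
    obtain ⟨u, hu, hud⟩ := not_subset.1 hdb
    have hf : mask (insert u (bits d)) = d + 2 ^ u := by rw [mask_insert hud, mask_bits]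
    refine ⟨d + 2 ^ u, ?_, u, mem_range.1 (mem_filter.1 hu).1, by simp⟩
    by_contra hfG
    have hsub : bits (d + 2 ^ u) ⊆ baseSet n base r := by
      rw [← hf, bits_mask]; exact insert_subset hu hdB
    have := hmax (d + 2 ^ u) (mem_filter.2 ⟨mem_range.2 (lt_of_bits_subset hsub), by simp [hd0],
      hsub, hfG⟩)
    rw [← hf, bits_mask, card_insert_of_notMem hud] at this
    omega

/-- By `exists_candidate`, a best candidate is at least as large as every missing set. It is new to
`G`, hence one more dominator for whatever is still missing after its insertion. If the best score
is 0, nothing is missing and richness is vacuous. -/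
theorem Rich.step (h : Rich n base r j G) {score : ℕ → ℕ}
    (hscore : ∀ c, score c = maskWeight n base 2 1 r c * (1 - if c = 0 ∨ c ∈ G then 1 else 0))
    {b : ℕ} (hb : b < 2 ^ n) (h1 : score (baseMaskOf n base r) ≤ score b)
    (h2 : ∀ f ∈ G, ∀ u < n, score (f - 2 ^ u) ≤ score b) :
    (score b = 0 → Rich n base r (j + 1) G) ∧
    (score b ≠ 0 → b ≠ 0 ∧ b ∉ G ∧ Rich n base r (j + 1) (insert b G)) := by
  have key : ∀ c, c ≠ 0 → bits c ⊆ baseSet n base r → c ∉ G → 2 ^ #(bits c) ≤ score b := by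
    intro c h0 hc hcG
    obtain ⟨d, hd0, hdB, hdG, hcd, hcand⟩ := exists_candidate h0 hc hcG
    have hd : score d = 2 ^ #(bits d) := by simp [hscore, hd0, hdG, maskWeight_eq hdB]
    calc 2 ^ #(bits c) ≤ 2 ^ #(bits d) := Nat.pow_le_pow_right (by norm_num) hcd
      _ = score d := hd.symm
      _ ≤ score b := by
        rcases hcand with rfl | ⟨f, hf, u, hu, rfl⟩
        · exact h1
        · exact h2 f hf u hu
  constructor
  · intro hb0 c h0 hc hcG
    have := key c h0 hc hcG
    have := Nat.pos_of_neZero (2 ^ #(bits c))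
    omega
  · intro hb0
    have hbG : ¬ (b = 0 ∨ b ∈ G) := fun hm => hb0 (by simp [hscore, hm])
    have hbB : bits b ⊆ baseSet n base r := by
      by_contra hB
      exact hb0 (by simp [hscore, maskWeight_eq_zero hb hB])
    have hsb : score b = 2 ^ #(bits b) := by simp [hscore, hbG, maskWeight_eq hbB]
    push Not at hbG
    refine ⟨hbG.1, hbG.2, fun c h0 hc hcG => ?_⟩
    have hcG' : c ∉ G := fun hm => hcG (mem_insert_of_mem hm)
    obtain ⟨F, hF, hj, hFs⟩ := h c h0 hc hcG'
    refine ⟨insert b F, insert_subset_insert _ hF, ?_, ?_⟩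
    · rw [card_insert_of_notMem fun hm => hbG.2 (hF hm)]; omega
    · intro f hf
      rcases mem_insert.1 hf with rfl | hf
      · refine ⟨hbB, ?_⟩
        have := key c h0 hc hcG'
        rw [hsb] at this
        exact (Nat.pow_le_pow_iff_right (by norm_num)).1 this
      · exact hFs f hf

end Rich

/-! ## The collection of colors computed by the program -/

/-- The collection of the first `g` colors. -/
def colorSet (γ : ℕ → ℕ) (g : ℕ) : Finset ℕ := (range g).image γ

/-- The colors are distinct nonempty sets of users, and flagged as not available. -/
structure ColorsOK (n : ℕ) (flag γ : ℕ → ℕ) (g : ℕ) : Prop where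
  flag : ∀ c, flag c = if c = 0 ∨ c ∈ colorSet γ g then 1 else 0
  ne_zero : ∀ i < g, γ i ≠ 0
  lt : ∀ i < g, γ i < 2 ^ n
  inj : ∀ i < g, ∀ j < g, γ i = γ j → i = j

theorem ColorsOK.insert {n b g : ℕ} {flag flag' γ γ' : ℕ → ℕ} (h : ColorsOK n flag γ g)
    (hb0 : b ≠ 0) (hbn : b < 2 ^ n) (hb : b ∉ colorSet γ g)
    (h5 : ∀ c, flag' c = if c = b then 1 else flag c)
    (h6 : ∀ i, γ' i = if i = g then b else γ i) :
    colorSet γ' (g + 1) = insert b (colorSet γ g) ∧ ColorsOK n flag' γ' (g + 1) := by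
  have h6' : ∀ i < g, γ' i = γ i := fun i hi => by rw [h6, if_neg hi.ne]
  have h6g : γ' g = b := by rw [h6, if_pos rfl]
  have hset : colorSet γ' (g + 1) = Insert.insert b (colorSet γ g) := by
    rw [colorSet, colorSet, range_add_one, image_insert, h6g]
    congr 1
    exact image_congr fun i hi => h6' i (mem_range.1 hi)
  have hne : ∀ i < g, γ i ≠ b := fun i hi he =>
    hb (mem_image.2 ⟨i, mem_range.2 hi, he⟩)
  refine ⟨hset, ⟨fun c => ?_, fun i hi => ?_, fun i hi => ?_, fun i hi j hj hij => ?_⟩⟩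
  · rw [h5, hset, h.flag]
    by_cases hc : c = b <;> simp [hc]
  · rcases Nat.lt_succ_iff_lt_or_eq.1 hi with hi | rfl
    · rw [h6' i hi]; exact h.ne_zero i hi
    · rwa [h6g]
  · rcases Nat.lt_succ_iff_lt_or_eq.1 hi with hi | rfl
    · rw [h6' i hi]; exact h.lt i hi
    · rwa [h6g]
  · rcases Nat.lt_succ_iff_lt_or_eq.1 hi with hi | rfl <;>
    rcases Nat.lt_succ_iff_lt_or_eq.1 hj with hj | rfl
    · rw [h6' i hi, h6' j hj] at hij; exact h.inj i hi j hj hij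
    · rw [h6' i hi, h6g] at hij; exact absurd hij (hne i hi)
    · rw [h6' j hj, h6g] at hij; exact absurd hij.symm (hne j hj)
    · rfl

/-! ### Specification of the collection of colors -/

section Spec

variable {B n k m : ℕ} {fst snd : ℕ → ℕ} {base : ℕ → ℕ → Bool} {s : Memory}

/-- A bound for the number of steps of `search`. -/
def searchSteps (n k : ℕ) : ℕ := k * k * (n * (n * 5 + 12) + 5) + (n * 5 + 13)

/-- For each resource, `k` searches raise the richness from 0 to `k`, each adding at most one color;
richness for earlier resources survives because the collection only grows. The bound on `2 ^ n` is
required only for `0 < k`: without resources the matrix is empty and the input length does not bound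
`n`. -/
theorem wp_colors (hB3 : 3 ≤ B) (hin : IsInput (s 0) n k m fst snd base) (h5 : s 5 = 0)
    (hn : n < 2 ^ B) (hB : 0 < k → 2 ^ n < 2 ^ B) (hk : k * k < 2 ^ B) (hk' : k < 2 ^ B) :
    WP B Prog.colors s (k * (k * (searchSteps n k + 7) + n * 4 + 8) + 6) fun s' =>
      ColorsOK n (s' 5) (s' 6) (s' 7 0) ∧ s' 7 0 ≤ k * k ∧ ∀ r < k, Rich n base r k (colorSet (s' 6) (s' 7 0)) := by
  have hB8 := eight_le_two_pow hB3
  refine WP.mono (WP.set (v := 2) rfl rfl (by omega) <| WP.set (v := 1) rfl rfl (by omega) <|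
    WP.set (v := 1) rfl rfl (by omega) <| WP.set (v := 0) rfl rfl (by omega) <|
    WP.forLoop (M := n * 4 + 4 + (k * (searchSteps n k + 7) + 2)) (n := k)
      (fun r s' => ColorsOK n (s' 5) (s' 6) (s' 7 0) ∧ s' 7 0 ≤ r * k ∧ ∀ r' < r, Rich n base r' k (colorSet (s' 6) (s' 7 0)))
      hin.numR hk' ?_ ?_ ?_)
    (N := k * (n * 4 + 4 + (k * (searchSteps n k + 7) + 2) + 2) + 2 + 4) (le_of_eq (by ring))
  · refine ⟨⟨fun c => ?_, ?_, ?_, ?_⟩, ?_, by simp⟩ <;>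
      simp [Memory.store, colorSet, h5]
  · intro r hr s₁ hf₁ h11 ⟨iC, ig, iR⟩
    have hnB := hB (by omega)
    have e0 : s₁ 0 = s 0 := hf₁ 0 rfl
    have e8 : s₁ 8 0 = 2 := congrFun (hf₁ 8 rfl) 0
    have e9 : s₁ 9 0 = 1 := congrFun (hf₁ 9 rfl) 0
    refine WP.call (wp_baseMask hB3 (by rw [e0]; exact hin) hn hnB hr h11) fun s₂ hf₂ h16 => ?_
    refine WP.forLoop (M := searchSteps n k + 5) (n := k)
      (fun j s' => ColorsOK n (s' 5) (s' 6) (s' 7 0) ∧ s' 7 0 ≤ r * k + j ∧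
        (∀ r' < r, Rich n base r' k (colorSet (s' 6) (s' 7 0))) ∧ Rich n base r j (colorSet (s' 6) (s' 7 0)))
      ((congrFun ((hf₂ 0 rfl).trans e0) 1).trans hin.numR) hk' ?_ ?_ ?_
    · have e6 : s₂ 6 = s₁ 6 := hf₂ 6 rfl
      have e7 : s₂ 7 = s₁ 7 := hf₂ 7 rfl
      have e5 : s₂ 5 = s₁ 5 := hf₂ 5 rfl
      rw [e5, e6, e7]
      exact ⟨iC, ig, iR, rich_zero⟩
    · intro j hj s₃ hf₃ h18 ⟨jC, jg, jR, jr⟩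
      have hgk : s₃ 7 0 < k * k := by nlinarith
      have d0 : s₃ 0 = s 0 := (hf₃ 0 rfl).trans ((hf₂ 0 rfl).trans e0)
      refine WP.mono (WP.call (wp_search hB3 (g := s₃ 7 0) (r := r)
        (score := fun c => maskWeight n base 2 1 r c * (1 - s₃ 5 c))
        (by rw [d0]; exact hin) (fun c => rfl) hn hnB (by omega) hr (by simp [jC.flag]) rfl jC.lt
        ((congrFun (hf₃ 8 rfl) 0).trans ((congrFun (hf₂ 8 rfl) 0).trans e8))
        ((congrFun (hf₃ 9 rfl) 0).trans ((congrFun (hf₂ 9 rfl) 0).trans e9))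
        ((congrFun (hf₃ 11 rfl) 0).trans ((congrFun (hf₂ 11 rfl) 0).trans h11))
        ((congrFun (hf₃ 16 rfl) 0).trans h16)) fun s₄ hf₄ ⟨kn, k20, kb, kG⟩ =>
          WP.ite (N₁ := 3) (N₂ := 1) ?_ ?_) (?_ : _ ≤ searchSteps n k + 5)
      rotate_right
      · have : s₃ 7 0 * (n * (n * 5 + 12) + 5) ≤ k * k * (n * (n * 5 + 12) + 5) :=
          Nat.mul_le_mul_right _ hgk.le
        simp only [searchSteps]; omega
      all_goals
        have f5 : s₄ 5 = s₃ 5 := hf₄ 5 rfl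
        have f6 : s₄ 6 = s₃ 6 := hf₄ 6 rfl
        have f7 : s₄ 7 = s₃ 7 := hf₄ 7 rfl
        have hst := jr.step (score := fun c => maskWeight n base 2 1 r c * (1 - s₃ 5 c))
          (fun c => by rw [jC.flag]) kn kb (fun f hf u hu => by
            obtain ⟨i, hi, rfl⟩ := mem_image.1 hf
            exact kG i (mem_range.1 hi) u hu)
        rw [← k20] at hst
        intro hg
      · obtain ⟨hb0, hbG, hrich⟩ := hst.2 hg
        refine WP.set (v := s₄ 19 0) rfl rfl (kn.trans hnB) <|
          WP.set (a' := s₄ 19 0) (v := 1) rfl rfl (by omega) <|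
          WP.write (v := s₄ 7 0 + 1) rfl rfl (by rw [f7]; omega) ?_
        obtain ⟨hset, hok⟩ := jC.insert
          (flag' := ((s₄.store 6 (s₄ 7 0) (s₄ 19 0)).store 5 (s₄ 19 0) 1) 5)
          (γ' := (s₄.store 6 (s₄ 7 0) (s₄ 19 0)) 6) hb0 kn hbG
          (fun c => by simp [Memory.store, f5]) (fun c => by simp [Memory.store, f6, f7])
        rw [← f7] at hset hok jR hrich
        refine ⟨hok, ?_, ?_, ?_⟩
        · change s₄ 7 0 + 1 ≤ _
          rw [f7]; omega
        · intro r' hr'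
          exact (jR r' hr').mono ((subset_insert _ _).trans hset.ge)
        · exact hrich.mono hset.ge
      · refine WP.skip ?_
        rw [f5, f6, f7]
        exact ⟨jC, by omega, jR, hst.1 hg⟩
    · intro s' _ ⟨jC, jg, jR, jr⟩
      refine ⟨jC, by rw [add_mul, one_mul]; exact jg, fun r' hr' => ?_⟩
      rcases Nat.lt_succ_iff_lt_or_eq.1 hr' with h | rfl
      · exact jR r' h
      · exact jr
  · intro s' _ h
    exact h

end Spec

end APEP

namespace APEP

open Finset

/-! ## Sums over independent sets -/

/-- No two distinct elements of `T` are neighbors. -/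
def Indep (nbr : ℕ → ℕ → Bool) (T : Finset ℕ) : Prop := ∀ a ∈ T, ∀ b ∈ T, a ≠ b → nbr a b = false

instance (nbr : ℕ → ℕ → Bool) : DecidablePred (Indep nbr) := fun T => by
  unfold Indep; infer_instance

/-- The sum over the independent subsets of `S` of the products of the weights. -/
def indepSum (nbr : ℕ → ℕ → Bool) (w : ℕ → ℕ) (S : Finset ℕ) : ℕ :=
  ∑ T ∈ S.powerset with Indep nbr T, ∏ v ∈ T, w v

theorem indepSum_empty (nbr : ℕ → ℕ → Bool) (w : ℕ → ℕ) : indepSum nbr w ∅ = 1 := by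
  rw [indepSum, powerset_empty, sum_filter]
  simp [Indep]

/-- An independent set either avoids `v`, or consists of `v` and an independent set of non-neighbors
of `v`. -/
theorem indepSum_insert {nbr : ℕ → ℕ → Bool} (hsymm : ∀ a b, nbr a b = nbr b a) (w : ℕ → ℕ)
    {v : ℕ} {S : Finset ℕ} (hv : v ∉ S) :
    indepSum nbr w (insert v S)
      = indepSum nbr w S + w v * indepSum nbr w {i ∈ S | nbr v i = false} := by
  rw [indepSum, sum_filter, sum_powerset_insert hv, ← sum_filter, indepSum, indepSum, mul_sum]
  congr 1
  rw [← sum_filter]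
  have : {T ∈ S.powerset | Indep nbr (insert v T)}
      = {T ∈ (filter (fun i => nbr v i = false) S).powerset | Indep nbr T} := by
    ext T
    simp only [mem_filter, mem_powerset]
    constructor
    · rintro ⟨hT, hI⟩
      refine ⟨fun i hi => mem_filter.2 ⟨hT hi, ?_⟩, fun a ha b hb => ?_⟩
      · exact hI v (mem_insert_self _ _) i (mem_insert_of_mem hi) fun h => hv (h ▸ hT hi)
      · exact hI a (mem_insert_of_mem ha) b (mem_insert_of_mem hb)
    · rintro ⟨hT, hI⟩
      refine ⟨fun i hi => (mem_filter.1 (hT hi)).1, fun a ha b hb hab => ?_⟩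
      rcases mem_insert.1 ha with rfl | ha' <;> rcases mem_insert.1 hb with rfl | hb'
      · exact absurd rfl hab
      · exact (mem_filter.1 (hT hb')).2
      · rw [hsymm]; exact (mem_filter.1 (hT ha')).2
      · exact hI a ha' b hb' hab
  rw [this]
  refine sum_congr rfl fun T hT => ?_
  have hT' := mem_powerset.1 (mem_filter.1 hT).1
  rw [prod_insert fun h => hv (mem_filter.1 (hT' h)).1]

/-- Without the independence condition the sum factors as the product of all `w v + 1`, which is why
`H` bounds `w v + 1`. -/
theorem indepSum_le {nbr : ℕ → ℕ → Bool} {w : ℕ → ℕ} {S : Finset ℕ} {k H : ℕ}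
    (hS : S ⊆ range k) (hw : ∀ v < k, w v + 1 ≤ 2 ^ H) : indepSum nbr w S ≤ 2 ^ (H * k) := by
  calc indepSum nbr w S ≤ ∑ T ∈ S.powerset, ∏ v ∈ T, w v :=
        sum_le_sum_of_subset (filter_subset _ _)
    _ = ∏ v ∈ S, (w v + 1) := by rw [prod_add_one]
    _ ≤ ∏ _v ∈ S, 2 ^ H := prod_le_prod' fun v hv => hw v (mem_range.1 (hS hv))
    _ = 2 ^ (H * #S) := by rw [prod_const, ← pow_mul]
    _ ≤ 2 ^ (H * k) := Nat.pow_le_pow_right (by norm_num)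
        (Nat.mul_le_mul_left _ ((card_le_card hS).trans_eq (card_range k)))

/-- The absolute value of the signed sum over all sets of resources of the product over all colors
of the sums over independent sets. -/
def coverTotal (nbr : ℕ → ℕ → Bool) (k g : ℕ) (w : ℕ → ℕ → ℕ) : ℕ :=
  (∑ X ∈ range (2 ^ k), (-1 : ℤ) ^ #(bits X) *
    ((∏ c ∈ range g, indepSum nbr (w c) (bits X) : ℕ) : ℤ)).natAbs

/-! ### Specification of the tables indexed by sets of resources -/

section Spec

variable {B n k m : ℕ} {fst snd : ℕ → ℕ} {base : ℕ → ℕ → Bool} {s : Memory}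

/-- The table is doubled `k` times; adding the new largest element flips the parity. -/
theorem wp_parities (hB3 : 3 ≤ B) (hin : IsInput (s 0) n k m fst snd base) (h4 : s 4 = 0)
    (hk : k < B) :
    WP B Prog.parities s (k * (2 ^ k * 3 + 5) + 3) fun s' =>
      s' 2 0 = 2 ^ k ∧ ∀ X < 2 ^ k, s' 4 X = #(bits X) % 2 := by
  have hB8 := eight_le_two_pow hB3
  have hkB : 2 ^ k < 2 ^ B := Nat.pow_lt_pow_right (by norm_num) hk
  have hk' : k < 2 ^ B := hk.trans Nat.lt_two_pow_self
  refine WP.mono (WP.set (v := 1) rfl rfl (by omega) <|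
    WP.forLoop (M := 2 ^ k * 3 + 3) (n := k)
      (fun v s' => s' 2 0 = 2 ^ v ∧ ∀ X < 2 ^ v, s' 4 X = #(bits X) % 2)
      hin.numR hk' ?_ ?_ ?_) (N := k * (2 ^ k * 3 + 3 + 2) + 2 + 1) (le_of_eq (by ring))
  · exact ⟨rfl, by simp [Memory.store, h4, bits_zero]⟩
  · intro v hv s₁ hf₁ h44 ⟨i2, i4⟩
    have hvk : 2 ^ (v + 1) ≤ 2 ^ k := Nat.pow_le_pow_right (by norm_num) hv
    have hvs : 2 ^ (v + 1) = 2 ^ v + 2 ^ v := by ring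
    refine WP.mono (WP.call (N₁ := 2 ^ v * (1 + 2) + 2) (N₂ := 1)
      (WP.forLoop (M := 1) (n := 2 ^ v)
        (fun a s' => (∀ X < 2 ^ v, s' 4 X = #(bits X) % 2) ∧
          ∀ b < a, s' 4 (2 ^ v + b) = #(bits (2 ^ v + b)) % 2)
        (Q := fun s' => ∀ X < 2 ^ (v + 1), s' 4 X = #(bits X) % 2)
        i2 (by omega) ⟨i4, by simp⟩ ?_ ?_)
      fun s₂ hf₂ h => ?_) (by omega)
    · intro a ha s₂ hf₂ h45 ⟨j1, j2⟩
      have e2 : s₂ 2 0 = 2 ^ v := (congrFun (hf₂ 2 rfl) 0).trans i2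
      have hpar : #(bits (2 ^ v + a)) % 2 = 1 - #(bits a) % 2 := by
        rw [bits_two_pow_add ha, card_insert_of_notMem fun hm => by
          simpa using bits_subset_range ha hm]
        omega
      refine WP.write (a' := 2 ^ v + a) (v := #(bits (2 ^ v + a)) % 2) ?_ ?_ (by omega) ⟨?_, ?_⟩
      · simp [e2, h45]
      · simp [h45, j1 a ha, hpar]
      · intro X hX
        have : X ≠ 2 ^ v + a := by omega
        simp [Memory.store, this, j1 X hX]
      · intro b hb
        rcases Nat.lt_succ_iff_lt_or_eq.1 hb with h | rfl
        · have : b ≠ a := by omega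
          simp [Memory.store, this, j2 b h]
        · simp [Memory.store]
    · intro s₂ _ ⟨j1, j2⟩ X hX
      rcases lt_or_ge X (2 ^ v) with h | h
      · exact j1 X h
      · obtain ⟨b, rfl⟩ := Nat.exists_eq_add_of_le h
        exact j2 b (by omega)
    · have e2 : s₂ 2 0 = 2 ^ v := (congrFun (hf₂ 2 rfl) 0).trans i2
      exact WP.write (v := 2 ^ (v + 1)) rfl (by simp [e2, pow_succ]) (by omega) ⟨rfl, h⟩
  · intro s' _ h
    exact h

/-- Uniqueness of quotient and remainder: distinct entries of a matrix with `k` columns have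
distinct addresses. -/
theorem mul_add_inj {k a b a' b' : ℕ} (hb : b < k) (hb' : b' < k) :
    a * k + b = a' * k + b' ↔ a = a' ∧ b = b' := by
  refine ⟨fun h => ?_, fun h => by rw [h.1, h.2]⟩
  have h1 : (a * k + b) % k = b := by rw [mul_comm, Nat.mul_add_mod, Nat.mod_eq_of_lt hb]
  have h2 : (a' * k + b') % k = b' := by rw [mul_comm, Nat.mul_add_mod, Nat.mod_eq_of_lt hb']
  have hbb : b = b' := by rw [← h1, ← h2, h]
  refine ⟨?_, hbb⟩
  subst hbb
  exact Nat.eq_of_mul_eq_mul_right (by omega : 0 < k) (by omega)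

/-- Some constraint leads from `a` to `b`. -/
def constraintRel (m : ℕ) (fst snd : ℕ → ℕ) (a b : ℕ) : Bool :=
  decide (∃ j < m, fst j = a ∧ snd j = b)

theorem wp_adjacency (hB3 : 3 ≤ B) (hin : IsInput (s 0) n k m fst snd base) (h3 : s 3 = 0)
    (hsnd : ∀ j < m, snd j < k) (hm : m < 2 ^ B) :
    WP B Prog.adjacency s (m * 3 + 2) fun s' =>
      ∀ a < k, ∀ b < k, s' 3 (a * k + b) = (constraintRel m fst snd a b).toNat := by
  have hB8 := eight_le_two_pow hB3
  refine WP.forLoop (M := 1) (n := m)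
      (fun i s' => ∀ a < k, ∀ b < k, s' 3 (a * k + b) = (constraintRel i fst snd a b).toNat)
      hin.numC hm ?_ ?_ ?_
  · simp [h3, constraintRel]
  · intro i hi s₁ hf₁ h46 inv
    have e0 : s₁ 0 = s 0 := hf₁ 0 rfl
    refine WP.write (a' := fst i * k + snd i) (v := 1) ?_ rfl (by omega) fun a ha b hb => ?_
    · simp [e0, h46, hin.fst i hi, hin.snd i hi, hin.numR]
    · have h1 : constraintRel (i + 1) fst snd a b
          = (constraintRel i fst snd a b || decide (fst i = a ∧ snd i = b)) := by
        rw [constraintRel, constraintRel, ← Bool.decide_or, decide_eq_decide]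
        constructor
        · rintro ⟨j, hj, h⟩
          rcases Nat.lt_succ_iff_lt_or_eq.1 hj with hj | rfl
          · exact Or.inl ⟨j, hj, h⟩
          · exact Or.inr h
        · rintro (⟨j, hj, h⟩ | h)
          · exact ⟨j, by omega, h⟩
          · exact ⟨i, by omega, h⟩
      rw [h1]
      have h2 := mul_add_inj (a := a) (a' := fst i) hb (hsnd i hi)
      have h3 := inv a ha b hb
      by_cases h : a = fst i ∧ b = snd i
      · simp [Memory.store, h.1, h.2]
      · have h' : ¬ (fst i = a ∧ snd i = b) := fun hh => h ⟨hh.1.symm, hh.2.symm⟩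
        simp [Memory.store, h2, h, h', h3]
  · intro s' _ h
    exact h

/-- Some constraint connects `a` and `b`. -/
def symmRel (rel : ℕ → ℕ → Bool) (a b : ℕ) : Bool := rel a b || rel b a

theorem symmRel_comm (rel : ℕ → ℕ → Bool) (a b : ℕ) : symmRel rel a b = symmRel rel b a :=
  Bool.or_comm _ _

theorem wp_removeNeighbors (hB3 : 3 ≤ B) (hk : s 0 1 = k) {rel : ℕ → ℕ → Bool} {v a : ℕ}
    (h3 : ∀ a < k, ∀ b < k, s 3 (a * k + b) = (rel a b).toNat)
    (hkB : k < B) (h30 : s 30 0 = v) (hv : v < k) (h31 : s 31 0 = a) (ha : a < 2 ^ k) :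
    WP B Prog.removeNeighbors s (k * 5 + 5) fun s' =>
      s' 32 0 = mask {i ∈ bits a | symmRel rel v i = false} := by
  have hB8 := eight_le_two_pow hB3
  have hkB' : 2 ^ k < 2 ^ B := Nat.pow_lt_pow_right (by norm_num) hkB
  have hk' : k < 2 ^ B := hkB.trans Nat.lt_two_pow_self
  refine WP.mono (WP.set (v := 0) rfl rfl (by omega) <| WP.set (v := 1) rfl rfl (by omega) <|
    WP.set (v := a) rfl h31 (by omega) <| WP.forLoop (M := 3) (n := k)
      (fun i s' => s' 32 0 = mask {i ∈ bits a ∩ range i | symmRel rel v i = false} ∧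
        s' 33 0 = 2 ^ i ∧ s' 34 0 = a / 2 ^ i)
      hk hk' ?_ ?_ ?_) (by omega)
  · simp [Memory.store, mask]
  · intro i hi s₁ hf₁ h35 ⟨i32, i33, i34⟩
    have e0 : s₁ 0 1 = k := (congrFun (hf₁ 0 rfl) 1).trans hk
    have e3 : s₁ 3 = s 3 := hf₁ 3 rfl
    have e30 : s₁ 30 0 = v := (congrFun (hf₁ 30 rfl) 0).trans h30
    have hik : 2 ^ (i + 1) ≤ 2 ^ k := Nat.pow_le_pow_right (by norm_num) hi
    have hbit := div_two_pow_mod_two a i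
    -- The matrix is not symmetric, so both orientations are consulted; truncated subtraction gives
    -- 0 also when both occur.
    have hsucc : mask {i ∈ bits a ∩ range (i + 1) | symmRel rel v i = false}
        = mask {i ∈ bits a ∩ range i | symmRel rel v i = false}
          + (a.testBit i).toNat * (1 - ((rel v i).toNat + (rel i v).toNat)) * 2 ^ i := by
      have hir : i ∉ filter (fun i => symmRel rel v i = false) (bits a ∩ range i) := by simp
      rw [range_add_one]
      by_cases hb : a.testBit i = true
      · rw [inter_insert_of_mem (mem_bits.2 hb), filter_insert]
        by_cases hr : symmRel rel v i = false
        · have hr' := hr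
          simp only [symmRel, Bool.or_eq_false_iff] at hr'
          rw [if_pos hr, mask_insert hir]
          simp [hb, hr'.1, hr'.2]
        · have hr' : 1 - ((rel v i).toNat + (rel i v).toNat) = 0 := by
            unfold symmRel at hr
            revert hr
            cases rel v i <;> cases rel i v <;> simp
          rw [if_neg hr, hr']
          simp
      · rw [inter_insert_of_notMem fun hm => hb (mem_bits.1 hm)]
        simp [hb]
    have hle : mask {i ∈ bits a ∩ range (i + 1) | symmRel rel v i = false} < 2 ^ (i + 1) :=
      mask_lt ((filter_subset _ _).trans inter_subset_right)
    refine WP.set (v := mask {i ∈ bits a ∩ range (i + 1) | symmRel rel v i = false}) rfl ?_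
      (by omega) <|
      WP.set (v := 2 ^ (i + 1)) rfl ?_ (by omega) <|
      WP.write (v := a / 2 ^ (i + 1)) rfl ?_ ((Nat.div_le_self _ _).trans_lt (by omega))
        ⟨?_, ?_, ?_⟩
    · simp [i32, i33, i34, h35, e0, e3, e30, h3 v hv i hi, h3 i hi v hv, hbit, hsucc]
    · simp [Memory.store, i33, pow_succ]
    · simp [Memory.store, i34, Nat.div_div_eq_div_mul, pow_succ]
    · simp [Memory.store]
    · simp [Memory.store]
    · simp [Memory.store]
  · intro s' _ h
    rw [h.1, inter_eq_left.2 (bits_subset_range ha)]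

/-- A bound for the number of steps of `indepSums`, where `E = 2 ^ k`. -/
def indepSteps (E k : ℕ) : ℕ := k * (E * (k * 5 + 8) + 5) + 4

/-- By `indepSum_insert` for the largest element `v`, the entry of `2 ^ v + a` needs only two
entries below `2 ^ v`: those of `a` and of `a` without the neighbors of `v`. Each of the `2 ^ k`
entries thus takes polynomially many steps. -/
theorem wp_indepSums (hB3 : 3 ≤ B) (hk : s 0 1 = k) {rel : ℕ → ℕ → Bool} {c : ℕ} {w : ℕ → ℕ}
    (h3 : ∀ a < k, ∀ b < k, s 3 (a * k + b) = (rel a b).toNat) (hkB : k < B)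
    (h28 : s 28 0 = c) (h23 : ∀ v < k, s 23 (c * k + v) = w v)
    (hJ : ∀ S ⊆ range k, indepSum (symmRel rel) w S < 2 ^ B) :
    WP B Prog.indepSums s (indepSteps (2 ^ k) k) fun s' =>
      ∀ X < 2 ^ k, s' 26 X = indepSum (symmRel rel) w (bits X) := by
  have hB8 := eight_le_two_pow hB3
  have hkB' : 2 ^ k < 2 ^ B := Nat.pow_lt_pow_right (by norm_num) hkB
  have hk' : k < 2 ^ B := hkB.trans Nat.lt_two_pow_self
  refine WP.mono (WP.set (v := 1) rfl rfl (by omega) <| WP.set (v := 1) rfl rfl (by omega) <|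
    WP.forLoop (M := 2 ^ k * (k * 5 + 8) + 3) (n := k)
      (fun v s' => s' 29 0 = 2 ^ v ∧
        ∀ X < 2 ^ v, s' 26 X = indepSum (symmRel rel) w (bits X))
      hk hk' ?_ ?_ ?_) (N := k * (2 ^ k * (k * 5 + 8) + 3 + 2) + 2 + 2)
      (le_of_eq (by unfold indepSteps; ring))
  · exact ⟨rfl, by simp [Memory.store, bits_zero, indepSum_empty]⟩
  · intro v hv s₁ hf₁ h30 ⟨i29, i26⟩
    have hvk : 2 ^ (v + 1) ≤ 2 ^ k := Nat.pow_le_pow_right (by norm_num) hv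
    have hvs : 2 ^ (v + 1) = 2 ^ v + 2 ^ v := by ring
    have e0 : s₁ 0 1 = k := (congrFun (hf₁ 0 rfl) 1).trans hk
    have e3 : s₁ 3 = s 3 := hf₁ 3 rfl
    have e23 : s₁ 23 = s 23 := hf₁ 23 rfl
    have e28 : s₁ 28 0 = c := (congrFun (hf₁ 28 rfl) 0).trans h28
    refine WP.mono (WP.call (N₁ := 2 ^ v * (k * 5 + 6 + 2) + 2) (N₂ := 1)
      (WP.forLoop (M := k * 5 + 6) (n := 2 ^ v)
        (fun a s' => (∀ X < 2 ^ v, s' 26 X = indepSum (symmRel rel) w (bits X)) ∧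
          ∀ b < a, s' 26 (2 ^ v + b) = indepSum (symmRel rel) w (bits (2 ^ v + b)))
        (Q := fun s' => ∀ X < 2 ^ (v + 1), s' 26 X = indepSum (symmRel rel) w (bits X))
        i29 (by omega) ⟨i26, by simp⟩ ?_ ?_)
      fun s₂ hf₂ h => ?_) ?_
    · intro a ha s₂ hf₂ h31 ⟨j1, j2⟩
      have f0 : s₂ 0 1 = k := (congrFun (hf₂ 0 rfl) 1).trans e0
      have f3 : s₂ 3 = s 3 := (hf₂ 3 rfl).trans e3
      have f30 : s₂ 30 0 = v := (congrFun (hf₂ 30 rfl) 0).trans h30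
      refine WP.mono (WP.call (wp_removeNeighbors hB3 f0 (rel := rel) (by rw [f3]; exact h3) hkB
        f30 hv h31 (by omega)) fun s₃ hf₃ h32 =>
        WP.write (a' := 2 ^ v + a) (v := indepSum (symmRel rel) w (bits (2 ^ v + a))) ?_ ?_
          (hJ _ (bits_subset_range (by omega))) ⟨?_, ?_⟩) (by omega)
      all_goals have g26 : s₃ 26 = s₂ 26 := hf₃ 26 rfl
      · have g29 : s₃ 29 0 = 2 ^ v :=
          (congrFun (hf₃ 29 rfl) 0).trans ((congrFun (hf₂ 29 rfl) 0).trans i29)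
        have g31 : s₃ 31 0 = a := (congrFun (hf₃ 31 rfl) 0).trans h31
        simp [g29, g31]
      · have g0 : s₃ 0 1 = k := (congrFun (hf₃ 0 rfl) 1).trans f0
        have g31 : s₃ 31 0 = a := (congrFun (hf₃ 31 rfl) 0).trans h31
        have g28 : s₃ 28 0 = c :=
          (congrFun (hf₃ 28 rfl) 0).trans ((congrFun (hf₂ 28 rfl) 0).trans e28)
        have g30 : s₃ 30 0 = v := (congrFun (hf₃ 30 rfl) 0).trans f30
        have g23 : s₃ 23 = s 23 := (hf₃ 23 rfl).trans ((hf₂ 23 rfl).trans e23)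
        have hlt : mask {i ∈ bits a | symmRel rel v i = false} < 2 ^ v :=
          mask_lt ((filter_subset _ _).trans (bits_subset_range ha))
        rw [bits_two_pow_add ha, indepSum_insert (symmRel_comm rel) w fun hm => by
          simpa using bits_subset_range ha hm]
        simp [g31, g0, g28, g30, g23, h32, g26, h23 v hv, j1 a ha, j1 _ hlt]
      · intro X hX
        have : X ≠ 2 ^ v + a := by omega
        simp [Memory.store, this, g26, j1 X hX]
      · intro b hb
        rcases Nat.lt_succ_iff_lt_or_eq.1 hb with h | rfl
        · have : b ≠ a := by omega
          simp [Memory.store, this, g26, j2 b h]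
        · simp [Memory.store]
    · intro s₂ _ ⟨j1, j2⟩ X hX
      rcases lt_or_ge X (2 ^ v) with h | h
      · exact j1 X h
      · obtain ⟨b, rfl⟩ := Nat.exists_eq_add_of_le h
        exact j2 b (by omega)
    · have e29 : s₂ 29 0 = 2 ^ v := (congrFun (hf₂ 29 rfl) 0).trans i29
      exact WP.write (v := 2 ^ (v + 1)) rfl (by simp [e29, pow_succ]) (by omega) ⟨rfl, h⟩
    · have : 2 ^ v * (k * 5 + 8) ≤ 2 ^ k * (k * 5 + 8) := Nat.mul_le_mul_right _ (by omega)
      exact Nat.add_le_add_right this 3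
  · intro s' _ h
    exact h.2

end Spec

end APEP

/-! ### Specification of the total, the weights, the modulus, the reduction and the output -/

namespace APEP

open Finset

theorem prod_indepSum_le {nbr : ℕ → ℕ → Bool} {w : ℕ → ℕ → ℕ} {S : Finset ℕ} {k g H : ℕ}
    (hS : S ⊆ range k) (hw : ∀ c < g, ∀ v < k, w c v + 1 ≤ 2 ^ H) {j : ℕ} (hj : j ≤ g) :
    ∏ c ∈ range j, indepSum nbr (w c) S ≤ 2 ^ (H * k * g) := by
  calc ∏ c ∈ range j, indepSum nbr (w c) S ≤ ∏ _c ∈ range j, 2 ^ (H * k) :=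
        prod_le_prod' fun c hc => indepSum_le hS (hw c ((mem_range.1 hc).trans_le hj))
    _ = 2 ^ (H * k * j) := by rw [prod_const, card_range, ← pow_mul]
    _ ≤ _ := Nat.pow_le_pow_right (by norm_num) (Nat.mul_le_mul_left _ hj)

/-- A bound for the number of steps of `total`, where `E = 2 ^ k`. -/
def totalSteps (E k g : ℕ) : ℕ :=
  E * 3 + 2 + (g * (indepSteps E k + (E * 3 + 2) + 2) + 2) + (E * 5 + 5)

theorem int_natAbs_sub (a b : ℕ) : ((a : ℤ) - b).natAbs = (a - b) + (b - a) := by omega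

section Spec

variable {B n k m g H : ℕ} {fst snd : ℕ → ℕ} {base : ℕ → ℕ → Bool} {s : Memory}

/-- Memory holds natural numbers, so even and odd sets are summed separately and subtracted both
ways; at least one truncated difference vanishes. Each product is at most `2 ^ (H * k * g)` and
there are `2 ^ k` of them, whence `hH`. -/
theorem wp_total (hB3 : 3 ≤ B) (hk : s 0 1 = k) (h2 : s 2 0 = 2 ^ k) {rel : ℕ → ℕ → Bool}
    (h3 : ∀ a < k, ∀ b < k, s 3 (a * k + b) = (rel a b).toNat)
    (h4 : ∀ X < 2 ^ k, s 4 X = #(bits X) % 2) (h7 : s 7 0 = g) {w : ℕ → ℕ → ℕ}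
    (h23 : ∀ c < g, ∀ v < k, s 23 (c * k + v) = w c v)
    (hw : ∀ c < g, ∀ v < k, w c v + 1 ≤ 2 ^ H) (hH : H * k * g + k < B) (hg : g < 2 ^ B) :
    WP B Prog.total s (totalSteps (2 ^ k) k g) fun s' =>
      s' 38 0 = coverTotal (symmRel rel) k g w := by
  have hB8 := eight_le_two_pow hB3
  have hkB' : 2 ^ k < 2 ^ B := Nat.pow_lt_pow_right (by norm_num) (by omega)
  have hprod : ∀ j ≤ g, ∀ X < 2 ^ k,
      ∏ c ∈ range j, indepSum (symmRel rel) (w c) (bits X) < 2 ^ B := fun j hj X hX =>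
    (prod_indepSum_le (bits_subset_range hX) hw hj).trans_lt
      (Nat.pow_lt_pow_right (by norm_num) (by omega))
  have hsum : ∀ j ≤ 2 ^ k, ∀ p : ℕ → Prop, ∀ _ : DecidablePred p,
      (∑ X ∈ range j, if p X then ∏ c ∈ range g, indepSum (symmRel rel) (w c) (bits X) else 0)
        < 2 ^ B := by
    intro j hj p _
    calc (∑ X ∈ range j, if p X then ∏ c ∈ range g, indepSum (symmRel rel) (w c) (bits X) else 0)
        ≤ ∑ _X ∈ range j, 2 ^ (H * k * g) := by
          refine sum_le_sum fun X hX => ?_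
          split_ifs
          · exact prod_indepSum_le (bits_subset_range ((mem_range.1 hX).trans_le hj)) hw le_rfl
          · exact Nat.zero_le _
      _ = j * 2 ^ (H * k * g) := by simp
      _ ≤ 2 ^ k * 2 ^ (H * k * g) := Nat.mul_le_mul_right _ hj
      _ = 2 ^ (H * k * g + k) := by rw [← pow_add, add_comm]
      _ < 2 ^ B := Nat.pow_lt_pow_right (by norm_num) hH
  have hproducts : WP B Prog.products s
      (2 ^ k * 3 + 2 + (g * (indepSteps (2 ^ k) k + (2 ^ k * 3 + 2) + 2) + 2)) fun s' =>
      ∀ X < 2 ^ k, s' 25 X = ∏ c ∈ range g, indepSum (symmRel rel) (w c) (bits X) := by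
    refine WP.call (WP.forLoop (M := 1) (n := 2 ^ k) (fun i s' => ∀ X < i, s' 25 X = 1)
      (Q := fun s' => ∀ X < 2 ^ k, s' 25 X = 1) h2 hkB' (by simp) ?_ (fun s' _ h => h))
      fun s₁ hf₁ h25 =>
      WP.forLoop (M := indepSteps (2 ^ k) k + (2 ^ k * 3 + 2)) (n := g)
        (fun j s' => ∀ X < 2 ^ k,
          s' 25 X = ∏ c ∈ range j, indepSum (symmRel rel) (w c) (bits X))
        ((congrFun (hf₁ 7 rfl) 0).trans h7) hg (by simpa using h25) ?_ (fun s' _ h => h)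
    · intro i hi s₁ hf₁ h27 inv
      refine WP.write (a' := i) (v := 1) (by simp [h27]) rfl (by omega) fun X hX => ?_
      by_cases h : X = i
      · simp [Memory.store, h]
      · simp [Memory.store, h, inv X (by omega)]
    · intro j hj s₂ hf₂ h28 inv
      have hHk : H * k ≤ H * k * g := Nat.le_mul_of_pos_right _ (by omega)
      have f0 : s₂ 0 1 = k := (congrFun ((hf₂ 0 rfl).trans (hf₁ 0 rfl)) 1).trans hk
      have f2 : s₂ 2 0 = 2 ^ k := (congrFun ((hf₂ 2 rfl).trans (hf₁ 2 rfl)) 0).trans h2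
      have f3 : s₂ 3 = s 3 := (hf₂ 3 rfl).trans (hf₁ 3 rfl)
      have f23 : s₂ 23 = s 23 := (hf₂ 23 rfl).trans (hf₁ 23 rfl)
      refine WP.call (wp_indepSums hB3 f0 (rel := rel) (w := w j) (by rw [f3]; exact h3)
        (by omega) h28 (by rw [f23]; exact h23 j hj) fun S hS =>
          (indepSum_le hS (hw j hj)).trans_lt (Nat.pow_lt_pow_right (by norm_num) (by omega)))
        fun s₃ hf₃ h26 => WP.forLoop (M := 1) (n := 2 ^ k)
          (fun i s' => (∀ X < i, s' 25 X
              = ∏ c ∈ range (j + 1), indepSum (symmRel rel) (w c) (bits X)) ∧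
            ∀ X < 2 ^ k, i ≤ X → s' 25 X = ∏ c ∈ range j, indepSum (symmRel rel) (w c) (bits X))
          ((congrFun (hf₃ 2 rfl) 0).trans f2) hkB' ⟨by simp, fun X hX _ => ?_⟩ ?_
          fun s' _ h => h.1
      · rw [hf₃ 25 rfl]; exact inv X hX
      · intro i hi s₄ hf₄ h27 ⟨i1, i2⟩
        have k26 : s₄ 26 = s₃ 26 := hf₄ 26 rfl
        refine WP.write (a' := i)
          (v := ∏ c ∈ range (j + 1), indepSum (symmRel rel) (w c) (bits i)) (by simp [h27]) ?_
          (hprod _ hj i hi) ⟨fun X hX => ?_, fun X hX hiX => ?_⟩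
        · simp [h27, k26, h26 i hi, i2 i hi le_rfl, prod_range_succ]
        · by_cases h : X = i
          · simp [Memory.store, h]
          · simp [Memory.store, h, i1 X (by omega)]
        · have : X ≠ i := by omega
          simp [Memory.store, this, i2 X hX (by omega)]
  set F : ℕ → ℕ := fun X => ∏ c ∈ range g, indepSum (symmRel rel) (w c) (bits X) with hF
  refine WP.mono (WP.call hproducts fun s₁ hf₁ h25 => WP.set (v := 0) rfl rfl (by omega) <|
    WP.set (v := 0) rfl rfl (by omega) <| WP.call (N₁ := 2 ^ k * (3 + 2) + 2) (N₂ := 1)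
      (WP.forLoop (M := 3) (n := 2 ^ k)
        (fun i s' => s' 36 0 = (∑ X ∈ range i, if #(bits X) % 2 = 0 then F X else 0) ∧
          s' 37 0 = ∑ X ∈ range i, if ¬ #(bits X) % 2 = 0 then F X else 0)
        ((congrFun (hf₁ 2 rfl) 0).trans h2) hkB' ?_ ?_ (fun s' _ h => h))
      fun s₂ hf₂ ⟨h36, h37⟩ =>
        WP.write (v := coverTotal (symmRel rel) k g w) rfl ?_ ?_ rfl) ?_
  · simp [Memory.store]
  · intro i hi s₂ hf₂ h27 ⟨i36, i37⟩
    have e4 : s₂ 4 i = #(bits i) % 2 :=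
      (congrFun ((hf₂ 4 rfl).trans (hf₁ 4 rfl)) i).trans (h4 i hi)
    have e25 : s₂ 25 i = F i := (congrFun (hf₂ 25 rfl) i).trans (h25 i hi)
    refine WP.ite (N₁ := 1) (N₂ := 1) (fun hg => ?_) fun hg => ?_
    all_goals simp only [Expr.eval_read, Expr.eval_reg, h27, e4] at hg
    · refine WP.write (v := ∑ X ∈ range (i + 1), if ¬ #(bits X) % 2 = 0 then F X else 0) rfl ?_
        (hsum _ hi _ _) ⟨?_, ?_⟩
      · rw [sum_range_succ, if_pos hg]
        simp [i37, h27, e25]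
      · change s₂ 36 0 = _
        rw [i36, sum_range_succ, if_neg hg, add_zero]
      · simp [Memory.store]
    · refine WP.write (v := ∑ X ∈ range (i + 1), if #(bits X) % 2 = 0 then F X else 0) rfl ?_
        (hsum _ hi _ _) ⟨?_, ?_⟩
      · rw [sum_range_succ, if_pos hg]
        simp [i36, h27, e25]
      · simp [Memory.store]
      · change s₂ 37 0 = _
        rw [i37, sum_range_succ, if_neg (not_not.2 hg), add_zero]
  all_goals try
    have hct : coverTotal (symmRel rel) k g w = (s₂ 36 0 - s₂ 37 0) + (s₂ 37 0 - s₂ 36 0) := by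
      rw [← int_natAbs_sub, coverTotal, h36, h37]
      push_cast
      rw [← sum_sub_distrib]
      congr 1
      refine sum_congr rfl fun X _ => ?_
      rcases Nat.mod_two_eq_zero_or_one #(bits X) with h | h
      · rw [(Nat.even_iff.2 h).neg_one_pow]; simp [h, hF]
      · rw [(Nat.odd_iff.2 h).neg_one_pow]; simp [h, hF]
  · rw [hct]; simp
  · have p1 := hsum (2 ^ k) le_rfl (fun X => #(bits X) % 2 = 0) inferInstance
    have p2 := hsum (2 ^ k) le_rfl (fun X => ¬ #(bits X) % 2 = 0) inferInstance
    rw [hct, h36, h37]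
    change (∑ X ∈ range (2 ^ k), if #(bits X) % 2 = 0 then F X else 0) < 2 ^ B at p1
    change (∑ X ∈ range (2 ^ k), if ¬ #(bits X) % 2 = 0 then F X else 0) < 2 ^ B at p2
    omega
  · unfold totalSteps
    omega

/-- The weights of the colors `γ` with parameter `Z`. -/
def initialWeight (n : ℕ) (base rel : ℕ → ℕ → Bool) (γ : ℕ → ℕ) (Z c v : ℕ) : ℕ :=
  maskWeight n base 1 Z v (γ c) * (1 - (rel v v).toNat)

theorem wp_weights (hB3 : 3 ≤ B) (hin : IsInput (s 0) n k m fst snd base) (h2 : s 2 0 = 2 ^ k)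
    {rel : ℕ → ℕ → Bool}
    (h3 : ∀ a < k, ∀ b < k, s 3 (a * k + b) = (rel a b).toNat) (h7 : s 7 0 = g)
    (hγ : ∀ c < g, s 6 c < 2 ^ n)
    (hn : n < 2 ^ B) (hk : k < 2 ^ B) (hg : g < 2 ^ B) (hZ : 2 * (2 ^ k) ^ g < 2 ^ B)
    (hZn : 0 < k → (2 * (2 ^ k) ^ g) ^ n < 2 ^ B) :
    WP B Prog.weights s (g * (k * (n * 5 + 8) + 7) + 6) fun s' =>
      s' 9 0 = 2 * (2 ^ k) ^ g ∧ ∀ c < g, ∀ v < k,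
        s' 23 (c * k + v) = initialWeight n base rel (s 6) (2 * (2 ^ k) ^ g) c v := by
  have hB8 := eight_le_two_pow hB3
  set Z := 2 * (2 ^ k) ^ g with hZdef
  have hZ2 : 2 ≤ Z := by
    have : 0 < (2 ^ k) ^ g := by positivity
    omega
  refine WP.mono (WP.set (v := 1) rfl rfl (by omega) <| WP.set (v := 2) rfl rfl (by omega) <|
    WP.call (N₁ := g * (1 + 2) + 2) (N₂ := g * (k * (n * 5 + 6 + 2) + 2 + 2) + 2)
      (WP.forLoop (M := 1) (n := g) (fun i s' => s' 9 0 = 2 * (2 ^ k) ^ i)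
        (Q := fun s' => s' 9 0 = Z) h7 hg (by simp [Memory.store]) ?_ fun s' _ h => h)
    fun s₁ hf₁ h9 =>
      WP.forLoop (M := k * (n * 5 + 6 + 2) + 2) (n := g)
        (fun i s' => ∀ c < i, ∀ v < k, s' 23 (c * k + v) = initialWeight n base rel (s 6) Z c v)
        ((congrFun (hf₁ 7 rfl) 0).trans h7) hg (by simp) ?_ ?_)
      (N := g * (1 + 2) + 2 + (g * (k * (n * 5 + 6 + 2) + 2 + 2) + 2) + 2) (le_of_eq (by ring))
  · intro i hi s₁ hf₁ h24 h9
    have e2 : s₁ 2 0 = 2 ^ k := (congrFun (hf₁ 2 rfl) 0).trans h2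
    refine WP.write (v := 2 * (2 ^ k) ^ (i + 1)) rfl ?_ ?_ rfl
    · simp [h9, e2, pow_succ, mul_assoc]
    · refine lt_of_le_of_lt (Nat.mul_le_mul_left _ ?_) hZ
      exact Nat.pow_le_pow_right (by positivity) hi
  · intro c hc s₂ hf₂ h24 inv
    have e0 : s₂ 0 = s 0 := (hf₂ 0 rfl).trans (hf₁ 0 rfl)
    refine WP.forLoop (M := n * 5 + 6) (n := k)
      (fun i s' => (∀ c' < c, ∀ v < k, s' 23 (c' * k + v)
        = initialWeight n base rel (s 6) Z c' v) ∧
        ∀ v < i, s' 23 (c * k + v) = initialWeight n base rel (s 6) Z c v)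
      ((congrFun e0 1).trans hin.numR) hk ⟨inv, by simp⟩ ?_ ?_
    · intro r hr s₃ hf₃ h11 ⟨i1, i2⟩
      have hZn' := hZn (by omega)
      have f0 : s₃ 0 = s 0 := (hf₃ 0 rfl).trans e0
      have f3 : s₃ 3 = s 3 := (hf₃ 3 rfl).trans ((hf₂ 3 rfl).trans (hf₁ 3 rfl))
      have f6 : s₃ 6 = s 6 := (hf₃ 6 rfl).trans ((hf₂ 6 rfl).trans (hf₁ 6 rfl))
      have f8 : s₃ 8 0 = 1 := congrFun ((hf₃ 8 rfl).trans ((hf₂ 8 rfl).trans (hf₁ 8 rfl))) 0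
      have f9 : s₃ 9 0 = Z := (congrFun ((hf₃ 9 rfl).trans (hf₂ 9 rfl)) 0).trans h9
      have f24 : s₃ 24 0 = c := (congrFun (hf₃ 24 rfl) 0).trans h24
      -- Since `2 ≤ Z`, the bound on `Z ^ n` also bounds the masks.
      have hcB : s 6 c < 2 ^ B := (hγ c hc).trans_le ((Nat.pow_le_pow_left hZ2 n).trans hZn'.le)
      have hle := maskWeight_le (α := 1) (β := Z) (Z := Z) (by omega) le_rfl (by omega) n base r
        (s 6 c)
      have hv : initialWeight n base rel (s 6) Z c r < 2 ^ B := by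
        refine lt_of_le_of_lt ?_ (hle.trans_lt hZn')
        unfold initialWeight
        exact (Nat.mul_le_mul_left _ (Nat.sub_le 1 _)).trans_eq (mul_one _)
      refine WP.mono (WP.set (v := s 6 c) rfl (by simp [f24, f6]) hcB <|
        WP.call (wp_weight hB3 (by change IsInput (s₃ 0) n k m fst snd base; rw [f0]; exact hin)
          (α := 1) (β := Z) (Z := Z) (r := r) (c := s 6 c)
          (by omega) le_rfl (by omega) hZn' hn hcB hr f8 f9 rfl h11)
        fun s₄ hf₄ h12 => WP.write (a' := c * k + r)
          (v := initialWeight n base rel (s 6) Z c r) ?_ ?_ hv ⟨?_, ?_⟩)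
        (by omega)
      all_goals
        have g0 : s₄ 0 1 = k :=
          (congrFun (hf₄ 0 rfl) 1).trans ((congrFun f0 1).trans hin.numR)
        have g11 : s₄ 11 0 = r := (congrFun (hf₄ 11 rfl) 0).trans h11
        have g24 : s₄ 24 0 = c := (congrFun (hf₄ 24 rfl) 0).trans f24
        have g3 : s₄ 3 = s 3 := (hf₄ 3 rfl).trans f3
        have g23 : s₄ 23 = s₃ 23 := hf₄ 23 rfl
      · simp [g0, g11, g24]
      · simp [g0, g11, g3, h12, h3 r hr r hr, initialWeight]
      · intro c' hc' v hv
        have : c' * k + v ≠ c * k + r := by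
          rw [Ne, mul_add_inj hv hr]; omega
        simp [Memory.store, this, g23, i1 c' hc' v hv]
      · intro v hv
        by_cases h : v = r
        · simp [Memory.store, h]
        · simp [Memory.store, h, g23, i2 v (by omega)]
    · intro s' _ ⟨i1, i2⟩ c' hc'
      rcases Nat.lt_succ_iff_lt_or_eq.1 hc' with h | rfl
      · exact i1 c' h
      · exact i2
  · intro s' hf' h
    exact ⟨(congrFun (hf' 9 rfl) 0).trans h9, h⟩

theorem eval_totalModD (s : Memory) : Prog.totalModD.eval s = s 38 0 % s 39 0 := by
  simp only [Expr.eval_sub, Expr.eval_mul, Expr.eval_div, Expr.eval_reg]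
  rw [Nat.mod_eq_sub_div_mul]

/-- The loop has a fixed number of rounds; once the power does not divide `P`, the register no
longer changes. In the application `W` is the optimal cost plus one. -/
theorem wp_modulus (hB3 : 3 ≤ B) (hn : s 0 0 = n) (hk : s 0 1 = k) {P Z : ℕ} (h38 : s 38 0 = P)
    (h9 : s 9 0 = Z) (hZ : 1 ≤ Z) (hZB : Z ^ (k * n + 1) < 2 ^ B) (hkn : k * n + 1 < 2 ^ B)
    (hP : ∃ W ≤ k * n + 1, ¬ Z ^ W ∣ P) :
    WP B Prog.modulus s (k * n * 5 + 8) fun s' =>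
      ∃ W, s' 39 0 = Z ^ W ∧ ¬ Z ^ W ∣ P ∧ ∀ W' < W, Z ^ W' ∣ P := by
  have hB8 := eight_le_two_pow hB3
  refine WP.mono (WP.set (v := 1) rfl rfl (by omega) <|
    WP.forLoop (M := 3) (n := k * n + 1)
      (fun i s' => ∃ W ≤ i, s' 39 0 = Z ^ W ∧ (∀ W' < W, Z ^ W' ∣ P) ∧
        (W = i ∨ ¬ Z ^ W ∣ P)) ?_ hkn ?_ ?_ ?_) (by omega)
  · simp [Memory.store, hn, hk]
  · exact ⟨0, le_rfl, rfl, by simp, Or.inl rfl⟩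
  · intro i hi s₁ hf₁ h40 ⟨W, hWi, h39, hdvd, hor⟩
    have e38 : s₁ 38 0 = P := (congrFun (hf₁ 38 rfl) 0).trans h38
    have e9 : s₁ 9 0 = Z := (congrFun (hf₁ 9 rfl) 0).trans h9
    refine WP.ite (N₁ := 1) (N₂ := 1) (fun hg => ?_) fun hg => ?_
    all_goals rw [eval_totalModD, e38, h39] at hg
    · exact WP.skip ⟨W, by omega, h39, hdvd, Or.inr fun h => hg (Nat.mod_eq_zero_of_dvd h)⟩
    · have hd : Z ^ W ∣ P := Nat.dvd_of_mod_eq_zero hg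
      obtain rfl : W = i := hor.resolve_right fun h => h hd
      refine WP.write (v := Z ^ (W + 1)) rfl (by simp [h39, e9, pow_succ])
        ((Nat.pow_le_pow_right hZ hi).trans_lt hZB) ⟨W + 1, le_rfl, rfl, ?_, Or.inl rfl⟩
      intro W' hW'
      exact (pow_dvd_pow Z (by omega)).trans hd
  · rintro s' _ ⟨W, hWi, h39, hdvd, hor⟩
    refine ⟨W, h39, ?_, hdvd⟩
    rcases hor with rfl | h
    · obtain ⟨W', hW', hW''⟩ := hP
      exact fun h => hW'' ((pow_dvd_pow Z hW').trans h)
    · exact h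

/-- Self-reducibility, with `hT` as the test whether the support of the weights contains a good
coloring. An entry is restored only if all good colorings left in the support use it, and this
persists as the support shrinks. In the end a good coloring remains and uses every remaining entry,
so the support is its graph. -/
theorem wp_reduce (hB3 : 3 ≤ B) (hk : s 0 1 = k) (h2 : s 2 0 = 2 ^ k) {rel : ℕ → ℕ → Bool}
    (h3 : ∀ a < k, ∀ b < k, s 3 (a * k + b) = (rel a b).toNat)
    (h4 : ∀ X < 2 ^ k, s 4 X = #(bits X) % 2) (h7 : s 7 0 = g) {w₀ : ℕ → ℕ → ℕ}
    (h23 : ∀ c < g, ∀ v < k, s 23 (c * k + v) = w₀ c v)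
    (hw : ∀ c < g, ∀ v < k, w₀ c v + 1 ≤ 2 ^ H) (hH : H * k * g + k < B) (hg : g < 2 ^ B)
    (hkB : k < 2 ^ B) {D : ℕ} (h39 : s 39 0 = D) {Good : (ℕ → ℕ) → Prop}
    (hGood : ∀ col, Good col → ∀ v < k, col v < g)
    (hT : ∀ w : ℕ → ℕ → ℕ, (∀ c < g, ∀ v < k, w c v = 0 ∨ w c v = w₀ c v) →
      (coverTotal (symmRel rel) k g w % D ≠ 0 ↔ ∃ col, Good col ∧ ∀ v < k, w (col v) v ≠ 0))
    (hD : coverTotal (symmRel rel) k g w₀ % D ≠ 0) :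
    WP B Prog.reduce s (g * (k * (totalSteps (2 ^ k) k g + 7) + 4) + 2) fun s' =>
      ∃ col, Good col ∧ (∀ v < k, w₀ (col v) v ≠ 0) ∧
        ∀ c < g, ∀ v < k, (s' 23 (c * k + v) ≠ 0 ↔ c = col v) := by
  have hB8 := eight_le_two_pow hB3
  let Inv : (ℕ → ℕ → Prop) → (ℕ → ℕ) → Prop := fun Done t =>
    (∀ c < g, ∀ v < k, t (c * k + v) = 0 ∨ t (c * k + v) = w₀ c v) ∧
    (∃ col, Good col ∧ ∀ v < k, t (col v * k + v) ≠ 0) ∧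
    ∀ c < g, ∀ v < k, Done c v → t (c * k + v) ≠ 0 →
      ∀ col, Good col → (∀ v < k, t (col v * k + v) ≠ 0) → col v = c
  have Inv_congr : ∀ D D' t, (∀ c v, v < k → D' c v → D c v) → Inv D t → Inv D' t :=
    fun D D' t h hI => ⟨hI.1, hI.2.1, fun c hc v hv hd => hI.2.2 c hc v hv (h c v hv hd)⟩
  refine WP.forLoop (M := k * (totalSteps (2 ^ k) k g + 7) + 2) (n := g)
    (fun c s' => Inv (fun c' _ => c' < c) (s' 23)) h7 hg ?_ ?_ ?_
  · refine ⟨fun c hc v hv => Or.inr (h23 c hc v hv), ?_, by simp⟩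
    obtain ⟨col, hc, hv⟩ := (hT w₀ fun _ _ _ _ => Or.inr rfl).1 hD
    exact ⟨col, hc, fun v hvk => by rw [h23 _ (hGood col hc v hvk) v hvk]; exact hv v hvk⟩
  · intro c hc s₁ hf₁ h24 inv
    have e0 : s₁ 0 1 = k := (congrFun (hf₁ 0 rfl) 1).trans hk
    refine WP.forLoop (M := totalSteps (2 ^ k) k g + 5) (n := k)
      (fun r s' => Inv (fun c' v => c' < c ∨ c' = c ∧ v < r) (s' 23)) e0 hkB
      (Inv_congr _ _ _ (by simp) inv) ?_ ?_
    · intro r hr s₂ hf₂ h11 ⟨i1, ⟨col, hcol, hcol'⟩, i3⟩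
      have f0 : s₂ 0 1 = k := (congrFun (hf₂ 0 rfl) 1).trans e0
      have f2 : s₂ 2 0 = 2 ^ k :=
        (congrFun ((hf₂ 2 rfl).trans (hf₁ 2 rfl)) 0).trans h2
      have f3 : s₂ 3 = s 3 := (hf₂ 3 rfl).trans (hf₁ 3 rfl)
      have f4 : s₂ 4 = s 4 := (hf₂ 4 rfl).trans (hf₁ 4 rfl)
      have f7 : s₂ 7 0 = g := (congrFun ((hf₂ 7 rfl).trans (hf₁ 7 rfl)) 0).trans h7
      have f24 : s₂ 24 0 = c := (congrFun (hf₂ 24 rfl) 0).trans h24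
      have f39 : s₂ 39 0 = D := (congrFun ((hf₂ 39 rfl).trans (hf₁ 39 rfl)) 0).trans h39
      set t := s₂ 23 with ht
      let t' : ℕ → ℕ := fun a => if a = c * k + r then 0 else t a
      have ht' : ∀ c' < g, ∀ v < k, t' (c' * k + v)
          = if c' = c ∧ v = r then 0 else t (c' * k + v) := by
        intro c' _ v hv
        simp only [t', mul_add_inj hv hr]
      have i1' : ∀ c < g, ∀ v < k, t' (c * k + v) = 0 ∨ t' (c * k + v) = w₀ c v := by
        intro c' hc' v hv
        rw [ht' c' hc' v hv]
        split_ifs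
        · exact Or.inl rfl
        · exact i1 c' hc' v hv
      have hle : ∀ a, t' a ≠ 0 → t a ≠ 0 := by
        intro a ha
        simp only [t'] at ha
        split_ifs at ha
        · exact absurd rfl ha
        · exact ha
      have hpow : 1 ≤ 2 ^ H := Nat.one_le_two_pow
      have hold : t (c * k + r) < 2 ^ B := by
        have := hw c hc r hr
        have hHB : H ≤ H * k * g := by
          rw [mul_assoc]
          exact Nat.le_mul_of_pos_right _ (Nat.mul_pos (by omega) (by omega))
        have : 2 ^ H ≤ 2 ^ B := Nat.pow_le_pow_right (by norm_num) (by omega)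
        rcases i1 c hc r hr with h | h <;> rw [h] <;> omega
      have hTt := hT (fun c v => t' (c * k + v)) i1'
      refine WP.mono (WP.set (v := t (c * k + r)) rfl (by simp [f0, f24, h11, ht]) hold <|
        WP.set (a' := c * k + r) (v := 0) ?_ rfl (by omega) <|
        WP.call (wp_total hB3 (g := g) (k := k) (H := H) (rel := rel)
          (w := fun c v => t' (c * k + v)) (by exact f0) (by exact f2)
          (by change ∀ a < k, ∀ b < k, s₂ 3 (a * k + b) = _; rw [f3]; exact h3)
          (by change ∀ X < 2 ^ k, s₂ 4 X = _; rw [f4]; exact h4) (by exact f7) (fun c' hc' v hv => ?_)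
          (fun c' hc' v hv => ?_) hH hg)
        fun s₃ hf₃ h38 => WP.ite (N₁ := 1) (N₂ := 1) (fun hg => ?_) fun hg => ?_) (by omega)
      · simp [Memory.store, f0, f24, h11]
      · simp [Memory.store, t', ht]
      · rcases i1' c' hc' v hv with h | h <;> rw [h]
        · omega
        · exact hw c' hc' v hv
      all_goals
        have g39 : s₃ 39 0 = D := (congrFun (hf₃ 39 rfl) 0).trans f39
        have g23 : s₃ 23 = t' := (hf₃ 23 rfl).trans (by
          funext a; simp [Memory.store, t', ht])
        rw [eval_totalModD, h38, g39] at hg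
      · refine WP.skip ?_
        rw [g23]
        refine ⟨i1', hTt.1 hg, fun c' hc' v hv hd hne col' hcol1 hcol2 => ?_⟩
        have hcv : ¬ (c' = c ∧ v = r) := fun h => hne (by rw [ht' c' hc' v hv, if_pos h])
        exact i3 c' hc' v hv (by omega) (hle _ hne) col' hcol1 fun v hv => hle _ (hcol2 v hv)
      · have g0 : s₃ 0 1 = k := (congrFun (hf₃ 0 rfl) 1).trans f0
        have g24 : s₃ 24 0 = c := (congrFun (hf₃ 24 rfl) 0).trans f24
        have g11 : s₃ 11 0 = r := (congrFun (hf₃ 11 rfl) 0).trans h11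
        have g41 : s₃ 41 0 = t (c * k + r) := congrFun (hf₃ 41 rfl) 0
        refine WP.write (a' := c * k + r) (v := t (c * k + r)) (by simp [g0, g24, g11])
          (by simp [g41]) hold ?_
        have hst : s₃.store 23 (c * k + r) (t (c * k + r)) 23 = t := by
          funext a
          by_cases h : a = c * k + r <;> simp [Memory.store, h, g23, t']
        rw [hst]
        refine ⟨i1, ⟨col, hcol, hcol'⟩, fun c' hc' v hv hd hne col' hcol1 hcol2 => ?_⟩
        by_cases hcv : c' = c ∧ v = r
        · obtain ⟨rfl, rfl⟩ := hcv
          -- A good coloring that avoids the entry would survive its deletion, and the remainder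
          -- would not be 0.
          by_contra hcc
          refine hTt.2 ⟨col', hcol1, fun v' hv' => ?_⟩ hg
          rw [ht' _ (hGood col' hcol1 v' hv') v' hv', if_neg]
          · exact hcol2 v' hv'
          · rintro ⟨h, rfl⟩
            exact hcc h
        · exact i3 c' hc' v hv (by omega) hne col' hcol1 hcol2
    · intro s' _ h
      exact Inv_congr _ _ _ (fun c' v hv hd => by omega) h
  · rintro s' _ ⟨h0, ⟨col, hcol, hcol'⟩, h⟩
    refine ⟨col, hcol, fun v hv => ?_, fun c hc v hv => ⟨fun hne => ?_, fun h => h ▸ hcol' v hv⟩⟩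
    · rw [← (h0 _ (hGood col hcol v hv) v hv).resolve_left (hcol' v hv)]
      exact hcol' v hv
    · exact (h c hc v hv hc hne col hcol hcol').symm

theorem wp_output (hB3 : 3 ≤ B) (hn : s 0 0 = n) (hk : s 0 1 = k) (h7 : s 7 0 = g)
    {col : ℕ → ℕ} (hcol : ∀ v < k, col v < g)
    (h23 : ∀ c < g, ∀ v < k, (s 23 (c * k + v) ≠ 0 ↔ c = col v))
    (h6 : ∀ c < g, s 6 c < 2 ^ B) (hnB : n < 2 ^ B) (hkB : k < 2 ^ B) (hg : g < 2 ^ B) :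
    WP B Prog.output s (g * (k * (n * 4 + 7) + 4) + 3) fun s' =>
      s' 1 0 = 1 ∧ ∀ v < k, ∀ u < n,
        s' 1 (1 + u * k + v) = ((s 6 (col v)).testBit u).toNat := by
  have hB8 := eight_le_two_pow hB3
  refine WP.mono (WP.set (v := 1) rfl rfl (by omega) <|
    WP.forLoop (M := k * (n * 4 + 7) + 2) (n := g)
      (fun c s' => s' 1 0 = 1 ∧ ∀ v < k, col v < c → ∀ u < n,
        s' 1 (1 + u * k + v) = ((s 6 (col v)).testBit u).toNat)
      h7 hg (by simp [Memory.store]) ?_ fun s' _ h => ⟨h.1, fun v hv => h.2 v hv (hcol v hv)⟩)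
    (N := g * (k * (n * 4 + 7) + 2 + 2) + 2 + 1) (le_of_eq (by ring))
  intro c hc s₁ hf₁ h24 inv
  have e0 : s₁ 0 = s 0 := hf₁ 0 rfl
  refine WP.forLoop (M := n * 4 + 5) (n := k)
    (fun r s' => s' 1 0 = 1 ∧ ∀ v < k, (col v < c ∨ col v = c ∧ v < r) → ∀ u < n,
        s' 1 (1 + u * k + v) = ((s 6 (col v)).testBit u).toNat)
    ((congrFun e0 1).trans hk) hkB ⟨inv.1, by simpa using inv.2⟩ ?_ ?_
  · intro r hr s₂ hf₂ h11 ⟨i1, i2⟩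
    have f0 : s₂ 0 = s 0 := (hf₂ 0 rfl).trans e0
    have f0k : s₂ 0 1 = k := (congrFun f0 1).trans hk
    have f6 : s₂ 6 = s 6 := (hf₂ 6 rfl).trans (hf₁ 6 rfl)
    have f23 : s₂ 23 = s 23 := (hf₂ 23 rfl).trans (hf₁ 23 rfl)
    have f24 : s₂ 24 0 = c := (congrFun (hf₂ 24 rfl) 0).trans h24
    refine WP.mono (WP.ite (N₁ := n * 4 + 3) (N₂ := 1) (fun hg => ?_) fun hg => ?_) (by omega)
    all_goals simp only [Expr.eval_read, Expr.eval_add, Expr.eval_mul, Expr.eval_reg,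
      Expr.eval_one, f24, f0k, h11, f23] at hg
    · have hcr : c = col r := (h23 c hc r hr).1 hg
      refine WP.mono (WP.set (v := s 6 c) rfl (by simp [f24, f6]) (h6 c hc) <|
        WP.forLoop (M := 2) (n := n)
          (fun u' s' => s' 42 0 = s 6 c / 2 ^ u' ∧ s' 1 0 = 1 ∧
            (∀ v < k, (col v < c ∨ col v = c ∧ v < r) → ∀ u < n,
              s' 1 (1 + u * k + v) = ((s 6 (col v)).testBit u).toNat) ∧
            ∀ u < u', s' 1 (1 + u * k + r) = ((s 6 c).testBit u).toNat)
          ((congrFun f0 0).trans hn) hnB ⟨by simp [Memory.store], i1, i2, by simp⟩ ?_ ?_)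
        (by omega)
      · intro u hu s₃ hf₃ h43 ⟨j42, j1, j2, j3⟩
        have k0 : s₃ 0 1 = k := (congrFun (hf₃ 0 rfl) 1).trans f0k
        have k11 : s₃ 11 0 = r := (congrFun (hf₃ 11 rfl) 0).trans h11
        have hbit := div_two_pow_mod_two (s 6 c) u
        refine WP.set (a' := 1 + u * k + r) (v := ((s 6 c).testBit u).toNat)
          (by simp [h43, k0, k11]) (by simp [j42, hbit]) ((Bool.toNat_lt _).trans_le (by omega)) <|
          WP.write (v := s 6 c / 2 ^ (u + 1)) rfl ?_ ((Nat.div_le_self _ _).trans_lt (h6 c hc))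
          ⟨rfl, ?_, ?_, ?_⟩
        · simp [Memory.store, j42, Nat.div_div_eq_div_mul, pow_succ]
        · have : 0 ≠ 1 + u * k + r := by omega
          simp [Memory.store, this, j1]
        · intro v hv hcv u' hu'
          have : ¬ 1 + u' * k + v = 1 + u * k + r := by
            rw [add_assoc, add_assoc, add_right_inj, mul_add_inj hv hr]
            rintro ⟨rfl, rfl⟩
            omega
          simp [Memory.store, this, j2 v hv hcv u' hu']
        · intro u' hu'
          by_cases h : u' = u
          · simp [Memory.store, h]
          · have hk0 : k ≠ 0 := by omega
            simp [Memory.store, h, hk0, j3 u' (by omega)]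
      · intro s' _ ⟨_, j1, j2, j3⟩
        refine ⟨j1, fun v hv hcv u hu => ?_⟩
        by_cases h : col v < c ∨ col v = c ∧ v < r
        · exact j2 v hv h u hu
        · obtain rfl : v = r := by omega
          rw [j3 u hu, ← hcr]
    · refine WP.skip ⟨i1, fun v hv hcv u hu => i2 v hv ?_ u hu⟩
      have hcr : c ≠ col r := fun h => ((h23 c hc r hr).2 h) hg
      rcases hcv with h | ⟨h, hvr⟩
      · exact Or.inl h
      · refine Or.inr ⟨h, lt_of_le_of_ne (by omega) ?_⟩
        rintro rfl
        exact hcr h.symm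
  · intro s' _ ⟨i1, i2⟩
    refine ⟨i1, fun v hv hcv => i2 v hv (by omega)⟩

end Spec

end APEP

namespace APEP

open Finset

/-! ## Covers by independent sets -/

/-- With X = U ∪ Y and Y ⊆ V \ U, the alternating sum over Y vanishes unless V \ U is empty. -/
theorem sum_neg_one_pow_card_of_subset {U V : Finset ℕ} (hU : U ⊆ V) :
    ∑ X ∈ V.powerset with U ⊆ X, (-1 : ℤ) ^ #X = if U = V then (-1) ^ #V else 0 := by
  have h1 : ∑ X ∈ V.powerset with U ⊆ X, (-1 : ℤ) ^ #X
      = ∑ Y ∈ (V \ U).powerset, (-1 : ℤ) ^ #U * (-1) ^ #Y := by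
    refine sum_nbij' (fun X => X \ U) (fun Y => U ∪ Y) ?_ ?_ ?_ ?_ ?_
    · intro X hX
      simp only [mem_filter, mem_powerset] at hX ⊢
      exact sdiff_subset_sdiff hX.1 le_rfl
    · intro Y hY
      simp only [mem_filter, mem_powerset] at hY ⊢
      exact ⟨union_subset hU (hY.trans sdiff_subset), subset_union_left⟩
    · intro X hX
      simp only [mem_filter, mem_powerset] at hX
      exact union_sdiff_of_subset hX.2
    · intro Y hY
      have hd : Disjoint U Y := disjoint_of_subset_right (mem_powerset.1 hY) disjoint_sdiff
      exact union_sdiff_cancel_left hd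
    · intro X hX
      simp only [mem_filter, mem_powerset] at hX
      rw [← pow_add, add_comm, card_sdiff_add_card_eq_card hX.2]
  rw [h1, ← mul_sum, sum_powerset_neg_one_pow_card]
  by_cases h : U = V
  · simp [h]
  · have : ¬ V \ U = ∅ := fun he => h (hU.antisymm (sdiff_eq_empty_iff_subset.1 he))
    simp [h, this]

/-- The families of independent sets that cover all resources. -/
def covers (nbr : ℕ → ℕ → Bool) (k g : ℕ) : Finset (Fin g → Finset ℕ) :=
  {τ ∈ Fintype.piFinset fun _ => {T ∈ (range k).powerset | Indep nbr T} |
    univ.biUnion τ = range k}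

theorem mem_covers {nbr : ℕ → ℕ → Bool} {k g : ℕ} {τ : Fin g → Finset ℕ} :
    τ ∈ covers nbr k g ↔ (∀ c, Indep nbr (τ c)) ∧ univ.biUnion τ = range k := by
  simp only [covers, mem_filter, Fintype.mem_piFinset, mem_powerset]
  constructor
  · exact fun h => ⟨fun c => (h.1 c).2, h.2⟩
  · exact fun h => ⟨fun c => ⟨h.2 ▸ subset_biUnion_of_mem τ (mem_univ c), h.1 c⟩, h.2⟩

theorem sum_range_two_pow_bits {M : Type*} [AddCommMonoid M] (k : ℕ) (f : Finset ℕ → M) :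
    ∑ X ∈ range (2 ^ k), f (bits X) = ∑ S ∈ (range k).powerset, f S := by
  refine sum_nbij' bits mask ?_ ?_ ?_ ?_ ?_
  · exact fun X hX => mem_powerset.2 (bits_subset_range (mem_range.1 hX))
  · exact fun S hS => mem_range.2 (mask_lt (mem_powerset.1 hS))
  · simp
  · simp
  · simp

/-- Inclusion-exclusion. The product for X expands into all families of independent subsets of X.
After exchanging the sums, a family with union U receives the alternating sum over X ⊇ U, which is
(-1)^k if U contains all resources and 0 otherwise. The absolute value removes the sign. -/
theorem coverTotal_eq (nbr : ℕ → ℕ → Bool) (k g : ℕ) (w : ℕ → ℕ → ℕ) :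
    coverTotal nbr k g w = ∑ τ ∈ covers nbr k g, ∏ c : Fin g, ∏ v ∈ τ c, w c v := by
  have h1 : ∀ X ∈ (range k).powerset,
      ∏ c ∈ range g, indepSum nbr (w c) X
        = ∑ τ ∈ Fintype.piFinset fun _ : Fin g => {T ∈ (range k).powerset | Indep nbr T},
          if univ.biUnion τ ⊆ X then ∏ c : Fin g, ∏ v ∈ τ c, w c v else 0 := by
    intro X hX
    rw [prod_range, ← sum_filter]
    simp only [indepSum]
    rw [prod_univ_sum]
    refine sum_congr ?_ fun _ _ => rfl
    ext τ
    simp only [mem_filter, Fintype.mem_piFinset, mem_powerset, biUnion_subset, mem_univ,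
      true_imp_iff]
    constructor
    · exact fun h => ⟨fun c => ⟨(h c).1.trans (mem_powerset.1 hX), (h c).2⟩, fun c => (h c).1⟩
    · exact fun h c => ⟨h.2 c, (h.1 c).2⟩
  have h2 : ∑ X ∈ range (2 ^ k), (-1 : ℤ) ^ #(bits X) *
      ((∏ c ∈ range g, indepSum nbr (w c) (bits X) : ℕ) : ℤ)
      = (-1) ^ k * ((∑ τ ∈ covers nbr k g, ∏ c : Fin g, ∏ v ∈ τ c, w c v : ℕ) : ℤ) := by
    rw [sum_range_two_pow_bits k fun S => (-1 : ℤ) ^ #S *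
      ((∏ c ∈ range g, indepSum nbr (w c) S : ℕ) : ℤ)]
    have h3 : ∀ X ∈ (range k).powerset, (-1 : ℤ) ^ #X *
        ((∏ c ∈ range g, indepSum nbr (w c) X : ℕ) : ℤ)
        = ∑ τ ∈ Fintype.piFinset fun _ : Fin g => {T ∈ (range k).powerset | Indep nbr T},
          (if univ.biUnion τ ⊆ X then (-1 : ℤ) ^ #X else 0)
            * ((∏ c : Fin g, ∏ v ∈ τ c, w c v : ℕ) : ℤ) := by
      intro X hX
      rw [h1 X hX, Nat.cast_sum, mul_sum]
      refine sum_congr rfl fun τ _ => ?_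
      split_ifs <;> simp
    rw [sum_congr rfl h3, sum_comm, covers, sum_filter, Nat.cast_sum, mul_sum]
    refine sum_congr rfl fun τ hτ => ?_
    have hU : univ.biUnion τ ⊆ range k := biUnion_subset.2 fun c _ =>
      mem_powerset.1 (mem_filter.1 (Fintype.mem_piFinset.1 hτ c)).1
    rw [← sum_mul, ← sum_filter, sum_neg_one_pow_card_of_subset hU, card_range]
    split_ifs <;> simp
  rw [coverTotal, h2, Int.natAbs_mul, Int.natAbs_pow, Int.natAbs_neg, Int.natAbs_one, one_pow,
    one_mul, Int.natAbs_natCast]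

/-- Each of the `g` members is one of at most `2 ^ k` sets; the factor 2 makes the inequality
strict. -/
theorem card_covers_lt (nbr : ℕ → ℕ → Bool) (k g : ℕ) :
    #(covers nbr k g) < 2 * (2 ^ k) ^ g := by
  have h1 : #(covers nbr k g) ≤ (2 ^ k) ^ g := by
    calc #(covers nbr k g)
        ≤ #(Fintype.piFinset fun _ : Fin g => {T ∈ (range k).powerset | Indep nbr T}) :=
          card_filter_le _ _
      _ = #{T ∈ (range k).powerset | Indep nbr T} ^ g := by simp
      _ ≤ (2 ^ k) ^ g := Nat.pow_le_pow_left ((card_filter_le _ _).trans (by simp)) g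
  have : 0 < (2 ^ k) ^ g := by positivity
  omega

/-- A sum of few powers of `Z` is divisible by `Z ^ W` only if all its terms are. -/
theorem pow_dvd_sum_iff {ι : Type*} {s : Finset ι} {Z W : ℕ} (hZ : #s < Z) {a e : ι → ℕ}
    (ha : ∀ i ∈ s, a i = 0 ∨ a i = Z ^ e i) :
    Z ^ W ∣ ∑ i ∈ s, a i ↔ ∀ i ∈ s, a i ≠ 0 → W ≤ e i := by
  constructor
  · intro h
    by_contra! hcon
    obtain ⟨j, hj, hj0, hjW⟩ := hcon
    -- The terms of least exponent `e i` add up to `Z ^ e i` times their number, which is positive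
    -- and below `Z`. Hence `Z ^ (e i + 1)` does not divide their sum, although it divides all other
    -- terms.
    obtain ⟨i, hi, hmin⟩ := exists_min_image {i ∈ s | a i ≠ 0} e ⟨j, mem_filter.2 ⟨hj, hj0⟩⟩
    obtain ⟨his, hi0⟩ := mem_filter.1 hi
    have hiW : e i < W := (hmin j (mem_filter.2 ⟨hj, hj0⟩)).trans_lt hjW
    have hd : Z ^ (e i + 1) ∣ ∑ i ∈ s, a i := (pow_dvd_pow Z hiW).trans h
    set p : ι → Prop := fun j => a j ≠ 0 ∧ e j = e i with hp
    classical
    rw [← sum_filter_add_sum_filter_not s p] at hd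
    have h1 : Z ^ (e i + 1) ∣ ∑ j ∈ s with ¬ p j, a j := by
      refine dvd_sum fun j hj => ?_
      obtain ⟨hjs, hjp⟩ := mem_filter.1 hj
      rcases ha j hjs with h0 | h0
      · simp [h0]
      · by_cases hj0 : a j = 0
        · simp [hj0]
        · have := hmin j (mem_filter.2 ⟨hjs, hj0⟩)
          have hne : e j ≠ e i := fun he => hjp ⟨hj0, he⟩
          rw [h0]
          exact pow_dvd_pow Z (by omega)
    have h2 := (Nat.dvd_add_left h1).1 hd
    have h3 : ∑ j ∈ s with p j, a j = Z ^ e i * #{j ∈ s | p j} := by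
      rw [mul_comm, ← smul_eq_mul, ← sum_const]
      refine sum_congr rfl fun j hj => ?_
      obtain ⟨hjs, hj0, hje⟩ := mem_filter.1 hj
      rw [← hje]
      exact (ha j hjs).resolve_left hj0
    have hpos : 0 < Z := by omega
    rw [h3, pow_succ, Nat.mul_dvd_mul_iff_left (pow_pos hpos _)] at h2
    have h4 : 0 < #{j ∈ s | p j} := card_pos.2 ⟨i, mem_filter.2 ⟨his, hi0, rfl⟩⟩
    have h5 := Nat.le_of_dvd h4 h2
    have h6 : #{j ∈ s | p j} ≤ #s := card_filter_le _ _
    omega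
  · intro h
    refine dvd_sum fun i hi => ?_
    rcases ha i hi with h0 | h0
    · simp [h0]
    · by_cases hi0 : a i = 0
      · simp [hi0]
      · rw [h0]
        exact pow_dvd_pow Z (h i hi hi0)

/-- `col` assigns one of `g` colors to each resource, and different colors to neighbors. -/
def Proper (nbr : ℕ → ℕ → Bool) (k g : ℕ) (col : ℕ → ℕ) : Prop :=
  (∀ v < k, col v < g) ∧ ∀ a < k, ∀ b < k, a ≠ b → nbr a b = true → col a ≠ col b

/-- The test for colorings of small cost. -/
theorem not_pow_dvd_coverTotal_iff {nbr : ℕ → ℕ → Bool} {k g Z W : ℕ} {w cost : ℕ → ℕ → ℕ}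
    (hZ : 2 * (2 ^ k) ^ g ≤ Z)
    (hw : ∀ c < g, ∀ v < k, w c v = 0 ∨ w c v = Z ^ cost c v) :
    ¬ Z ^ W ∣ coverTotal nbr k g w ↔
      ∃ col, (Proper nbr k g col ∧ ∑ v ∈ range k, cost (col v) v < W) ∧
        ∀ v < k, w (col v) v ≠ 0 := by
  have hmem : ∀ τ ∈ covers nbr k g, ∀ c, ∀ v ∈ τ c, v < k := fun τ hτ c v hv =>
    mem_range.1 ((mem_covers.1 hτ).2 ▸ mem_biUnion.2 ⟨c, mem_univ _, hv⟩)
  have ha : ∀ τ ∈ covers nbr k g, (∏ c : Fin g, ∏ v ∈ τ c, w c v) = 0 ∨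
      (∏ c : Fin g, ∏ v ∈ τ c, w c v) = Z ^ ∑ c : Fin g, ∑ v ∈ τ c, cost c v := by
    intro τ hτ
    by_cases h : (∏ c : Fin g, ∏ v ∈ τ c, w c v) = 0
    · exact Or.inl h
    · right
      simp only [prod_eq_zero_iff, mem_univ, true_and, not_exists, not_and] at h
      rw [← prod_pow_eq_pow_sum]
      refine prod_congr rfl fun c _ => ?_
      rw [← prod_pow_eq_pow_sum]
      exact prod_congr rfl fun v hv => (hw c c.2 v (hmem τ hτ c v hv)).resolve_left (h c v hv)
  rw [coverTotal_eq, pow_dvd_sum_iff ((card_covers_lt nbr k g).trans_le hZ) ha]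
  push Not
  constructor
  · rintro ⟨τ, hτ, h0, hW⟩
    simp only [ne_eq, prod_eq_zero_iff, mem_univ, true_and, not_exists, not_and] at h0
    obtain ⟨hI, hU⟩ := mem_covers.1 hτ
    -- A cover may contain a resource several times. Keeping one color per resource cannot raise the
    -- cost, as every pair kept is also counted in the cover.
    have hex : ∀ v, ∃ c : ℕ, v < k → ∃ h : c < g, v ∈ τ ⟨c, h⟩ := by
      intro v
      by_cases hv : v < k
      · obtain ⟨c, _, hc⟩ := mem_biUnion.1 (hU.ge (mem_range.2 hv))
        exact ⟨c, fun _ => ⟨c.2, hc⟩⟩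
      · exact ⟨0, fun h => absurd h hv⟩
    choose col hcol using hex
    refine ⟨col, ⟨⟨fun v hv => (hcol v hv).1, fun a hak b hbk hab hn hc => ?_⟩, ?_⟩, ?_⟩
    · obtain ⟨h1, h2⟩ := hcol a hak
      obtain ⟨h3, h4⟩ := hcol b hbk
      have h5 : b ∈ τ ⟨col a, h1⟩ := by simpa only [hc] using h4
      rw [hI _ a h2 b h5 hab] at hn
      exact Bool.false_ne_true hn
    · refine lt_of_le_of_lt ?_ hW
      rw [← sum_fiberwise_of_maps_to (s := range k) (t := range g) (g := col)
        (fun v hv => mem_range.2 (hcol v (mem_range.1 hv)).1), sum_range]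
      refine sum_le_sum fun c _ => ?_
      rw [sum_congr rfl (g := fun v => cost c v) fun v hv => by rw [(mem_filter.1 hv).2]]
      refine sum_le_sum_of_subset fun v hv => ?_
      obtain ⟨hv, hvc⟩ := mem_filter.1 hv
      obtain ⟨h1, h2⟩ := hcol v (mem_range.1 hv)
      simpa only [hvc] using h2
    · intro v hv
      obtain ⟨h1, h2⟩ := hcol v hv
      exact h0 ⟨col v, h1⟩ v h2
  -- Conversely, the color classes form a cover containing each resource once, so its exponent
  -- equals the cost.
  · rintro ⟨col, ⟨⟨hg, hp⟩, hW⟩, h0⟩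
    refine ⟨fun c => {v ∈ range k | col v = c}, mem_covers.2 ⟨fun c a ha b hb hab => ?_, ?_⟩,
      ?_, ?_⟩
    · obtain ⟨ha, hac⟩ := mem_filter.1 ha
      obtain ⟨hb, hbc⟩ := mem_filter.1 hb
      by_contra hn
      exact hp a (mem_range.1 ha) b (mem_range.1 hb) hab (by simpa using hn) (hac.trans hbc.symm)
    · ext v
      simp only [mem_biUnion, mem_univ, true_and, mem_filter]
      exact ⟨fun ⟨c, h, _⟩ => h, fun h => ⟨⟨col v, hg v (mem_range.1 h)⟩, h, rfl⟩⟩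
    · simp only [ne_eq, prod_eq_zero_iff, mem_univ, true_and, not_exists, not_and, mem_filter,
        mem_range, and_imp]
      rintro c v hv rfl'
      rw [← rfl']
      exact h0 v hv
    · refine lt_of_eq_of_lt ?_ hW
      rw [← sum_fiberwise_of_maps_to (s := range k) (t := range g) (g := col)
        (fun v hv => mem_range.2 (hg v (mem_range.1 hv))), sum_range]
      refine sum_congr rfl fun c _ => sum_congr rfl fun v hv => by rw [(mem_filter.1 hv).2]

/-! ## Colorings by masks -/

/-- `f` assigns to each resource a nonempty set of authorized users, and different sets to the
resources of a constraint. -/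
def MaskColoring (n k : ℕ) (base rel : ℕ → ℕ → Bool) (f : ℕ → ℕ) : Prop :=
  (∀ r < k, f r ≠ 0 ∧ bits (f r) ⊆ baseSet n base r) ∧
    ∀ a < k, ∀ b < k, rel a b = true → f a ≠ f b

/-- A coloring can be replaced by a coloring from a rich collection, without loss of size. -/
theorem MaskColoring.exists_rich {n k : ℕ} {base rel : ℕ → ℕ → Bool} {G : Finset ℕ}
    (hG0 : 0 ∉ G) (hG : ∀ r < k, Rich n base r k G) {f : ℕ → ℕ}
    (hf : MaskColoring n k base rel f) :
    ∃ f', MaskColoring n k base rel f' ∧ (∀ r < k, f' r ∈ G) ∧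
      ∀ r < k, #(bits (f r)) ≤ #(bits (f' r)) := by
  have key : ∀ j ≤ k, ∃ f', MaskColoring n k base rel f' ∧ (∀ r < j, f' r ∈ G) ∧
      ∀ r < k, #(bits (f r)) ≤ #(bits (f' r)) := by
    intro j
    induction j with
    | zero => exact fun _ => ⟨f, hf, by simp, fun _ _ => le_rfl⟩
    | succ j ih =>
      intro hj
      obtain ⟨f', hf', hfG, hle⟩ := ih (by omega)
      by_cases hfj : f' j ∈ G
      · refine ⟨f', hf', fun r hr => ?_, hle⟩
        rcases Nat.lt_succ_iff_lt_or_eq.1 hr with h | rfl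
        · exact hfG r h
        · exact hfj
      · obtain ⟨F, hFG, hFk, hF⟩ := hG j hj (f' j) (hf'.1 j hj).1 (hf'.1 j hj).2 hfj
        -- The other resources use at most `k - 1` colors, so one of the `k` dominators is unused
        -- and can replace the color of `j`.
        have hcard : #(((range k).erase j).image f') < #F := by
          refine lt_of_le_of_lt card_image_le ?_
          rw [card_erase_of_mem (mem_range.2 hj), card_range]
          omega
        obtain ⟨x, hxF, hx⟩ := exists_mem_notMem_of_card_lt_card hcard
        have hx' : ∀ r < k, r ≠ j → f' r ≠ x := fun r hr hrj h =>
          hx (mem_image.2 ⟨r, mem_erase.2 ⟨hrj, mem_range.2 hr⟩, h⟩)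
        refine ⟨Function.update f' j x, ⟨fun r hr => ?_, fun a ha b hb hab => ?_⟩, fun r hr => ?_,
          fun r hr => ?_⟩
        · by_cases h : r = j
          · subst h
            rw [Function.update_self]
            exact ⟨fun h0 => hG0 (h0 ▸ hFG hxF), (hF x hxF).1⟩
          · rw [Function.update_of_ne h]
            exact hf'.1 r hr
        · have hne : a ≠ b := fun h => hf'.2 a ha b hb hab (h ▸ rfl)
          by_cases h1 : a = j
          · rw [h1, Function.update_self, Function.update_of_ne (h1 ▸ hne.symm)]
            exact (hx' b hb (h1 ▸ hne.symm)).symm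
          · rw [Function.update_of_ne h1]
            by_cases h2 : b = j
            · rw [h2, Function.update_self]
              exact hx' a ha h1
            · rw [Function.update_of_ne h2]
              exact hf'.2 a ha b hb hab
        · by_cases h : r = j
          · rw [h, Function.update_self]
            exact hFG hxF
          · rw [Function.update_of_ne h]
            exact hfG r (by omega)
        · by_cases h : r = j
          · rw [h, Function.update_self]
            exact (hle j hj).trans (hF x hxF).2
          · rw [Function.update_of_ne h]
            exact hle r hr
  exact key k le_rfl

/-! ### Costs of colors, and colorings by masks versus proper colorings -/

section Weights

variable {n k g Z : ℕ} {base rel : ℕ → ℕ → Bool} {γ : ℕ → ℕ}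

/-- The number of authorized users of `v` that color `c` lacks. -/
def colorCost (n : ℕ) (base : ℕ → ℕ → Bool) (γ : ℕ → ℕ) (c v : ℕ) : ℕ :=
  #(baseSet n base v \ bits (γ c))

theorem colorCost_le (c v : ℕ) : colorCost n base γ c v ≤ n :=
  (card_le_card (sdiff_subset.trans (filter_subset _ _))).trans_eq (card_range n)

theorem initialWeight_eq {c v : ℕ} (hc : γ c < 2 ^ n) :
    initialWeight n base rel γ Z c v = 0 ∨
      initialWeight n base rel γ Z c v = Z ^ colorCost n base γ c v := by
  unfold initialWeight
  by_cases h : bits (γ c) ⊆ baseSet n base v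
  · rw [maskWeight_eq h]
    cases rel v v <;> simp [colorCost]
  · left
    rw [maskWeight_eq_zero hc h, zero_mul]

theorem initialWeight_ne_zero (hZ : 0 < Z) {c v : ℕ} (hc : γ c < 2 ^ n) :
    initialWeight n base rel γ Z c v ≠ 0 ↔ bits (γ c) ⊆ baseSet n base v ∧ rel v v = false := by
  unfold initialWeight
  by_cases h : bits (γ c) ⊆ baseSet n base v
  · rw [maskWeight_eq h]
    cases rel v v <;> simp [h, hZ.ne']
  · simp [maskWeight_eq_zero hc h, h]

/-- By `hinj`, different color indices stand for different sets. `Proper` ignores constraints of a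
resource with itself; the nonzero weights exclude those. -/
theorem maskColoring_of_proper (hZ : 0 < Z) (h0 : ∀ c < g, γ c ≠ 0) (hγ : ∀ c < g, γ c < 2 ^ n)
    (hinj : ∀ i < g, ∀ j < g, γ i = γ j → i = j) {col : ℕ → ℕ}
    (hcol : Proper (symmRel rel) k g col)
    (hw : ∀ v < k, initialWeight n base rel γ Z (col v) v ≠ 0) :
    MaskColoring n k base rel fun v => γ (col v) := by
  have hw' := fun v hv => (initialWeight_ne_zero hZ (hγ _ (hcol.1 v hv))).1 (hw v hv)
  refine ⟨fun v hv => ⟨h0 _ (hcol.1 v hv), (hw' v hv).1⟩, fun a ha b hb hab he => ?_⟩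
  have hc := hinj _ (hcol.1 a ha) _ (hcol.1 b hb) he
  by_cases h : a = b
  · subst h
    rw [(hw' a ha).2] at hab
    exact Bool.false_ne_true hab
  · exact hcol.2 a ha b hb h (by simp [symmRel, hab]) hc

theorem exists_proper_of_maskColoring (hZ : 0 < Z) (hγ : ∀ c < g, γ c < 2 ^ n) {f : ℕ → ℕ}
    (hf : MaskColoring n k base rel f) (hfG : ∀ r < k, f r ∈ colorSet γ g) :
    ∃ col, Proper (symmRel rel) k g col ∧ (∀ v < k, γ (col v) = f v) ∧
      ∀ v < k, initialWeight n base rel γ Z (col v) v ≠ 0 := by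
  have hex : ∀ v, ∃ c, v < k → c < g ∧ γ c = f v := by
    intro v
    by_cases hv : v < k
    · obtain ⟨c, hc, h⟩ := mem_image.1 (hfG v hv)
      exact ⟨c, fun _ => ⟨mem_range.1 hc, h⟩⟩
    · exact ⟨0, fun h => absurd h hv⟩
  choose col hcol using hex
  refine ⟨col, ⟨fun v hv => (hcol v hv).1, fun a ha b hb _ hn he => ?_⟩,
    fun v hv => (hcol v hv).2, fun v hv => ?_⟩
  · have hfe : f a = f b := by rw [← (hcol a ha).2, ← (hcol b hb).2, he]
    simp only [symmRel, Bool.or_eq_true] at hn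
    rcases hn with hn | hn
    · exact hf.2 a ha b hb hn hfe
    · exact hf.2 b hb a ha hn hfe.symm
  · rw [initialWeight_ne_zero hZ (hγ _ (hcol v hv).1), (hcol v hv).2]
    refine ⟨(hf.1 v hv).2, ?_⟩
    by_contra h
    exact hf.2 v hv v hv (by simpa using h) rfl

/-- Cost and total size have a constant sum, so least cost means largest size. -/
theorem sum_colorCost_add {col : ℕ → ℕ} (h : ∀ v < k, bits (γ (col v)) ⊆ baseSet n base v) :
    ∑ v ∈ range k, colorCost n base γ (col v) v + ∑ v ∈ range k, #(bits (γ (col v)))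
      = ∑ v ∈ range k, #(baseSet n base v) := by
  rw [← sum_add_distrib]
  exact sum_congr rfl fun v hv => card_sdiff_add_card_eq_card (h v (mem_range.1 hv))

end Weights

end APEP

namespace APEP

open Finset

/-! ## Correctness of the program on input words -/

theorem weightsSteps_mono {n k g g' : ℕ} (h : g ≤ g') :
    g * (k * (n * 5 + 8) + 7) + 6 ≤ g' * (k * (n * 5 + 8) + 7) + 6 :=
  Nat.add_le_add_right (Nat.mul_le_mul_right _ h) 6

theorem totalSteps_mono {E k g g' : ℕ} (h : g ≤ g') : totalSteps E k g ≤ totalSteps E k g' := by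
  unfold totalSteps
  gcongr

/-- A bound for the number of steps of the program, where `E = 2 ^ k`. -/
def solveSteps (E k n m : ℕ) : ℕ :=
  (k * (E * 3 + 5) + 3) + ((m * 3 + 2) + ((k * (k * (searchSteps n k + 7) + n * 4 + 8) + 6) +
    ((k * k * (k * (n * 5 + 8) + 7) + 6) + (totalSteps E k (k * k) +
      (((k * n * 5 + 8) + ((k * k * (k * (totalSteps E k (k * k) + 7) + 4) + 2) +
        (k * k * (k * (n * 4 + 7) + 4) + 3))) + 1 + 1)))))

section Solve

variable {B n k m : ℕ} {fst snd : ℕ → ℕ} {base : ℕ → ℕ → Bool} {s : Memory}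

/-- The bit budget: `g ≤ k * k` gives `Z ≤ 2 ^ (1 + k * (k * k))`, and weights are at most `Z ^ n`.
Then `hH` makes room for the totals and `hZB` for the powers of `Z` up to exponent `k * n + 1`. -/
theorem wp_solve (hB3 : 3 ≤ B) (hin : IsInput (s 0) n k m fst snd base)
    (hsnd : ∀ j < m, snd j < k) (hs : ∀ b, b ≠ 0 → s b = 0)
    (hn : n < 2 ^ B) (hm : m < 2 ^ B) (hkk : k * k < B)
    (hH : ((1 + k * (k * k)) * n + 1) * k * (k * k) + k < B)
    (hZB : (1 + k * (k * k)) * (k * n + 1) < B) :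
    WP B Prog.solve s (solveSteps (2 ^ k) k n m) fun s' =>
      (s' 1 0 = 0 ∧ ∀ f, ¬ MaskColoring n k base (constraintRel m fst snd) f) ∨
      (s' 1 0 = 1 ∧ ∃ f, MaskColoring n k base (constraintRel m fst snd) f ∧
        (∀ f', MaskColoring n k base (constraintRel m fst snd) f' →
          ∑ r ∈ range k, #(bits (f' r)) ≤ ∑ r ∈ range k, #(bits (f r))) ∧
        ∀ r < k, ∀ u < n, s' 1 (1 + u * k + r) = ((f r).testBit u).toNat) := by
  have hB8 := eight_le_two_pow hB3
  have hBlt : B < 2 ^ B := Nat.lt_two_pow_self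
  have hkle : k ≤ k * k := Nat.le_mul_self k
  have hknB : k * n + 1 < B := (Nat.le_mul_of_pos_left _ (by omega)).trans_lt hZB
  have hnB : 0 < k → (1 + k * (k * k)) * n + 1 < B := by
    intro hk
    refine lt_of_le_of_lt ?_ hH
    rw [mul_assoc]
    exact (Nat.le_mul_of_pos_right _ (by positivity)).trans (Nat.le_add_right _ _)
  have hn2 : 0 < k → 2 ^ n < 2 ^ B := by
    intro hk
    refine Nat.pow_lt_pow_right (by norm_num) (lt_of_le_of_lt ?_ (hnB hk))
    exact (Nat.le_mul_of_pos_left _ (by omega)).trans (Nat.le_add_right _ _)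
  set rel := constraintRel m fst snd with hrel
  refine WP.call (wp_parities hB3 hin (hs 4 (by decide)) (by omega)) fun s₁ hf₁ ⟨h2, h4⟩ => ?_
  refine WP.call (wp_adjacency hB3
    (n := n) (k := k) (m := m) (fst := fst) (snd := snd) (base := base)
    (by rw [hf₁ 0 rfl]; exact hin)
    ((hf₁ 3 rfl).trans (hs 3 (by decide))) hsnd hm) fun s₂ hf₂ h3 => ?_
  have a0 : s₂ 0 = s 0 := (hf₂ 0 rfl).trans (hf₁ 0 rfl)
  refine WP.call (wp_colors hB3
    (n := n) (k := k) (m := m) (fst := fst) (snd := snd) (base := base)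
    (by rw [a0]; exact hin)
    ((hf₂ 5 rfl).trans ((hf₁ 5 rfl).trans (hs 5 (by decide)))) hn hn2 (by omega) (by omega))
    fun s₃ hf₃ ⟨hC, hgk, hR⟩ => ?_
  set g := s₃ 7 0 with hg
  set γ := s₃ 6 with hγ
  have hgB : g < 2 ^ B := by omega
  have b0 : s₃ 0 = s 0 := (hf₃ 0 rfl).trans a0
  have b2 : s₃ 2 0 = 2 ^ k := (congrFun ((hf₃ 2 rfl).trans (hf₂ 2 rfl)) 0).trans h2
  have b3 : s₃ 3 = s₂ 3 := hf₃ 3 rfl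
  have b4 : s₃ 4 = s₁ 4 := (hf₃ 4 rfl).trans (hf₂ 4 rfl)
  set Z := 2 * (2 ^ k) ^ g with hZ
  have hZ2 : 2 ≤ Z := by
    have : 0 < (2 ^ k) ^ g := by positivity
    omega
  have hZle : Z ≤ 2 ^ (1 + k * (k * k)) := by
    rw [hZ, ← pow_mul, ← pow_succ']
    exact Nat.pow_le_pow_right (by norm_num) (by
      have := Nat.mul_le_mul_left k hgk
      omega)
  have hZpow : ∀ e, (1 + k * (k * k)) * e < B → Z ^ e < 2 ^ B := by
    intro e he
    refine (Nat.pow_le_pow_left hZle e).trans_lt ?_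
    rw [← pow_mul]
    exact Nat.pow_lt_pow_right (by norm_num) he
  have hZn : 0 < k → Z ^ n < 2 ^ B := fun hk => hZpow n (by have := hnB hk; omega)
  have hZlt : Z < 2 ^ B := by
    have := hZpow 1 (lt_of_le_of_lt (Nat.mul_le_mul_left _ (Nat.le_add_left 1 _)) hZB)
    simpa using this
  refine WP.call ((wp_weights hB3
    (n := n) (k := k) (m := m) (fst := fst) (snd := snd) (base := base)
    (by rw [b0]; exact hin) b2 (rel := rel)
    (by rw [b3]; exact h3) rfl hC.lt hn (by omega) hgB hZlt hZn).mono (weightsSteps_mono hgk))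
    fun s₄ hf₄ ⟨h9, h23⟩ => ?_
  set w₀ := initialWeight n base rel γ Z with hw₀
  have hw : ∀ c < g, ∀ v < k, w₀ c v + 1 ≤ 2 ^ ((1 + k * (k * k)) * n + 1) := by
    intro c hc v hv
    have h1 : w₀ c v ≤ Z ^ n := by
      rcases initialWeight_eq (base := base) (rel := rel) (Z := Z) (v := v) (hC.lt c hc) with h | h
      · exact h.trans_le (Nat.zero_le _)
      · exact h.trans_le (Nat.pow_le_pow_right (by omega) (colorCost_le c v))
    have h2 : Z ^ n ≤ 2 ^ ((1 + k * (k * k)) * n) := by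
      rw [pow_mul]
      exact Nat.pow_le_pow_left hZle n
    have h3 : 0 < 2 ^ ((1 + k * (k * k)) * n) := by positivity
    rw [pow_succ]
    omega
  have hHg : ((1 + k * (k * k)) * n + 1) * k * g + k < B :=
    (Nat.add_le_add_right (Nat.mul_le_mul_left _ hgk) k).trans_lt hH
  have c0 : s₄ 0 = s 0 := (hf₄ 0 rfl).trans b0
  have c1 : s₄ 0 1 = k := (congrFun c0 1).trans hin.numR
  have c2 : s₄ 2 0 = 2 ^ k := (congrFun (hf₄ 2 rfl) 0).trans b2
  have c3 : s₄ 3 = s₂ 3 := (hf₄ 3 rfl).trans b3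
  have c4 : s₄ 4 = s₁ 4 := (hf₄ 4 rfl).trans b4
  have c7 : s₄ 7 0 = g := congrFun (hf₄ 7 rfl) 0
  refine WP.call ((wp_total hB3 c1 c2 (rel := rel) (by rw [c3]; exact h3)
    (by rw [c4]; exact h4) c7 h23 hw hHg hgB).mono (totalSteps_mono hgk)) fun s₅ hf₅ h38 => ?_
  set P := coverTotal (symmRel rel) k g w₀ with hP
  have htest : ∀ W (w : ℕ → ℕ → ℕ), (∀ c < g, ∀ v < k, w c v = 0 ∨ w c v = w₀ c v) →
      (¬ Z ^ W ∣ coverTotal (symmRel rel) k g w ↔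
      ∃ col, (Proper (symmRel rel) k g col ∧
        ∑ v ∈ range k, colorCost n base γ (col v) v < W) ∧ ∀ v < k, w (col v) v ≠ 0) := by
    intro W w hsub
    refine not_pow_dvd_coverTotal_iff le_rfl fun c hc v hv => ?_
    rcases hsub c hc v hv with h | h
    · exact Or.inl h
    · rw [h]
      exact initialWeight_eq (hC.lt c hc)
  have htest₀ := fun W => htest W w₀ fun _ _ _ _ => Or.inr rfl
  have hG0 : 0 ∉ colorSet γ g := by
    intro h
    obtain ⟨i, hi, h⟩ := mem_image.1 h
    exact hC.ne_zero i (mem_range.1 hi) h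
  have hcolor : ∀ f, MaskColoring n k base rel f → ∃ col, Proper (symmRel rel) k g col ∧
      (∀ v < k, w₀ (col v) v ≠ 0) ∧ ∀ v < k, #(bits (f v)) ≤ #(bits (γ (col v))) := by
    intro f hf
    obtain ⟨f', hf', hfG, hle⟩ := hf.exists_rich hG0 hR
    obtain ⟨col, h1, h2, h3⟩ := exists_proper_of_maskColoring (Z := Z) (by omega) hC.lt hf' hfG
    exact ⟨col, h1, h3, fun v hv => by rw [h2 v hv]; exact hle v hv⟩
  refine WP.ite (N₂ := 1) (fun hg0 => ?_) fun hg0 => ?_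
  all_goals rw [Expr.eval_reg, h38] at hg0
  · have hex : ∃ W ≤ k * n + 1, ¬ Z ^ W ∣ P := by
      -- The total is positive and less than `Z ^ P`, so the test yields some coloring; its cost is
      -- at most `k * n`, which brings the exponent down to `k * n + 1`.
      have h1 : ¬ Z ^ P ∣ P := by
        intro hd
        have := Nat.le_of_dvd (by omega) hd
        have h2 : P < Z ^ P := Nat.lt_pow_self hZ2
        omega
      obtain ⟨col, ⟨hcol, _⟩, hsupp⟩ := (htest₀ P).1 h1
      refine ⟨k * n + 1, le_rfl, (htest₀ _).2 ⟨col, ⟨hcol, Nat.lt_succ_of_le ?_⟩, hsupp⟩⟩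
      calc ∑ v ∈ range k, colorCost n base γ (col v) v ≤ ∑ _v ∈ range k, n :=
            sum_le_sum fun v _ => colorCost_le _ _
        _ = k * n := by simp
    have d0 : s₅ 0 = s 0 := (hf₅ 0 rfl).trans c0
    refine WP.call (wp_modulus hB3 ((congrFun d0 0).trans hin.numU)
      ((congrFun d0 1).trans hin.numR) h38 (Z := Z) ((congrFun (hf₅ 9 rfl) 0).trans h9)
      (one_le_two.trans hZ2)
      (hZpow _ hZB) (by omega) hex) fun s₆ hf₆ ⟨W, h39, hWP, hWmin⟩ => ?_
    have e0 : s₆ 0 = s 0 := (hf₆ 0 rfl).trans d0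
    have e3 : s₆ 3 = s₂ 3 := (hf₆ 3 rfl).trans ((hf₅ 3 rfl).trans c3)
    have e4 : s₆ 4 = s₁ 4 := (hf₆ 4 rfl).trans ((hf₅ 4 rfl).trans c4)
    have e23 : s₆ 23 = s₄ 23 := (hf₆ 23 rfl).trans (hf₅ 23 rfl)
    have hkB : k < 2 ^ B := by omega
    refine WP.call ((wp_reduce hB3 ((congrFun e0 1).trans hin.numR)
      ((congrFun ((hf₆ 2 rfl).trans (hf₅ 2 rfl)) 0).trans c2) (rel := rel)
      (by rw [e3]; exact h3) (by rw [e4]; exact h4)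
      ((congrFun ((hf₆ 7 rfl).trans (hf₅ 7 rfl)) 0).trans c7) (w₀ := w₀)
      (by rw [e23]; exact h23) hw hHg hgB hkB h39
      (Good := fun col => Proper (symmRel rel) k g col ∧
        ∑ v ∈ range k, colorCost n base γ (col v) v < W) (fun col h => h.1.1)
      (fun w hsub => by rw [← htest W w hsub, Nat.dvd_iff_mod_eq_zero])
      (by rwa [Ne, ← Nat.dvd_iff_mod_eq_zero])).mono
      (N' := k * k * (k * (totalSteps (2 ^ k) k (k * k) + 7) + 4) + 2) ?_)
      fun s₇ hf₇ ⟨col, ⟨hcol, hcost⟩, hsupp, hnz⟩ => ?_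
    · have := totalSteps_mono (E := 2 ^ k) (k := k) hgk
      gcongr
    have f0 : s₇ 0 = s 0 := (hf₇ 0 rfl).trans e0
    have f6 : s₇ 6 = γ := (hf₇ 6 rfl).trans ((hf₆ 6 rfl).trans ((hf₅ 6 rfl).trans (hf₄ 6 rfl)))
    have f7 : s₇ 7 0 = g := (congrFun ((hf₇ 7 rfl).trans
      ((hf₆ 7 rfl).trans (hf₅ 7 rfl))) 0).trans c7
    have hγB : ∀ c < g, γ c < 2 ^ B := by
      intro c hc
      refine (hC.lt c hc).trans (hn2 ?_)
      by_contra hk0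
      obtain rfl : k = 0 := by omega
      omega
    refine (wp_output hB3 ((congrFun f0 0).trans hin.numU) ((congrFun f0 1).trans hin.numR) f7
      hcol.1 hnz (by rw [f6]; exact hγB) hn hkB hgB).conseq ?_ fun s₈ _ ⟨hone, hout⟩ => ?_
    · gcongr
    · right
      rw [f6] at hout
      refine ⟨hone, fun v => γ (col v), ?_, fun f' hf' => ?_, hout⟩
      · exact maskColoring_of_proper (by omega) hC.ne_zero hC.lt hC.inj hcol hsupp
      · obtain ⟨col', hcol', hsupp', hle⟩ := hcolor f' hf'
        refine (sum_le_sum fun v hv => hle v (mem_range.1 hv)).trans ?_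
        have hsub : ∀ c : ℕ → ℕ, Proper (symmRel rel) k g c → (∀ v < k, w₀ (c v) v ≠ 0) →
            ∀ v < k, bits (γ (c v)) ⊆ baseSet n base v := fun c h1 h2 v hv =>
          ((initialWeight_ne_zero (by omega) (hC.lt _ (h1.1 v hv))).1 (h2 v hv)).1
        have s1 := sum_colorCost_add (hsub col hcol hsupp)
        have s2 := sum_colorCost_add (hsub col' hcol' hsupp')
        -- As `Z ^ (W - 1)` divides the total, no supported coloring costs less than `W - 1`, while
        -- `col` costs at most that. Here `W` is positive by `hcost`.
        have hmin : ¬ ∑ v ∈ range k, colorCost n base γ (col' v) v < W - 1 := fun h =>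
          (htest₀ (W - 1)).2 ⟨col', ⟨hcol', h⟩, hsupp'⟩ (hWmin _ (by omega))
        change _ ≤ ∑ v ∈ range k, #(bits (γ (col v)))
        omega
  · refine WP.skip (Or.inl ⟨?_, fun f hf => ?_⟩)
    · have h1 : s₅ 1 = s 1 := (hf₅ 1 rfl).trans ((hf₄ 1 rfl).trans ((hf₃ 1 rfl).trans
        ((hf₂ 1 rfl).trans (hf₁ 1 rfl))))
      rw [h1, hs 1 (by decide)]
      rfl
    · obtain ⟨col, h1, h2, _⟩ := hcolor f hf
      -- A coloring would make some power of `Z` fail to divide the total, but every power divides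
      -- 0.
      refine (htest₀ (∑ v ∈ range k, colorCost n base γ (col v) v + 1)).2
        ⟨col, ⟨h1, Nat.lt_succ_self _⟩, h2⟩ ?_
      rw [← hP, hg0]
      exact dvd_zero _

end Solve

end APEP

namespace APEP

open Finset

/-! ## The input word -/

theorem getD_flatMap {α : Type*} {f : α → List ℕ} {L : ℕ} {l : List α}
    (hL : ∀ a ∈ l, (f a).length = L) {i j : ℕ} (hi : i < l.length) (hj : j < L) :
    (l.flatMap f).getD (i * L + j) 0 = (f l[i]).getD j 0 := by
  induction l generalizing i with
  | nil => simp at hi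
  | cons a l ih =>
    have ha : (f a).length = L := hL a (by simp)
    rw [List.flatMap_cons]
    cases i with
    | zero =>
      rw [zero_mul, zero_add, List.getD_append _ _ _ _ (by omega)]
      rfl
    | succ i =>
      rw [List.getD_append_right _ _ _ _ (by rw [ha, add_mul]; omega)]
      have : (i + 1) * L + j - (f a).length = i * L + j := by rw [ha, add_mul]; omega
      rw [this, ih (fun a ha => hL a (List.mem_cons_of_mem _ ha)) (by simpa using hi)]
      rfl

theorem length_flatMap_of_length_eq {α : Type*} {f : α → List ℕ} {L : ℕ} {l : List α}
    (hL : ∀ a ∈ l, (f a).length = L) : (l.flatMap f).length = l.length * L := by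
  rw [List.length_flatMap, List.map_congr_left hL, List.map_const', List.sum_replicate,
    smul_eq_mul]

namespace Instance

variable (I : Instance)

/-- The base relation on natural numbers. -/
def baseRel (u r : ℕ) : Bool :=
  if h : u < I.numUsers ∧ r < I.numResources then
    decide ((⟨u, h.1⟩, ⟨r, h.2⟩) ∈ I.base) else false

/-- The resources of constraint `j`. -/
def constraintFst (j : ℕ) : ℕ := if h : j < I.constraints.length then I.constraints[j].fst else 0
def constraintSnd (j : ℕ) : ℕ := if h : j < I.constraints.length then I.constraints[j].snd else 0

theorem length_encode_constraint {k : ℕ} (c : Constraint (Fin k)) : c.encode.length = 4 := rfl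

theorem length_encode : I.encode.length
    = 3 + 4 * I.constraints.length + I.numUsers * I.numResources := by
  rw [encode, List.length_append, List.length_append,
    length_flatMap_of_length_eq (L := 4) fun c _ => length_encode_constraint c,
    length_flatMap_of_length_eq (L := I.numResources) fun c _ => by simp]
  simp [mul_comm]

theorem isInput : IsInput (I.initialMemory 0) I.numUsers I.numResources I.constraints.length
    I.constraintFst I.constraintSnd I.baseRel := by
  have hlen : (I.constraints.flatMap Constraint.encode).length = I.constraints.length * 4 :=
    length_flatMap_of_length_eq fun c _ => length_encode_constraint c
  have hcon : ∀ j (hj : j < I.constraints.length) i, i < 4 →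
      I.initialMemory 0 (3 + (j * 4 + i)) = (I.constraints[j].encode).getD i 0 := by
    intro j hj i hi
    simp only [initialMemory, if_true, encode]
    rw [List.getD_append _ _ _ _ (by simp only [List.length_append, hlen]; simp; omega),
      List.getD_append_right _ _ _ _ (by simp)]
    have : 3 + (j * 4 + i)
        - [I.numUsers, I.numResources, I.constraints.length].length = j * 4 + i := by simp
    rw [this, getD_flatMap (fun c _ => length_encode_constraint c) hj hi]
  refine ⟨rfl, rfl, rfl, fun j hj => ?_, fun j hj => ?_, fun u hu r hr => ?_⟩
  · have := hcon j hj 0 (by norm_num)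
    rw [show 3 + 4 * j = 3 + (j * 4 + 0) by ring, this, constraintFst, dif_pos hj]
    rfl
  · have := hcon j hj 1 (by norm_num)
    rw [show 4 + 4 * j = 3 + (j * 4 + 1) by ring, this, constraintSnd, dif_pos hj]
    rfl
  · simp only [initialMemory, if_true, encode]
    rw [List.getD_append_right _ _ _ _ (by simp only [List.length_append, hlen]; simp; omega)]
    have : 3 + 4 * I.constraints.length + u * I.numResources + r
        - ([I.numUsers, I.numResources, I.constraints.length]
          ++ I.constraints.flatMap Constraint.encode).length = u * I.numResources + r := by
      rw [List.length_append, hlen]; simp; omega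
    rw [this, getD_flatMap (L := I.numResources) (fun c _ => by simp) (by simpa using hu) hr]
    rw [List.getD_eq_getElem _ _ (by simpa using hr)]
    simp [baseRel, hu, hr]

theorem initialMemory_of_ne {b : ℕ} (hb : b ≠ 0) : I.initialMemory b = 0 := by
  funext a; simp [initialMemory, hb]

theorem constraintSnd_lt {j : ℕ} (hj : j < I.constraints.length) :
    I.constraintSnd j < I.numResources := by
  rw [constraintSnd, dif_pos hj]
  exact Fin.is_lt _

theorem length_encode_le_size : I.encode.length ≤ I.size := by
  rw [size]
  generalize I.encode = l
  induction l with
  | nil => simp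
  | cons a l ih => simp only [List.length_cons, List.map_cons, List.sum_cons]; omega

theorem size_numUsers_le : I.numUsers.size ≤ I.size := by
  simp only [size, encode, List.append_assoc, List.cons_append, List.map_cons, List.sum_cons]
  omega

/-! ## Authorization relations and colorings by masks -/

/-- The relation between constrained resources. -/
abbrev conflict : ℕ → ℕ → Bool :=
  constraintRel I.constraints.length I.constraintFst I.constraintSnd

theorem conflict_iff {a b : ℕ} :
    I.conflict a b = true ↔ ∃ c ∈ I.constraints, (c.fst : ℕ) = a ∧ (c.snd : ℕ) = b := by
  simp only [conflict, constraintRel, decide_eq_true_eq]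
  constructor
  · rintro ⟨j, hj, h1, h2⟩
    rw [constraintFst, dif_pos hj] at h1
    rw [constraintSnd, dif_pos hj] at h2
    exact ⟨_, List.getElem_mem hj, h1, h2⟩
  · rintro ⟨c, hc, h1, h2⟩
    obtain ⟨j, hj, rfl⟩ := List.getElem_of_mem hc
    exact ⟨j, hj, by rw [constraintFst, dif_pos hj, h1], by rw [constraintSnd, dif_pos hj, h2]⟩

/-- A user in exactly one of the two sets lies in their union anyway. -/
theorem satisfies_iff {U R : Type} {A : Finset (U × R)} {c : Constraint R} (hop : c.op = .xor)
    (hq : c.quant = .ex) : Satisfies A c ↔ usersOf A c.fst ≠ usersOf A c.snd := by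
  simp only [Satisfies, hq, hop, LogicOp.Holds, Set.mem_union]
  rw [Ne, Set.ext_iff]
  push Not
  refine exists_congr fun u => ?_
  tauto

/-- The authorization relation of a function from resources to masks. -/
def ofMasks (f : ℕ → ℕ) : I.AuthRel := univ.filter fun x => (f x.2).testBit x.1 = true

/-- The masks of an authorization relation. -/
def toMasks (A : I.AuthRel) (r : ℕ) : ℕ :=
  if h : r < I.numResources then
    mask ((univ.filter fun u => (u, ⟨r, h⟩) ∈ A).map Fin.valEmbedding) else 0

variable {I}

theorem mem_baseSet {u r : ℕ} : u ∈ baseSet I.numUsers I.baseRel r ↔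
    ∃ (hu : u < I.numUsers) (hr : r < I.numResources), (⟨u, hu⟩, ⟨r, hr⟩) ∈ I.base := by
  rw [baseSet, mem_filter, mem_range, baseRel]
  constructor
  · rintro ⟨hu, h⟩
    split_ifs at h with h'
    · exact ⟨h'.1, h'.2, by simpa using h⟩
  · rintro ⟨hu, hr, h⟩
    exact ⟨hu, by simp [hu, hr, h]⟩

theorem mem_bits_toMasks {A : I.AuthRel} {r u : ℕ} (hr : r < I.numResources) :
    u ∈ bits (I.toMasks A r) ↔ ∃ hu : u < I.numUsers, (⟨u, hu⟩, ⟨r, hr⟩) ∈ A := by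
  rw [toMasks, dif_pos hr, bits_mask]
  simp only [mem_map, mem_filter, mem_univ, true_and, Fin.valEmbedding_apply]
  exact ⟨fun ⟨a, ha, h⟩ => ⟨h ▸ a.2, by subst h; exact ha⟩, fun ⟨hu, h⟩ => ⟨_, h, rfl⟩⟩

theorem ofMasks_toMasks (A : I.AuthRel) : I.ofMasks (I.toMasks A) = A := by
  ext ⟨u, r⟩
  simp only [ofMasks, mem_filter, mem_univ, true_and]
  rw [← mem_bits, mem_bits_toMasks r.2]
  exact ⟨fun ⟨_, h⟩ => h, fun h => ⟨u.2, h⟩⟩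

theorem card_ofMasks {f : ℕ → ℕ}
    (hf : ∀ r < I.numResources, bits (f r) ⊆ range I.numUsers) :
    #(I.ofMasks f) = ∑ r ∈ range I.numResources, #(bits (f r)) := by
  rw [sum_range, card_eq_sum_card_fiberwise (f := Prod.snd) (t := univ) fun _ _ => by simp]
  refine sum_congr rfl fun r _ => ?_
  refine card_bij (fun x _ => (x.1 : ℕ)) ?_ ?_ ?_
  · rintro ⟨u, r'⟩ hx
    obtain ⟨hx', rfl⟩ := mem_filter.1 hx
    exact mem_bits.2 (mem_filter.1 hx').2
  · rintro ⟨u, r'⟩ hx ⟨u', r''⟩ hx' h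
    obtain ⟨_, rfl⟩ := mem_filter.1 hx
    obtain ⟨_, h'⟩ := mem_filter.1 hx'
    exact Prod.ext (Fin.ext h) h'.symm
  · intro u hu
    refine ⟨(⟨u, mem_range.1 (hf r r.2 hu)⟩, r), ?_, rfl⟩
    exact mem_filter.2 ⟨mem_filter.2 ⟨mem_univ _, mem_bits.1 hu⟩, rfl⟩

theorem maskColoring_toMasks (hI : ∀ c ∈ I.constraints, c ∈ SoDE I.numResources) {A : I.AuthRel}
    (hA : I.Valid A) :
    MaskColoring I.numUsers I.numResources I.baseRel I.conflict (I.toMasks A) := by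
  obtain ⟨h1, h2, h3⟩ := hA
  refine ⟨fun r hr => ⟨fun h0 => ?_, fun u hu => ?_⟩, fun a ha b hb hab he => ?_⟩
  · obtain ⟨u, hu⟩ := h2 ⟨r, hr⟩
    have : (u : ℕ) ∈ bits (I.toMasks A r) := (mem_bits_toMasks hr).2 ⟨u.2, hu⟩
    rw [h0, bits_zero] at this
    exact notMem_empty _ this
  · obtain ⟨hu', h⟩ := (mem_bits_toMasks hr).1 hu
    exact mem_baseSet.2 ⟨hu', hr, h1 h⟩
  · obtain ⟨c, hc, rfl, rfl⟩ := (conflict_iff I).1 hab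
    refine (satisfies_iff (hI c hc).1 (hI c hc).2).1 (h3 c hc) ?_
    ext u
    have ha' := mem_bits_toMasks (A := A) (u := u) ha
    have hb' := mem_bits_toMasks (A := A) (u := u) hb
    rw [he, hb'] at ha'
    simpa [usersOf] using ha'.symm

theorem valid_ofMasks (hI : ∀ c ∈ I.constraints, c ∈ SoDE I.numResources) {f : ℕ → ℕ}
    (hf : MaskColoring I.numUsers I.numResources I.baseRel I.conflict f) :
    I.Valid (I.ofMasks f) := by
  have hmem : ∀ (u : Fin I.numUsers) (r : Fin I.numResources),
      (u, r) ∈ I.ofMasks f ↔ (u : ℕ) ∈ bits (f r) := by simp [ofMasks]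
  have hsub : ∀ r < I.numResources, bits (f r) ⊆ range I.numUsers := fun r hr =>
    (hf.1 r hr).2.trans (filter_subset _ _)
  refine ⟨?_, fun r => ?_, fun c hc => ?_⟩
  · rintro ⟨u, r⟩ hx
    obtain ⟨_, _, h⟩ := mem_baseSet.1 ((hf.1 r r.2).2 ((hmem u r).1 hx))
    exact h
  · have : (bits (f r)).Nonempty := by
      rw [nonempty_iff_ne_empty, ← bits_zero]
      exact fun h => (hf.1 r r.2).1 (bits_injective h)
    obtain ⟨u, hu⟩ := this
    exact ⟨⟨u, mem_range.1 (hsub r r.2 hu)⟩, (hmem _ _).2 hu⟩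
  · rw [satisfies_iff (hI c hc).1 (hI c hc).2]
    intro he
    refine hf.2 c.fst c.fst.2 c.snd c.snd.2 ((conflict_iff I).2 ⟨c, hc, rfl, rfl⟩)
      (bits_injective ?_)
    have key : ∀ u : Fin I.numUsers, (u : ℕ) ∈ bits (f c.fst) ↔ (u : ℕ) ∈ bits (f c.snd) := by
      intro u
      rw [← hmem, ← hmem]
      exact Set.ext_iff.1 he u
    ext u
    constructor <;> intro hu
    · exact (key ⟨u, mem_range.1 (hsub _ c.fst.2 hu)⟩).1 hu
    · exact (key ⟨u, mem_range.1 (hsub _ c.snd.2 hu)⟩).2 hu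

end Instance

/-! ## Polynomial bounds -/

/-- Functions given by a polynomial. -/
def IsPoly (f : ℕ → ℕ) : Prop := ∃ q : Polynomial ℕ, ∀ x, q.eval x = f x

namespace IsPoly

theorem const (c : ℕ) : IsPoly fun _ => c := ⟨.C c, fun x => by simp⟩

theorem id : IsPoly fun x => x := ⟨.X, fun x => by simp⟩

theorem add {f g : ℕ → ℕ} : IsPoly f → IsPoly g → IsPoly fun x => f x + g x := by
  rintro ⟨p, hp⟩ ⟨q, hq⟩
  exact ⟨p + q, fun x => by simp [hp, hq]⟩

theorem mul {f g : ℕ → ℕ} : IsPoly f → IsPoly g → IsPoly fun x => f x * g x := by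
  rintro ⟨p, hp⟩ ⟨q, hq⟩
  exact ⟨p * q, fun x => by simp [hp, hq]⟩

theorem pow {f : ℕ → ℕ} (d : ℕ) : IsPoly f → IsPoly fun x => f x ^ d := by
  rintro ⟨p, hp⟩
  exact ⟨p ^ d, fun x => by simp [hp]⟩

end IsPoly

/-- A bound for the number of bits of all cells. -/
def cellBits (L : ℕ) : ℕ := (L + 2) ^ 7

theorem isPoly_bound : IsPoly fun L => solveSteps 1 L L L * stepTime (cellBits L) := by
  unfold solveSteps totalSteps indepSteps searchSteps stepTime cellBits
  repeat' first
    | with_reducible exact IsPoly.const _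
    | with_reducible exact IsPoly.id
    | with_reducible apply IsPoly.add
    | with_reducible apply IsPoly.mul
    | with_reducible apply IsPoly.pow

theorem solveSteps_mono {E k n m L : ℕ} (hk : k ≤ L) (hn : n ≤ L) (hm : m ≤ L) :
    solveSteps E k n m ≤ solveSteps E L L L := by
  unfold solveSteps totalSteps indepSteps searchSteps
  gcongr

theorem solveSteps_le_mul {E L : ℕ} (hE : 1 ≤ E) :
    solveSteps E L L L ≤ E * solveSteps 1 L L L := by
  obtain ⟨e, rfl⟩ := Nat.exists_eq_add_of_le hE
  -- The step count S is affine in `E`, so S(1 + e) + e * S(0) = (1 + e) * S(1).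
  refine Nat.le.intro (k := e * solveSteps 0 L L L) ?_
  unfold solveSteps totalSteps indepSteps searchSteps
  ring

theorem solveSteps_le {k n m L : ℕ} (hk : k ≤ L) (hn : 0 < k → n ≤ L) (hm : m ≤ L) :
    solveSteps (2 ^ k) k n m ≤ 2 ^ k * solveSteps 1 L L L := by
  refine le_trans ?_ (solveSteps_le_mul Nat.one_le_two_pow)
  rcases Nat.eq_zero_or_pos k with rfl | h
  -- Without resources `n` may be exponential in the input size, but the step bound then does not
  -- depend on `n`.
  · have : solveSteps (2 ^ 0) 0 n m = solveSteps (2 ^ 0) 0 0 m := by simp [solveSteps]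
    rw [this]
    exact solveSteps_mono hk (Nat.zero_le _) hm
  · exact solveSteps_mono hk (hn h) hm

theorem cellBits_spec {k n L : ℕ} (hk : k ≤ L) (hkn : k * n ≤ L)
    (hn : 0 < k → n ≤ L) :
    3 ≤ cellBits L ∧ L ≤ cellBits L ∧ k * k < cellBits L ∧
      ((1 + k * (k * k)) * n + 1) * k * (k * k) + k < cellBits L ∧
      (1 + k * (k * k)) * (k * n + 1) < cellBits L := by
  have hexp : cellBits L = L ^ 7 + 14 * L ^ 6 + 84 * L ^ 5 + 280 * L ^ 4 + 560 * L ^ 3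
      + 672 * L ^ 2 + 448 * L + 128 := by unfold cellBits; ring
  have h1 : k * k ≤ L ^ 2 := by rw [sq]; gcongr
  -- The largest requirement; its degree 7 is the exponent in `cellBits`.
  have h2 : ((1 + k * (k * k)) * n + 1) * k * (k * k) + k ≤ L ^ 7 + L ^ 4 + L ^ 3 + L := by
    rcases Nat.eq_zero_or_pos k with rfl | h
    · simp
    · calc ((1 + k * (k * k)) * n + 1) * k * (k * k) + k
          ≤ ((1 + L * (L * L)) * L + 1) * L * (L * L) + L := by
            have := hn h
            gcongr
        _ = L ^ 7 + L ^ 4 + L ^ 3 + L := by ring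
  have h3 : (1 + k * (k * k)) * (k * n + 1) ≤ L ^ 4 + L ^ 3 + L + 1 := by
    calc (1 + k * (k * k)) * (k * n + 1) ≤ (1 + L * (L * L)) * (L + 1) := by gcongr
      _ = _ := by ring
  rw [hexp]
  refine ⟨by omega, by omega, by omega, by omega, by omega⟩

/-! ### Solvability of the two problems -/

theorem maxAPEP_solvable : SolvableInOStar maxAPEP SoDE fun k => 2 ^ k := by
  obtain ⟨q, hq⟩ := isPoly_bound
  refine ⟨Prog.solve, q, fun I hI => ?_⟩
  set L := I.size
  have hlen := I.length_encode_le_size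
  rw [I.length_encode] at hlen
  -- A nonempty base set needs a user. So for `0 < k` the matrix has at least `n` and at least `k`
  -- entries, and both numbers are bounded by the input size.
  have hn0 : 0 < I.numResources → 0 < I.numUsers := fun hk =>
    Fin.pos_iff_nonempty.2 ⟨(I.base_nonempty ⟨0, hk⟩).some⟩
  have hn : 0 < I.numResources → I.numUsers ≤ L := fun hk => by
    have := Nat.le_mul_of_pos_right I.numUsers hk
    omega
  have hk : I.numResources ≤ L := by
    rcases Nat.eq_zero_or_pos I.numResources with h | h
    · omega
    · have := Nat.le_mul_of_pos_left I.numResources (hn0 h)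
      omega
  have hkn : I.numResources * I.numUsers ≤ L := by rw [mul_comm]; omega
  obtain ⟨b1, b2, b3, b4, b5⟩ := cellBits_spec hk hkn hn
  have hpow : 2 ^ L ≤ 2 ^ cellBits L := Nat.pow_le_pow_right (by norm_num) b2
  have hLpow : L < 2 ^ L := Nat.lt_two_pow_self
  have hnB : I.numUsers < 2 ^ cellBits L :=
    (Nat.size_le.1 I.size_numUsers_le).trans_le hpow
  have hbounded : I.initialMemory.Bounded (cellBits L) := by
    refine ⟨b1, fun b a => ?_⟩
    simp only [Instance.initialMemory]
    split_ifs
    · rcases lt_or_ge a I.encode.length with ha | ha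
      · rw [List.getD_eq_getElem _ _ ha]
        refine (Nat.size_le.1 ?_).trans_le hpow
        have : I.encode[a].size + 1 ≤ I.size :=
          List.le_sum_of_mem (List.mem_map_of_mem (f := fun x => x.size + 1)
            (List.getElem_mem ha))
        omega
      · rw [List.getD_eq_default _ _ ha]
        positivity
    · positivity
  obtain ⟨s, t, hr, -, ht, hs⟩ := wp_solve b1 I.isInput (fun j hj => I.constraintSnd_lt hj)
    (fun b hb => I.initialMemory_of_ne hb) hnB (by omega) b3 b4 b5 hbounded
  refine ⟨s, t, hr, ?_, ?_⟩
  · rcases hs with ⟨h0, hno⟩ | ⟨h1, f, hf, hmax, hout⟩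
    · rw [Instance.answer, if_pos h0]
      exact fun A hA => hno _ (Instance.maskColoring_toMasks hI hA)
    · have hans : I.answer s = some (I.ofMasks f) := by
        rw [Instance.answer, if_neg (by omega)]
        congr 1
        ext ⟨u, r⟩
        simp only [Instance.ofMasks, mem_filter, mem_univ, true_and, hout r r.2 u u.2]
        cases (f r).testBit u <;> simp
      rw [hans]
      refine ⟨Instance.valid_ofMasks hI hf, fun A hA => ?_⟩
      have hA' := Instance.maskColoring_toMasks hI hA
      have h := hmax _ hA'
      rw [← Instance.card_ofMasks fun r hr => (hf.1 r hr).2.trans (filter_subset _ _),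
        ← Instance.card_ofMasks fun r hr => (hA'.1 r hr).2.trans (filter_subset _ _),
        Instance.ofMasks_toMasks] at h
      exact h
  · refine ht.trans ?_
    rw [hq, ← mul_assoc]
    exact Nat.mul_le_mul_right _ (solveSteps_le hk hn (by omega))

theorem dapep_of_maxAPEP {I : Instance} {ans : Option I.AuthRel} (h : maxAPEP I ans) :
    DAPEP I ans := by
  cases ans with
  | none => exact h
  | some A => exact h.1

end APEP

theorem mainTheorem4 :
    APEP.SolvableInOStar APEP.DAPEP APEP.SoDE (fun k => 2 ^ k) ∧
      APEP.SolvableInOStar APEP.maxAPEP APEP.SoDE (fun k => 2 ^ k) := by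
  refine ⟨?_, APEP.maxAPEP_solvable⟩
  obtain ⟨prog, q, h⟩ := APEP.maxAPEP_solvable
  refine ⟨prog, q, fun I hI => ?_⟩
  obtain ⟨s, t, hr, hans, ht⟩ := h I hI
  exact ⟨s, t, hr, APEP.dapep_of_maxAPEP hans, ht⟩
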